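/- Let $\widetilde C$ be a compact connected Riemann surface, let $\widetilde G$ be a finite abelian group acting on $\widetilde C$ by biholomorphic maps (for example, the Galois group of a Galois covering $\widetilde C\to\mathbb P^1$), and let $H\subseteq\widetilde G$ be a subgroup. For a character $\chi$ of $H$ let $H^0(\widetilde C,\omega_{\widetilde C})^{\chi}=\{\eta : h^*\eta=\chi(h)\eta \text{ for all } h\in H\}$, and put $$V_-=H^0(\widetilde C,\omega_{\widetilde C})_-=\bigoplus_{\chi\in \mathrm{Hom}(H,\mathbb C^*),\ \chi\ne 1}H^0(\widetilde C,\omega_{\widetilde C})^{\chi}.$$ Let $H_1(\widetilde C,\mathbb Z)_-$ be the subgroup of the classes in $H_1(\widetilde C,\mathbb Z)$ annihilated by $\sum_{h\in H}h$, and let $P=V_-^*/H_1(\widetilde C,\mathbb Z)_-$ be the Prym variety of $\widetilde C\to\widetilde C/H$, with the restriction $E$ of the canonical polarization of the Jacobian of $\widetilde C$ and with the induced action of $\widetilde G$. Let $\mathbb H$ be the Siegel space of all complex structures on the real vector space $V_-^*$ that are compatible with $E$ (that is, for which $E$ is the imaginary part of a positive definite Hermitian form), and let $A_{p,D}$ be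 the moduli space of polarized abelian varieties of the dimension $p$ and the type $D$ of $(P,E)$, i.e. the quotient of $\mathbb H$ by the group of the automorphisms of the lattice $H_1(\widetilde C,\mathbb Z)_-$ that preserve $E$. Let $N=\mathrm{GSp}(E)\cap \mathrm{GL}_{\mathbb Q[\widetilde G]}$, let $Y_N\subseteq\mathbb H$ be the set of the points whose Hodge structure $h$ factors through $N_{\mathbb R}$, let $Y^+$ be the connected component of $Y_N$ that contains the point given by $P$, and let $P(\widetilde G)\subseteq A_{p,D}$ be the image of $Y^+$. For a character $n$ of $\widetilde G$, with the group $\mathrm{Hom}(\widetilde G,\mathbb C^*)$ written additively, let $d_n$ be the dimension of the $n$-eigenspace of $\widetilde G$ on $V_-$. Then $$\dim P(\widetilde G)=\frac12\sum_{n:\,2n\neq0} d_n d_{-n}+\frac12\sum_{n:\,2n=0} d_n(d_n+1),$$ where $n$ runs through the characters of $\widetilde G$; so in the first part every unordered pair $\{n,-n\}$ with $2n\ne 0$ contributes $d_nd_{-n}$ exactly once. This dimension also equals $\dim (S^2V_-)^{\widetilde G}$. -/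

import Mathlib

open scoped Manifold ContDiff TensorProduct

noncomputable section

/-! ### Holomorphic one-forms on a Riemann surface and the action of a group on them -/

/-- `H⁰(X, ω_X)`: the holomorphic sections of the cotangent bundle of the Riemann surface `X`
(over the base field `ℂ`, being of class `C^ω` means being holomorphic). -/
abbrev HolomorphicOneForm (X : Type*) [TopologicalSpace X] [ChartedSpace ℂ X]
    [IsManifold 𝓘(ℂ) ω X] :=
  ContMDiffSection 𝓘(ℂ) (ℂ →L[ℂ] ℂ) ω
    (fun x : X => TangentSpace 𝓘(ℂ) x →L[ℂ] Bundle.Trivial X ℂ x)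

/-- The group `G` acts on the Riemann surface `X` by holomorphic (hence biholomorphic) maps. -/
class HolomorphicAction (G X : Type*) [Group G] [MulAction G X] [TopologicalSpace X]
    [ChartedSpace ℂ X] : Prop where
  contMDiff_smul : ∀ g : G, ContMDiff 𝓘(ℂ) 𝓘(ℂ) ω (fun x : X => g • x)

section Forms

variable {X : Type*} [TopologicalSpace X] [ChartedSpace ℂ X] [IsManifold 𝓘(ℂ) ω X]

theorem HolomorphicOneForm.contMDiff_pullback {φ : X → X} (hφ : ContMDiff 𝓘(ℂ) 𝓘(ℂ) ω φ)
    (η : HolomorphicOneForm X) :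
    ContMDiff 𝓘(ℂ) (𝓘(ℂ).prod 𝓘(ℂ, ℂ →L[ℂ] ℂ)) ω
      (fun x => Bundle.TotalSpace.mk' (ℂ →L[ℂ] ℂ)
        (E := fun x : X => TangentSpace 𝓘(ℂ) x →L[ℂ] Bundle.Trivial X ℂ x) x
        ((η (φ x)).comp (mfderiv 𝓘(ℂ) 𝓘(ℂ) φ x))) := by
  intro x₀
  rw [contMDiffAt_hom_bundle]
  refine ⟨contMDiffAt_id, ?_⟩
  have h1 : ContMDiffAt 𝓘(ℂ) 𝓘(ℂ, ℂ →L[ℂ] ℂ) ω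
      (inTangentCoordinates 𝓘(ℂ) 𝓘(ℂ) id φ (mfderiv 𝓘(ℂ) 𝓘(ℂ) φ) x₀) x₀ :=
    (hφ x₀).mfderiv_const (by simp)
  have h2 := ((contMDiffAt_hom_bundle _).1 (η.contMDiff (φ x₀))).2.comp x₀ (hφ x₀)
  have h3 := h2.clm_comp h1
  refine h3.congr_of_eventuallyEq ?_
  have e1 := (hφ.continuous.continuousAt (x := x₀)).preimage_mem_nhds
    ((trivializationAt ℂ (TangentSpace 𝓘(ℂ)) (φ x₀)).open_baseSet.mem_nhds
      (FiberBundle.mem_baseSet_trivializationAt' (φ x₀)))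
  filter_upwards [e1] with x hx
  ext
  simp only [ContinuousLinearMap.inCoordinates, inTangentCoordinates, Function.comp,
    ContinuousLinearMap.comp_apply, id]
  erw [Bundle.Trivialization.symmL_continuousLinearMapAt _ hx]
  rfl

variable {G : Type*} [CommGroup G] [MulAction G X] [HolomorphicAction G X]

/-- Pullback `g^*` of holomorphic one-forms along the automorphism `x ↦ g • x`:
`(g^* η)_x = η_{g x} ∘ d_x g`. -/
def formPullback (g : G) : HolomorphicOneForm X →ₗ[ℂ] HolomorphicOneForm X where
  toFun η := ⟨fun x => (η (g • x)).comp (mfderiv 𝓘(ℂ) 𝓘(ℂ) (fun y : X => g • y) x),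
    HolomorphicOneForm.contMDiff_pullback (HolomorphicAction.contMDiff_smul g) η⟩
  map_add' η θ := by
    ext x
    rfl
  map_smul' c η := by
    ext x
    rfl

theorem formPullback_mul (g h : G) (η : HolomorphicOneForm X) :
    formPullback h (formPullback g η) = formPullback (g * h) η := by
  refine ContMDiffSection.ext fun x => ?_
  have hd : ∀ (k : G) (y : X), MDifferentiableAt 𝓘(ℂ) 𝓘(ℂ) (fun y : X => k • y) y :=
    fun k y => (HolomorphicAction.contMDiff_smul k).mdifferentiable (by simp) y
  have hc : mfderiv 𝓘(ℂ) 𝓘(ℂ) (fun y : X => (g * h) • y) x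
      = (mfderiv 𝓘(ℂ) 𝓘(ℂ) (fun y : X => g • y) (h • x)).comp
          (mfderiv 𝓘(ℂ) 𝓘(ℂ) (fun y : X => h • y) x) := by
    have := mfderiv_comp x (hd g (h • x)) (hd h x)
    rw [← this]
    congr 1
    funext y
    exact mul_smul g h y
  change ((η (g • h • x)).comp (mfderiv 𝓘(ℂ) 𝓘(ℂ) (fun y : X => g • y) (h • x))).comp
      (mfderiv 𝓘(ℂ) 𝓘(ℂ) (fun y : X => h • y) x)
    = (η ((g * h) • x)).comp (mfderiv 𝓘(ℂ) 𝓘(ℂ) (fun y : X => (g * h) • y) x)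
  rw [hc]
  have key : ∀ y y' : X, y = y' → ∀ w : ℂ, (η y : ℂ → ℂ) w = (η y' : ℂ → ℂ) w := by
    rintro y _ rfl w
    rfl
  exact ContinuousLinearMap.ext fun w => key _ _ (mul_smul g h x).symm _

variable (X) in
/-- For a subgroup `K` of `G` and a character `χ` of `K`, the `χ`-eigenspace
`H⁰(X, ω_X)^χ = {η | k^* η = χ(k) η for all k ∈ K}`. -/
def formEigenspace (K : Subgroup G) (χ : K →* ℂˣ) :
    Submodule ℂ (HolomorphicOneForm X) where
  carrier := {η | ∀ k : K, formPullback (k : G) η = (χ k : ℂ) • η}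
  add_mem' {η θ} hη hθ k := (by
    rw [map_add, hη k, hθ k]
    exact (smul_add (χ k : ℂ) η θ).symm)
  zero_mem' k := by rw [map_zero, smul_zero]
  smul_mem' c η hη k := by rw [map_smul, hη k, smul_comm]

variable (X) in
/-- `H⁰(X, ω_X)₊ = H⁰(X, ω_X)^H`. -/
abbrev formsPlus (H : Subgroup G) :
    Submodule ℂ (HolomorphicOneForm X) :=
  formEigenspace X H 1

variable (X) in
/-- `H⁰(X, ω_X)₋`, the sum of the eigenspaces of the nontrivial characters of `H`. -/
def formsMinus (H : Subgroup G) :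
    Submodule ℂ (HolomorphicOneForm X) :=
  ⨆ (χ : H →* ℂˣ) (_ : χ ≠ 1), formEigenspace X H χ

theorem formPullback_mem_formsMinus (H : Subgroup G) (g : G) :
    ∀ η ∈ formsMinus X H, formPullback g η ∈ formsMinus X H := by
  have : formsMinus X H ≤ (formsMinus X H).comap (formPullback g) := by
    refine iSup₂_le fun χ hχ η hη => ?_
    refine Submodule.mem_iSup_of_mem χ (Submodule.mem_iSup_of_mem hχ fun k => ?_)
    rw [formPullback_mul, mul_comm, ← formPullback_mul, hη k, map_smul]
  exact this

/-- The action of `G` on `H⁰(X, ω_X)₋` by pullback. -/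
def minusPullback (H : Subgroup G) (g : G) : formsMinus X H →ₗ[ℂ] formsMinus X H :=
  (formPullback g).restrict (formPullback_mem_formsMinus H g)

variable (X) in
/-- The `χ`-eigenspace of `G` acting on `H⁰(X, ω_X)₋`. -/
def minusEigenspace (H : Subgroup G) (χ : G →* ℂˣ) :
    Submodule ℂ (formsMinus X H) where
  carrier := {η | ∀ g : G, minusPullback H g η = (χ g : ℂ) • η}
  add_mem' {η θ} hη hθ g := by rw [map_add, hη g, hθ g, smul_add]
  zero_mem' g := by rw [map_zero, smul_zero]
  smul_mem' c η hη g := by rw [map_smul, hη g, smul_comm]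

end Forms

/-! ### The symmetric square and its invariants -/

/-- The map induced on symmetric squares by a linear map. -/
def symSquareMap {V : Type*} [AddCommGroup V] [Module ℂ V] (f : V →ₗ[ℂ] V) :
    Sym[ℂ]^2 V →+ Sym[ℂ]^2 V :=
  AddCon.lift _ ((SymmetricPower.mk ℂ (Fin 2) V).toAddMonoidHom.comp
      (PiTensorProduct.map (fun _ : Fin 2 => f)).toAddMonoidHom) <| by
    refine AddCon.addConGen_le.2 ?_
    rintro _ _ ⟨e, v⟩
    refine (AddCon.ker_rel _).2 ?_
    change SymmetricPower.mk ℂ (Fin 2) V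
        (PiTensorProduct.map (fun _ => f) (PiTensorProduct.tprod ℂ fun i => v i))
      = SymmetricPower.mk ℂ (Fin 2) V
        (PiTensorProduct.map (fun _ => f) (PiTensorProduct.tprod ℂ fun i => v (e i)))
    rw [PiTensorProduct.map_tprod, PiTensorProduct.map_tprod]
    exact Quotient.sound (AddConGen.Rel.of _ _ (SymmetricPower.Rel.perm e fun i => f (v i)))

theorem symSquareMap_smul {V : Type*} [AddCommGroup V] [Module ℂ V] (f : V →ₗ[ℂ] V) (c : ℂ)
    (t : Sym[ℂ]^2 V) : symSquareMap f (c • t) = c • symSquareMap f t := by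
  induction t using AddCon.induction_on with
  | H t =>
    change SymmetricPower.mk ℂ (Fin 2) V (PiTensorProduct.map (fun _ => f) (c • t))
      = c • SymmetricPower.mk ℂ (Fin 2) V (PiTensorProduct.map (fun _ => f) t)
    rw [map_smul, map_smul]

/-- The subspace `(S² V)^G` of invariants of the symmetric square of `V` under
a family of endomorphisms `σ g` (`g ∈ G`) of `V`. -/
def symSquareInvariants {V G : Type*} [AddCommGroup V] [Module ℂ V] (σ : G → V →ₗ[ℂ] V) :
    Submodule ℂ (Sym[ℂ]^2 V) where
  carrier := {t | ∀ g, symSquareMap (σ g) t = t}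
  add_mem' {s t} hs ht g := by rw [map_add, hs g, ht g]
  zero_mem' g := map_zero _
  smul_mem' c t ht g := by rw [symSquareMap_smul, ht g]

/-! ### Integration of one-forms over cycles and the lattice of the Prym variety -/

section Periods

/-- A path of class `C¹` in `X`, parametrized by `[0, 1]`. -/
def C1Path (X : Type*) [TopologicalSpace X] [ChartedSpace ℂ X] :=
  {γ : ℝ → X // ContMDiffOn 𝓘(ℝ) 𝓘(ℝ, ℂ) 1 γ (Set.Icc 0 1)}

/-- The boundary of a singular one-chain (a `ℤ`-linear combination of `C¹` paths). -/
def chainBoundary (X : Type*) [TopologicalSpace X] [ChartedSpace ℂ X] :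
    (C1Path X →₀ ℤ) →+ (X →₀ ℤ) :=
  Finsupp.liftAddHom fun γ =>
    Finsupp.singleAddHom (γ.1 1) - Finsupp.singleAddHom (γ.1 0)

variable {X : Type*} [TopologicalSpace X] [ChartedSpace ℂ X] [IsManifold 𝓘(ℂ) ω X]

/-- The integral of a holomorphic one-form along a `C¹` path. -/
def pathIntegral (η : HolomorphicOneForm X) (γ : C1Path X) : ℂ :=
  ∫ t in (0 : ℝ)..1, η (γ.1 t) (mfderiv 𝓘(ℝ) 𝓘(ℝ, ℂ) γ.1 t (1 : ℝ) : ℂ)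

/-- The integral of a holomorphic one-form over a one-chain. -/
def chainIntegral (η : HolomorphicOneForm X) : (C1Path X →₀ ℤ) →+ ℂ :=
  Finsupp.liftAddHom fun γ => (AddMonoidHom.mulRight (pathIntegral η γ)).comp
    (Int.castAddHom ℂ)

variable (X) in
/-- The group `H₁(X, ℤ)`, embedded in `H⁰(X, ω_X)^*` through integration over cycles. -/
def periodLattice :
    AddSubgroup (Module.Dual ℂ (HolomorphicOneForm X)) where
  carrier := {l | ∃ c : C1Path X →₀ ℤ, chainBoundary X c = 0 ∧ ∀ η, l η = chainIntegral η c}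
  add_mem' := by
    rintro l m ⟨c, hc, hl⟩ ⟨d, hd, hm⟩
    exact ⟨c + d, by rw [map_add, hc, hd, add_zero],
      fun η => by rw [map_add, LinearMap.add_apply, hl, hm]⟩
  zero_mem' := ⟨0, map_zero _, fun η => by rw [map_zero, LinearMap.zero_apply]⟩
  neg_mem' := by
    rintro l ⟨c, hc, hl⟩
    exact ⟨-c, by rw [map_neg, hc, neg_zero],
      fun η => by rw [map_neg, LinearMap.neg_apply, hl]⟩

variable {G : Type*} [CommGroup G] [MulAction G X] [HolomorphicAction G X]

variable (X) in
/-- The lattice `H₁(X, ℤ)₋` in `H⁰(X, ω_X)₋^*`. A class in `H₁(X, ℤ)` lies in `H₁(X, ℤ)₋`, that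
is, it is annihilated by `∑_{h ∈ H} h`, if and only if all `H`-invariant forms have integral zero
over it; then it is determined by the integrals over it of the forms in `H⁰(X, ω_X)₋`.
The complex torus `H⁰(X, ω_X)₋^* / H₁(X, ℤ)₋` is the Prym variety of `X → X / H`. -/
def prymLattice (H : Subgroup G) :
    AddSubgroup (Module.Dual ℂ (formsMinus X H)) :=
  (periodLattice X ⊓ (formsPlus X H).dualAnnihilator.toAddSubgroup).map
    (formsMinus X H).dualRestrict.toAddMonoidHom

/-- The action of `g ∈ G` on `H⁰(X, ω_X)₋^*` induced by the automorphism `g` of `X`. -/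
def dualAction (H : Subgroup G) (g : G) : Module.End ℝ (Module.Dual ℂ (formsMinus X H)) :=
  (minusPullback H g).dualMap.restrictScalars ℝ

end Periods

/-! ### The canonical polarization -/

section Polarization

theorem exists_chart_cover (X : Type*) [TopologicalSpace X] [ChartedSpace ℂ X] [CompactSpace X] :
    ∃ (n : ℕ) (p : Fin n → X), ∀ x, ∃ k, x ∈ (chartAt ℂ (p k)).source := by
  obtain ⟨t, ht⟩ := isCompact_univ.elim_finite_subcover
    (fun p : X => (chartAt ℂ p).source) (fun p => (chartAt ℂ p).open_source)
    (fun x _ => Set.mem_iUnion.2 ⟨x, mem_chart_source ℂ x⟩)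
  refine ⟨t.card, fun k => (t.equivFin.symm k : X), fun x => ?_⟩
  obtain ⟨p, hp, hx⟩ := Set.mem_iUnion₂.1 (ht (Set.mem_univ x))
  exact ⟨t.equivFin ⟨p, hp⟩, by simpa using hx⟩

variable {X : Type*} [TopologicalSpace X] [ChartedSpace ℂ X] [IsManifold 𝓘(ℂ) ω X]

/-- The function `f` such that `η = f dz` in the chart `z` at the point `p`. -/
def chartCoeff (η : HolomorphicOneForm X) (p : X) (z : ℂ) : ℂ :=
  η ((chartAt ℂ p).symm z) (mfderiv 𝓘(ℂ) 𝓘(ℂ) (chartAt ℂ p).symm z (1 : ℂ))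

/-- The Hermitian form `⟨η, θ⟩ = (i / 2) ∫_X η ∧ conj θ` on `H⁰(X, ω_X)`. In a chart in which
`η = f dz` and `θ = g dz` the integrand is `f (conj g) dx dy`. The integral over `X` is computed by
cutting `X` into finitely many pieces, the `k`-th of which lies in the domain of the `k`-th chart
of a finite family of charts that covers `X`. -/
def hermitianForm [CompactSpace X] (η θ : HolomorphicOneForm X) : ℂ :=
  let p := (exists_chart_cover X).choose_spec.choose
  ∑ k, ∫ z in chartAt ℂ (p k) '' ((chartAt ℂ (p k)).source \
      ⋃ j : {j // j < k}, (chartAt ℂ (p j)).source),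
    chartCoeff η (p k) z * (starRingEnd ℂ) (chartCoeff θ (p k) z)

variable {G : Type*} [CommGroup G] [MulAction G X] [HolomorphicAction G X]

/-- The element `u` of `H⁰(X, ω_X)₋` with `l = ⟨·, u⟩`. -/
def rieszRep [CompactSpace X] {H : Subgroup G} (l : Module.Dual ℂ (formsMinus X H)) :
    formsMinus X H :=
  Classical.epsilon fun u => ∀ η : formsMinus X H, hermitianForm (η : HolomorphicOneForm X) u = l η

/-- The polarization of the Prym variety, as a real alternating form on `H⁰(X, ω_X)₋^*`.
The canonical polarization of the Jacobian is the imaginary part of the Hermitian form on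
`H⁰(X, ω_X)^*` dual to `⟨·, ·⟩`; this is its restriction to `H⁰(X, ω_X)₋^*`, which is the
annihilator of `H⁰(X, ω_X)₊`, the orthogonal complement of `H⁰(X, ω_X)₋`. -/
def prymPolarization [CompactSpace X] (H : Subgroup G)
    (l m : Module.Dual ℂ (formsMinus X H)) : ℝ :=
  (hermitianForm (rieszRep m : HolomorphicOneForm X) (rieszRep l)).im

end Polarization

/-! ### Moduli of polarized abelian varieties and the PEL subvariety

A polarized abelian variety is given by a real vector space `U` with a lattice `L`, an alternating
form `E` on `U` and a complex structure `J` on `U` that is compatible with `E`. -/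

section Moduli

variable {U : Type*} [AddCommGroup U] [Module ℝ U]

/-- The Siegel space of `(U, E)`: the complex structures `J` on `U` for which `E` is the imaginary
part of a positive definite Hermitian form. -/
def SiegelSpace (E : U → U → ℝ) : Set (Module.End ℝ U) :=
  {J | J * J = -1 ∧ (∀ x y, E (J x) (J y) = E x y) ∧ ∀ x, x ≠ 0 → 0 < E (J x) x}

/-- Two points of the Siegel space are equivalent if they are conjugate under the group of
automorphisms of the lattice `L` that preserve `E`. -/
def siegelSetoid (E : U → U → ℝ) (L : AddSubgroup U) : Setoid (SiegelSpace E) where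
  r J J' := ∃ g : U ≃ₗ[ℝ] U, (∀ x y, E (g x) (g y) = E x y) ∧ (∀ x, g x ∈ L ↔ x ∈ L) ∧
    ∀ x, g (J.1 x) = J'.1 (g x)
  iseqv :=
    { refl := fun J => ⟨LinearEquiv.refl ℝ U, fun _ _ => rfl, fun _ => Iff.rfl, fun _ => rfl⟩
      symm := by
        rintro J J' ⟨g, h1, h2, h3⟩
        refine ⟨g.symm, fun x y => ?_, fun x => ?_, fun x => ?_⟩
        · rw [← h1, g.apply_symm_apply, g.apply_symm_apply]
        · rw [← h2, g.apply_symm_apply]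
        · rw [LinearEquiv.symm_apply_eq, h3, g.apply_symm_apply]
      trans := by
        rintro J J' J'' ⟨g, h1, h2, h3⟩ ⟨k, k1, k2, k3⟩
        refine ⟨g.trans k, fun x y => ?_, fun x => ?_, fun x => ?_⟩
        · simp only [LinearEquiv.trans_apply, k1, h1]
        · simp only [LinearEquiv.trans_apply, k2, h2]
        · simp only [LinearEquiv.trans_apply, h3, k3] }

/-- The moduli space `A_{p,D}`, where `D` is the type of `E` on `L`: the quotient of the Siegel
space by the symplectic group of `(L, E)`. -/
def ModuliSpace (E : U → U → ℝ) (L : AddSubgroup U) := Quotient (siegelSetoid E L)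

/-- The endomorphism `h(z) = a + b J`, `z = a + b i`, of the Hodge structure
`h : ℂˣ → GSp(U, E)` that corresponds to the complex structure `J`. -/
def hodgeHom (J : Module.End ℝ U) (z : ℂ) : Module.End ℝ U := z.re • 1 + z.im • J

/-- The real points of `N = GSp(U, E) ∩ GL_F(U)`: the symplectic similitudes that commute with the
action `ρ` of `G`, that is, that are linear over `F = ℚ[G]`. -/
def pelGroup {G : Type*} (E : U → U → ℝ) (ρ : G → Module.End ℝ U) : Set (Module.End ℝ U) :=
  {T | IsUnit T ∧ (∃ ν : ℝ, ν ≠ 0 ∧ ∀ x y, E (T x) (T y) = ν * E x y) ∧ ∀ g, T * ρ g = ρ g * T}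

/-- `Y_N`: the points of the Siegel space whose Hodge structure `h` factors through `N`. -/
def pelLocus {G : Type*} (E : U → U → ℝ) (ρ : G → Module.End ℝ U) : Set (Module.End ℝ U) :=
  {J | J ∈ SiegelSpace E ∧ ∀ z : ℂ, z ≠ 0 → hodgeHom J z ∈ pelGroup E ρ}

/-- All coordinates `ℓ (T x)` of an endomorphism `T`. Via this map the space of endomorphisms of
the (finite-dimensional) space `U` has its usual topology. -/
def endCoord (T : Module.End ℝ U) : Module.Dual ℝ U × U → ℝ := fun q => q.1 (T q.2)

/-- `Y⁺`: the connected component of `Y_N` that contains the base point `J₀`. -/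
def pelComponent {G : Type*} (E : U → U → ℝ) (ρ : G → Module.End ℝ U) (J₀ : Module.End ℝ U) :
    Set (Module.End ℝ U) :=
  {J | J ∈ pelLocus E ρ ∧
    endCoord J ∈ connectedComponentIn (endCoord '' pelLocus E ρ) (endCoord J₀)}

/-- The image of `Y⁺` in the moduli space. -/
def pelSubvariety {G : Type*} (E : U → U → ℝ) (L : AddSubgroup U) (ρ : G → Module.End ℝ U)
    (J₀ : Module.End ℝ U) : Set (ModuliSpace E L) :=
  {a | ∃ (J : Module.End ℝ U) (h : J ∈ pelComponent E ρ J₀),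
    a = Quotient.mk (siegelSetoid E L) ⟨J, h.1.1⟩}

/-- `f` is a holomorphic immersion of the open set `Ω` of `ℂ^d` into a space of complex structures
on `U`: at every point `u` of `Ω` it has an injective derivative `A`, and `A` is complex linear,
where a tangent vector `T` at the complex structure `J` is multiplied by `i` according to
`i • T = J T`. -/
def IsHolomorphicImmersion {d : ℕ} (Ω : Set (Fin d → ℂ)) (f : (Fin d → ℂ) → Module.End ℝ U) :
    Prop :=
  ∀ u ∈ Ω, ∃ A : (Fin d → ℂ) →ₗ[ℝ] Module.End ℝ U,
    (∀ (ℓ : Module.Dual ℝ U) (x : U), HasFDerivAt (fun v => ℓ (f v x))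
      (LinearMap.toContinuousLinearMap (ℓ ∘ₗ (LinearMap.applyₗ x) ∘ₗ A)) u) ∧
    (∀ v, A (Complex.I • v) = f u * A v) ∧ Function.Injective A

/-- The subset `S` of the moduli space has complex dimension `m`: the largest dimension of a complex
manifold immersed holomorphically in the inverse image of `S` in the Siegel space is `m`. -/
def HasComplexDim {E : U → U → ℝ} {L : AddSubgroup U} (S : Set (ModuliSpace E L)) (m : ℕ) : Prop :=
  IsGreatest {d : ℕ | ∃ (Ω : Set (Fin d → ℂ)) (f : (Fin d → ℂ) → Module.End ℝ U),
    IsOpen Ω ∧ Ω.Nonempty ∧ IsHolomorphicImmersion Ω f ∧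
    ∀ u ∈ Ω, ∃ h : f u ∈ SiegelSpace E, Quotient.mk (siegelSetoid E L) ⟨f u, h⟩ ∈ S} m

end Moduli

/-- `P(G)`: the PEL subvariety of the moduli space of polarized abelian varieties that is defined by
the Prym variety of `X → X / H`, with its polarization and the action of `G`. The base point is the
complex structure of the Prym variety, multiplication by `i` on `H⁰(X, ω_X)₋^*`. -/
def prymPELSubvariety {X : Type*} [TopologicalSpace X] [ChartedSpace ℂ X] [IsManifold 𝓘(ℂ) ω X]
    [CompactSpace X] {G : Type*} [CommGroup G] [MulAction G X] [HolomorphicAction G X]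
    (H : Subgroup G) : Set (ModuliSpace (prymPolarization (X := X) H) (prymLattice X H)) :=
  pelSubvariety (prymPolarization H) (prymLattice X H) (dualAction H)
    ((LinearMap.lsmul ℂ (Module.Dual ℂ (formsMinus X H)) Complex.I).restrictScalars ℝ)

end

/-!
The PEL subvariety is the image of a component of the PEL locus `Y_N` in the Siegel space of
`U = V₋^*`, where `V₋ = H⁰(X, ω_X)₋`, and its dimension is the dimension of the tangent space of
`Y_N` at the base point. By `mem_pelLocus_iff`, `Y_N` consists of the compatible complex structures
that commute with `G`. Its tangent space at `J` is the space `pelTangent` of the endomorphisms of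
`U` that anticommute with `J`, are skew for the polarization and commute with `G`.

*Dimension of the subvariety* (`hasComplexDim_pelSubvariety`). For the lower bound, the Cayley
transform `T ↦ (1 + T) J₀ (1 + T)⁻¹` immerses a ball of the tangent space at the base point `J₀`
holomorphically in the component of `J₀` (`exists_immersion_pelComponent`). For the upper bound, a
complex manifold immersed in the inverse image of the subvariety is covered by the closed sets on
which the period point is carried into `Y_N` by a fixed automorphism of the lattice. The
automorphism group of the lattice is countable, as the lattice is countable and spans `U`, so that
one of these sets has an interior point by Baire's theorem. At such a point the tangent space of the
manifold embeds in a tangent space of `Y_N`. All tangent spaces of `Y_N` have the same dimension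
(`finrank_pelTangent_le`, `two_mul_le_of_immersion`).

*Geometry of the surface.* These arguments need that `H⁰(X, ω_X)` is finite-dimensional
(`HolomorphicOneForm.finiteDimensional`: by Schwarz' lemma on a finite cover by discs, a form with
zeros on a sufficiently fine finite net vanishes), that `⟨·, ·⟩` is a positive definite Hermitian
form invariant under `G` (`hermitianForm_pullback`, `eq_zero_of_hermitianForm_self`), and that the
lattice of the Prym variety is countable and spans `U` over `ℝ` (`countable_prymLattice`,
`span_prymLattice`). A period is a sum of jumps between local primitives on a finite cover, and
these jumps are locally constant, so that they take only countably many values. A real functional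
on `U` that vanishes on the lattice gives a form with purely imaginary periods. The real part of
such a form has a single-valued primitive, which is constant by the maximum principle, so that the
form vanishes (`eq_zero_of_re_period`).

*Linear algebra.* The Hermitian form identifies `V₋` with `U` conjugate-linearly, and by this the
tangent space at `J₀` becomes the space of the `G`-invariant symmetric linear maps `V₋^* → V₋`
(`exists_pelTangent_parametrization`), that is, `(S² V₋)^G` (`finrank_invariantSymmMaps`). In a
basis of eigenvectors of `G` these are the symmetric matrices whose `(i, j)`-entry vanishes unless
the characters of the `i`-th and the `j`-th basis vector are inverse to each other, and counting
the unordered pairs `{i, j}` gives the formula (`two_mul_finrank_invariantSymmMaps`).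
-/

open scoped Topology
open Set Filter

noncomputable section

/-! ### Holomorphic one-forms in local coordinates -/

section LocalCoordinates

section Charts

variable {X : Type*} [TopologicalSpace X] [ChartedSpace ℂ X]

theorem mfderiv_apply_one_eq_deriv {F : ℂ → X} {z : ℂ} (hF : MDifferentiableAt 𝓘(ℂ) 𝓘(ℂ) F z) :
    (mfderiv 𝓘(ℂ) 𝓘(ℂ) F z (1 : ℂ) : ℂ) = deriv (chartAt ℂ (F z) ∘ F) z := by
  refine (DFunLike.congr_fun hF.mfderiv (1 : ℂ)).trans ?_
  change fderivWithin ℂ (writtenInExtChartAt 𝓘(ℂ) 𝓘(ℂ) z F) (range 𝓘(ℂ)) z 1 = _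
  rw [modelWithCornersSelf_coe, range_id, fderivWithin_univ, fderiv_apply_one_eq_deriv]
  rfl

/-- The coordinate expression of the map `ψ` from the chart at `p` to the chart at `q`. -/
def chartMap (ψ : X → X) (p q : X) (z : ℂ) : ℂ := chartAt ℂ q (ψ ((chartAt ℂ p).symm z))

theorem isOpen_chartMap_domain {ψ : X → X} (hψ : Continuous ψ) (p q : X) :
    IsOpen {z | z ∈ (chartAt ℂ p).target ∧ ψ ((chartAt ℂ p).symm z) ∈ (chartAt ℂ q).source} :=
  ((hψ.comp_continuousOn (chartAt ℂ p).continuousOn_symm).isOpen_inter_preimage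
    (chartAt ℂ p).open_target (chartAt ℂ q).open_source)

end Charts

variable {X : Type*} [TopologicalSpace X] [ChartedSpace ℂ X] [IsManifold 𝓘(ℂ) ω X]

theorem mdifferentiableAt_chart_symm (p : X) {z : ℂ} (hz : z ∈ (chartAt ℂ p).target) :
    MDifferentiableAt 𝓘(ℂ) 𝓘(ℂ) (chartAt ℂ p).symm z := by
  exact mdifferentiableAt_atlas_symm (chart_mem_atlas _ _) hz

theorem differentiableAt_chartMap {ψ : X → X} (hψ : ContMDiff 𝓘(ℂ) 𝓘(ℂ) ω ψ) {p q : X} {z : ℂ}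
    (hz : z ∈ (chartAt ℂ p).target) (hq : ψ ((chartAt ℂ p).symm z) ∈ (chartAt ℂ q).source) :
    DifferentiableAt ℂ (chartMap ψ p q) z := by
  rw [← mdifferentiableAt_iff_differentiableAt]
  have h1 := mdifferentiableAt_chart_symm p hz
  have h2 : MDifferentiableAt 𝓘(ℂ) 𝓘(ℂ) ψ ((chartAt ℂ p).symm z) :=
    hψ.mdifferentiable (by simp) _
  have h3 : MDifferentiableAt 𝓘(ℂ) 𝓘(ℂ) (chartAt ℂ q) (ψ ((chartAt ℂ p).symm z)) :=
    mdifferentiableAt_atlas (chart_mem_atlas _ _) hq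
  exact h3.comp z (h2.comp z h1)

/-- The coefficient of a pullback, by the chain rule. The form `ζ` is the pullback of `η` along
`ψ`. -/
theorem chartCoeff_comp {ψ : X → X} (hψ : ContMDiff 𝓘(ℂ) 𝓘(ℂ) ω ψ) (η ζ : HolomorphicOneForm X)
    (hζ : ∀ x, ζ x = (η (ψ x)).comp (mfderiv 𝓘(ℂ) 𝓘(ℂ) ψ x)) {p q : X} {z : ℂ}
    (hz : z ∈ (chartAt ℂ p).target) (hq : ψ ((chartAt ℂ p).symm z) ∈ (chartAt ℂ q).source) :
    chartCoeff ζ p z = deriv (chartMap ψ p q) z * chartCoeff η q (chartMap ψ p q z) := by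
  have h1 := mdifferentiableAt_chart_symm p hz
  have h2 : MDifferentiableAt 𝓘(ℂ) 𝓘(ℂ) ψ ((chartAt ℂ p).symm z) :=
    hψ.mdifferentiable (by simp) _
  have e1 : chartCoeff ζ p z
      = η (ψ ((chartAt ℂ p).symm z)) (mfderiv 𝓘(ℂ) 𝓘(ℂ) (ψ ∘ (chartAt ℂ p).symm) z (1 : ℂ)) := by
    rw [chartCoeff, hζ, mfderiv_comp z h2 h1]; rfl
  have h4 : chartMap ψ p q z ∈ (chartAt ℂ q).target := (chartAt ℂ q).map_source hq
  have e2 : mfderiv 𝓘(ℂ) 𝓘(ℂ) (ψ ∘ (chartAt ℂ p).symm) z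
      = mfderiv 𝓘(ℂ) 𝓘(ℂ) ((chartAt ℂ q).symm ∘ chartMap ψ p q) z := by
    apply Filter.EventuallyEq.mfderiv_eq
    filter_upwards [(isOpen_chartMap_domain hψ.continuous p q).mem_nhds ⟨hz, hq⟩] with w hw
    exact ((chartAt ℂ q).left_inv hw.2).symm
  have e3 := mfderiv_comp z (mdifferentiableAt_chart_symm q h4)
    (differentiableAt_chartMap hψ hz hq).mdifferentiableAt
  have e4 : mfderiv 𝓘(ℂ) 𝓘(ℂ) (ψ ∘ (chartAt ℂ p).symm) z (1 : ℂ)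
      = deriv (chartMap ψ p q) z •
        (mfderiv 𝓘(ℂ) 𝓘(ℂ) (chartAt ℂ q).symm (chartMap ψ p q z) (1 : ℂ) : ℂ) := by
    rw [e2, e3, mfderiv_eq_fderiv]
    have : (fderiv ℂ (chartMap ψ p q) z 1) = deriv (chartMap ψ p q) z • (1 : ℂ) := by
      simp
    change (mfderiv 𝓘(ℂ) 𝓘(ℂ) (chartAt ℂ q).symm (chartMap ψ p q z)
      (fderiv ℂ (chartMap ψ p q) z 1)) = _
    rw [this]
    exact map_smul _ _ _
  have key : ∀ y y' : X, y = y' → ∀ w : ℂ, (η y : ℂ → ℂ) w = (η y' : ℂ → ℂ) w := by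
    rintro y _ rfl w
    rfl
  rw [e1, e4]
  have := map_smul (η (ψ ((chartAt ℂ p).symm z))) (deriv (chartMap ψ p q) z)
    (mfderiv 𝓘(ℂ) 𝓘(ℂ) (chartAt ℂ q).symm (chartMap ψ p q z) (1 : ℂ))
  refine this.trans ?_
  rw [smul_eq_mul, chartCoeff]
  congr 1
  exact key _ _ ((chartAt ℂ q).left_inv hq).symm _

theorem chartCoeff_eq_transition (η : HolomorphicOneForm X) {p q : X} {z : ℂ}
    (hz : z ∈ (chartAt ℂ p).target) (hq : (chartAt ℂ p).symm z ∈ (chartAt ℂ q).source) :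
    chartCoeff η p z = deriv (chartMap id p q) z * chartCoeff η q (chartMap id p q z) :=
  chartCoeff_comp contMDiff_id η η (fun x => by rw [mfderiv_id]; rfl) hz hq

theorem differentiableAt_chartCoeff_self (η : HolomorphicOneForm X) (p : X) :
    DifferentiableAt ℂ (chartCoeff η p) (chartAt ℂ p p) := by
  have h := ((contMDiffAt_hom_bundle _).1 (η.contMDiff p)).2
  have h1 := h.mdifferentiableAt (by simp)
  have h2 : MDifferentiableAt 𝓘(ℂ) 𝓘(ℂ) (chartAt ℂ p).symm (chartAt ℂ p p) :=
    mdifferentiableAt_chart_symm p (mem_chart_target ℂ p)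
  have h3 := MDifferentiableAt.comp_of_eq (chartAt ℂ p p) h1 h2
    ((chartAt ℂ p).left_inv (mem_chart_source ℂ p))
  rw [mdifferentiableAt_iff_differentiableAt] at h3
  have h4 := h3.clm_apply (differentiableAt_const (1 : ℂ))
  refine h4.congr_of_eventuallyEq ?_
  filter_upwards [(chartAt ℂ p).open_target.mem_nhds (mem_chart_target ℂ p)] with z hz
  have hs := (chartAt ℂ p).map_target hz
  simp only [Function.comp, ContinuousLinearMap.inCoordinates, ContinuousLinearMap.comp_apply]
  rw [chartCoeff]
  rw [TangentBundle.symmL_trivializationAt (I := 𝓘(ℂ)) hs]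
  have key : ∀ w w' : ℂ, w = w' → (η ((chartAt ℂ p).symm z) : ℂ → ℂ)
      (mfderiv 𝓘(ℂ) 𝓘(ℂ) (chartAt ℂ p).symm w (1 : ℂ) : ℂ) = (η ((chartAt ℂ p).symm z) : ℂ → ℂ)
      (mfderiv 𝓘(ℂ) 𝓘(ℂ) (chartAt ℂ p).symm w' (1 : ℂ) : ℂ) := by
    rintro w _ rfl
    rfl
  simp
  exact key _ _ ((chartAt ℂ p).right_inv hz).symm

theorem differentiableAt_chartCoeff (η : HolomorphicOneForm X) {p : X} {z : ℂ}
    (hz : z ∈ (chartAt ℂ p).target) : DifferentiableAt ℂ (chartCoeff η p) z := by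
  set q := (chartAt ℂ p).symm z with hq
  have ho := isOpen_chartMap_domain (continuous_id (X := X)) p q
  have hm : z ∈ {z | z ∈ (chartAt ℂ p).target ∧ id ((chartAt ℂ p).symm z) ∈ (chartAt ℂ q).source} :=
    ⟨hz, mem_chart_source ℂ q⟩
  have hd : DifferentiableOn ℂ (chartMap id p q)
      {z | z ∈ (chartAt ℂ p).target ∧ id ((chartAt ℂ p).symm z) ∈ (chartAt ℂ q).source} :=
    fun w hw => (differentiableAt_chartMap contMDiff_id hw.1 hw.2).differentiableWithinAt
  have h1 : DifferentiableAt ℂ (deriv (chartMap id p q)) z :=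
    (hd.deriv ho).differentiableAt (ho.mem_nhds hm)
  have h2 : DifferentiableAt ℂ (fun w => chartCoeff η q (chartMap id p q w)) z :=
    DifferentiableAt.comp (f := chartMap id p q) (g := chartCoeff η q) z
      (differentiableAt_chartCoeff_self η q) (hd.differentiableAt (ho.mem_nhds hm))
  refine (h1.mul h2).congr_of_eventuallyEq ?_
  filter_upwards [ho.mem_nhds hm] with w hw
  exact chartCoeff_eq_transition η hw.1 hw.2

theorem chartCoeff_self (η : HolomorphicOneForm X) (p : X) :
    chartCoeff η p (chartAt ℂ p p) = (η p (1 : ℂ) : ℂ) := by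
  have hl := (chartAt ℂ p).left_inv (mem_chart_source ℂ p)
  have hd := mdifferentiableAt_chart_symm p (mem_chart_target ℂ p)
  have key : ∀ y y' : X, y = y' → ∀ w : ℂ, (η y : ℂ → ℂ) w = (η y' : ℂ → ℂ) w := by
    rintro y _ rfl w
    rfl
  have : (mfderiv 𝓘(ℂ) 𝓘(ℂ) (chartAt ℂ p).symm (chartAt ℂ p p) (1 : ℂ) : ℂ) = (1 : ℂ) := by
    refine (mfderiv_apply_one_eq_deriv hd).trans ?_
    rw [hl]
    suffices h : (chartAt ℂ p ∘ (chartAt ℂ p).symm) =ᶠ[𝓝 (chartAt ℂ p p)] id from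
      h.deriv_eq.trans (deriv_id (chartAt ℂ p p))
    filter_upwards [(chartAt ℂ p).open_target.mem_nhds (mem_chart_target ℂ p)] with z hz
    exact (chartAt ℂ p).right_inv hz
  exact (key _ _ hl _).trans (congrArg _ this)

theorem HolomorphicOneForm.eq_zero_of_chartCoeff {η : HolomorphicOneForm X}
    (h : ∀ p, chartCoeff η p (chartAt ℂ p p) = 0) : η = 0 := by
  refine ContMDiffSection.ext fun x => ?_
  apply ContinuousLinearMap.ext_ring
  exact (chartCoeff_self η x).symm.trans (h x)

theorem chartCoeff_add (η θ : HolomorphicOneForm X) (p : X) (z : ℂ) :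
    chartCoeff (η + θ) p z = chartCoeff η p z + chartCoeff θ p z := rfl

theorem chartCoeff_smul (c : ℂ) (η : HolomorphicOneForm X) (p : X) (z : ℂ) :
    chartCoeff (c • η) p z = c * chartCoeff η p z := rfl

end LocalCoordinates

/-! ### The space of holomorphic one-forms is finite-dimensional -/

section FiniteDimension

theorem exists_chart_disc {X : Type*} [TopologicalSpace X] [ChartedSpace ℂ X] (x : X) :
    ∃ R : ℝ, 0 < R ∧ Metric.closedBall (chartAt ℂ x x) (2 * R) ⊆ (chartAt ℂ x).target := by
  obtain ⟨ε, hε, h⟩ := Metric.nhds_basis_closedBall.mem_iff.1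
    ((chartAt ℂ x).open_target.mem_nhds (mem_chart_target ℂ x))
  exact ⟨ε / 2, by positivity, by rwa [mul_div_cancel₀ _ two_ne_zero]⟩

variable {X : Type*} [TopologicalSpace X] [ChartedSpace ℂ X] [IsManifold 𝓘(ℂ) ω X]

theorem continuousOn_chartCoeff (η : HolomorphicOneForm X) (p : X) :
    ContinuousOn (chartCoeff η p) (chartAt ℂ p).target :=
  fun _ hz => (differentiableAt_chartCoeff η hz).continuousAt.continuousWithinAt

/-- A form which vanishes in the chart at `q` at the point `x` also vanishes there in every other
chart. -/
theorem chartCoeff_self_eq_zero {η : HolomorphicOneForm X} {q x : X}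
    (hx : x ∈ (chartAt ℂ q).source) (h : chartCoeff η q (chartAt ℂ q x) = 0) :
    chartCoeff η x (chartAt ℂ x x) = 0 := by
  have hl := (chartAt ℂ x).left_inv (mem_chart_source ℂ x)
  rw [chartCoeff_eq_transition η (q := q) (mem_chart_target ℂ x) (by rwa [hl]), chartMap, hl, id,
    h, mul_zero]

theorem chartCoeff_eq_zero {η : HolomorphicOneForm X} {q x : X}
    (hx : x ∈ (chartAt ℂ q).source) (h : chartCoeff η x (chartAt ℂ x x) = 0) :
    chartCoeff η q (chartAt ℂ q x) = 0 := by
  have hl := (chartAt ℂ q).left_inv hx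
  rw [chartCoeff_eq_transition η (q := x) ((chartAt ℂ q).map_source hx)
    (by rw [hl]; exact mem_chart_source ℂ x), chartMap, hl, id, h, mul_zero]

/-- Bounds for the coefficients of a form on discs which cover the surface control its
coefficients on any compact part of any chart, uniformly in the form. -/
theorem exists_chartCoeff_bound (t : Finset X) (R : X → ℝ)
    (hcov : ∀ x, ∃ j ∈ t, x ∈ (chartAt ℂ j).source ∧
      chartAt ℂ j x ∈ Metric.ball (chartAt ℂ j j) (R j))
    (i : X) {K : Set ℂ} (hK : IsCompact K) (hKt : K ⊆ (chartAt ℂ i).target) :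
    ∃ C : ℝ, 0 ≤ C ∧ ∀ (η : HolomorphicOneForm X) (B : ℝ), 0 ≤ B →
      (∀ j ∈ t, ∀ z ∈ Metric.ball (chartAt ℂ j j) (R j), ‖chartCoeff η j z‖ ≤ B) →
      ∀ z ∈ K, ‖chartCoeff η i z‖ ≤ C * B := by
  refine IsCompact.induction_on (p := fun S => ∃ C : ℝ, 0 ≤ C ∧
      ∀ (η : HolomorphicOneForm X) (B : ℝ), 0 ≤ B →
      (∀ j ∈ t, ∀ z ∈ Metric.ball (chartAt ℂ j j) (R j), ‖chartCoeff η j z‖ ≤ B) →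
      ∀ z ∈ S, ‖chartCoeff η i z‖ ≤ C * B) hK ?_ ?_ ?_ ?_
  · exact ⟨0, le_rfl, fun _ _ _ _ z hz => absurd hz (notMem_empty z)⟩
  · rintro s s' hss ⟨C, hC, h⟩
    exact ⟨C, hC, fun η B hB hη z hz => h η B hB hη z (hss hz)⟩
  · rintro s s' ⟨C, hC, h⟩ ⟨C', hC', h'⟩
    refine ⟨C + C', by positivity, fun η B hB hη z hz => ?_⟩
    rcases hz with hz | hz
    · exact (h η B hB hη z hz).trans (by nlinarith)
    · exact (h' η B hB hη z hz).trans (by nlinarith)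
  · intro z₀ hz₀
    obtain ⟨j, hj, hs, hb⟩ := hcov ((chartAt ℂ i).symm z₀)
    have ho := isOpen_chartMap_domain (continuous_id (X := X)) i j
    have hd : DifferentiableOn ℂ (chartMap id i j)
        {z | z ∈ (chartAt ℂ i).target ∧ id ((chartAt ℂ i).symm z) ∈ (chartAt ℂ j).source} :=
      fun w hw => (differentiableAt_chartMap contMDiff_id hw.1 hw.2).differentiableWithinAt
    have hm := ho.mem_nhds ⟨hKt hz₀, hs⟩
    have hc : ContinuousAt (chartMap id i j) z₀ := (hd.differentiableAt hm).continuousAt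
    have hc' : ContinuousAt (deriv (chartMap id i j)) z₀ :=
      ((hd.deriv ho).differentiableAt hm).continuousAt
    refine ⟨{z | (z ∈ (chartAt ℂ i).target ∧ id ((chartAt ℂ i).symm z) ∈ (chartAt ℂ j).source) ∧
      chartMap id i j z ∈ Metric.ball (chartAt ℂ j j) (R j) ∧
      ‖deriv (chartMap id i j) z‖ < ‖deriv (chartMap id i j) z₀‖ + 1}, ?_,
      ‖deriv (chartMap id i j) z₀‖ + 1, by positivity, ?_⟩
    · apply mem_nhdsWithin_of_mem_nhds
      filter_upwards [hm, hc.preimage_mem_nhds (Metric.isOpen_ball.mem_nhds hb),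
        hc'.norm.eventually (gt_mem_nhds (lt_add_one _))] with z h1 h2 h3
      exact ⟨h1, h2, h3⟩
    · rintro η B hB hη z ⟨h1, h2, h3⟩
      rw [chartCoeff_eq_transition η h1.1 h1.2, norm_mul]
      exact mul_le_mul h3.le (hη j hj _ h2) (norm_nonneg _) (by positivity)

/-- If `f` is bounded by `B` on a disc of radius `2 R` and has a zero in the
concentric disc of radius `R`, then it is small near that zero. -/
theorem norm_le_of_zero {f : ℂ → ℂ} {c z w : ℂ} {R B : ℝ}
    (hd : DifferentiableOn ℂ f (Metric.closedBall c (2 * R)))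
    (hB : ∀ u ∈ Metric.closedBall c (2 * R), ‖f u‖ ≤ B)
    (hw : w ∈ Metric.ball c R) (h0 : f w = 0) (hzw : dist z w < R) :
    ‖f z‖ ≤ B / R * dist z w := by
  have hsub : Metric.ball w R ⊆ Metric.closedBall c (2 * R) := by
    intro u hu
    rw [Metric.mem_ball] at hu hw
    rw [Metric.mem_closedBall]
    linarith [dist_triangle u w c]
  have := Complex.dist_le_div_mul_dist_of_mapsTo_ball (hd.mono hsub) (R₂ := B)
    (fun u hu => by simpa [h0] using hB u (hsub hu)) (z := z) hzw
  simpa [h0] using this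

/-- A finite set of points separates the holomorphic one-forms on a compact surface: a form with
zeros at the points of a sufficiently fine net vanishes. -/
theorem exists_finset_separating [CompactSpace X] : ∃ N : Finset X,
    ∀ η : HolomorphicOneForm X, (∀ x ∈ N, chartCoeff η x (chartAt ℂ x x) = 0) → η = 0 := by
  choose R hR hRt using exists_chart_disc (X := X)
  obtain ⟨t, ht⟩ := isCompact_univ.elim_nhds_subcover
    (fun x : X => (chartAt ℂ x).source ∩ chartAt ℂ x ⁻¹' Metric.ball (chartAt ℂ x x) (R x))
    (fun x _ => (chartAt ℂ x).continuousOn.isOpen_inter_preimage (chartAt ℂ x).open_source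
      Metric.isOpen_ball |>.mem_nhds ⟨mem_chart_source ℂ x, Metric.mem_ball_self (hR x)⟩)
  have hcov : ∀ x, ∃ j ∈ t, x ∈ (chartAt ℂ j).source ∧
      chartAt ℂ j x ∈ Metric.ball (chartAt ℂ j j) (R j) := fun x => by
    obtain ⟨j, hj, hx⟩ := mem_iUnion₂.1 (ht.2 (mem_univ x))
    exact ⟨j, hj, hx.1, hx.2⟩
  choose C hC0 hC using fun i : X => exists_chartCoeff_bound t R hcov i
    (isCompact_closedBall (chartAt ℂ i i) (2 * R i)) (hRt i)
  obtain ⟨r, hrR, hr⟩ : ∃ r : ℝ, (∀ j ∈ t, r < R j) ∧ 0 < r := by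
    have : ∀ᶠ r in 𝓝[>] (0 : ℝ), ∀ j ∈ t, r < R j :=
      (Filter.eventually_all_finset t).2 fun j _ => nhdsWithin_le_nhds (gt_mem_nhds (hR j))
    exact (this.and self_mem_nhdsWithin).exists
  have hC1 : ∀ i ∈ t, C i ≤ ∑ j ∈ t, C j := fun i hi =>
    Finset.single_le_sum (f := C) (fun j _ => hC0 j) hi
  set D := ∑ j ∈ t, C j with hD
  have hD0 : 0 ≤ D := Finset.sum_nonneg fun j _ => hC0 j
  -- With this mesh, a bound on the small discs improves by the factor `1 / 2`.
  set ε := r / (2 * (D + 1)) with hε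
  have hε0 : 0 < ε := by positivity
  have hεr : ε ≤ r := div_le_self hr.le (by linarith)
  have hεD : D * ε ≤ r / 2 := by
    rw [hε, mul_div_assoc', div_le_div_iff₀ (by positivity) two_pos]
    nlinarith
  choose S hSs hSf hS using fun j : X => Metric.finite_approx_of_totallyBounded
    (((isCompact_closedBall (chartAt ℂ j j) (R j)).totallyBounded).subset
      Metric.ball_subset_closedBall) ε hε0
  classical
  refine ⟨t.biUnion fun j => ((hSf j).image (chartAt ℂ j).symm).toFinset, fun η hη => ?_⟩
  have hsmall : ∀ j z, z ∈ Metric.ball (chartAt ℂ j j) (R j) → z ∈ (chartAt ℂ j).target :=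
    fun j z hz => hRt j (Metric.closedBall_subset_closedBall (by linarith [hR j])
      (Metric.ball_subset_closedBall hz))
  have hz : ∀ j ∈ t, ∀ w ∈ S j, chartCoeff η j w = 0 := by
    intro j hj w hw
    have h1 := (hsmall j w (hSs j hw))
    have := hη ((chartAt ℂ j).symm w) (by
      simp only [Finset.mem_biUnion, Set.Finite.mem_toFinset]
      exact ⟨j, hj, w, hw, rfl⟩)
    have := chartCoeff_eq_zero ((chartAt ℂ j).map_target h1) this
    rwa [(chartAt ℂ j).right_inv h1] at this
  have step : ∀ B, 0 ≤ B →
      (∀ j ∈ t, ∀ z ∈ Metric.ball (chartAt ℂ j j) (R j), ‖chartCoeff η j z‖ ≤ B) →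
      ∀ j ∈ t, ∀ z ∈ Metric.ball (chartAt ℂ j j) (R j), ‖chartCoeff η j z‖ ≤ B / 2 := by
    intro B hB h j hj z hzb
    have h1 := hC j η B hB h
    obtain ⟨w, hw, hzw⟩ := mem_iUnion₂.1 (hS j hzb)
    rw [Metric.mem_ball] at hzw
    have h2 := norm_le_of_zero
      (fun u hu => (differentiableAt_chartCoeff η (hRt j hu)).differentiableWithinAt) h1
      (hSs j hw) (hz j hj w hw) (by linarith [hrR j hj])
    refine h2.trans ?_
    rw [div_mul_eq_mul_div, div_le_div_iff₀ (hR j) two_pos]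
    have h3 : C j * dist z w ≤ R j / 2 := by
      calc C j * dist z w ≤ D * ε := mul_le_mul (hC1 j hj) hzw.le dist_nonneg hD0
        _ ≤ r / 2 := hεD
        _ ≤ R j / 2 := by linarith [hrR j hj]
    nlinarith
  obtain ⟨B, hB0, hB⟩ : ∃ B, 0 ≤ B ∧
      ∀ j ∈ t, ∀ z ∈ Metric.ball (chartAt ℂ j j) (R j), ‖chartCoeff η j z‖ ≤ B := by
    choose b hb using fun j : X =>
      (isCompact_closedBall (chartAt ℂ j j) (2 * R j)).exists_bound_of_continuousOn
      ((continuousOn_chartCoeff η j).mono (hRt j))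
    have hb0 : ∀ j, 0 ≤ b j := fun j => (norm_nonneg _).trans
      (hb j _ (Metric.mem_closedBall_self (by linarith [hR j])))
    refine ⟨∑ j ∈ t, b j, Finset.sum_nonneg fun j _ => hb0 j, fun j hj z hzb => ?_⟩
    exact (hb j z (Metric.closedBall_subset_closedBall (by linarith [hR j])
      (Metric.ball_subset_closedBall hzb))).trans
        (Finset.single_le_sum (f := b) (fun j _ => hb0 j) hj)
  have iter : ∀ n : ℕ, ∀ j ∈ t, ∀ z ∈ Metric.ball (chartAt ℂ j j) (R j),
      ‖chartCoeff η j z‖ ≤ B * (1 / 2) ^ n := by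
    intro n
    induction n with
    | zero => simpa using hB
    | succ n ih =>
      intro j hj z hzb
      have := step _ (by positivity) ih j hj z hzb
      rw [pow_succ]; linarith
  have hzero : ∀ j ∈ t, ∀ z ∈ Metric.ball (chartAt ℂ j j) (R j), chartCoeff η j z = 0 := by
    intro j hj z hzb
    have hlim : Tendsto (fun n : ℕ => B * (1 / 2 : ℝ) ^ n) atTop (𝓝 (B * 0)) :=
      (tendsto_pow_atTop_nhds_zero_of_lt_one (by norm_num) (by norm_num)).const_mul B
    rw [mul_zero] at hlim
    exact norm_le_zero_iff.1 (ge_of_tendsto' hlim fun n => iter n j hj z hzb)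
  refine HolomorphicOneForm.eq_zero_of_chartCoeff fun x => ?_
  obtain ⟨j, hj, hs, hb⟩ := hcov x
  exact chartCoeff_self_eq_zero hs (hzero j hj _ hb)

instance HolomorphicOneForm.finiteDimensional [CompactSpace X] :
    FiniteDimensional ℂ (HolomorphicOneForm X) := by
  obtain ⟨N, hN⟩ := exists_finset_separating (X := X)
  let ev : HolomorphicOneForm X →ₗ[ℂ] (N → ℂ) :=
    { toFun := fun η x => chartCoeff η x (chartAt ℂ (x : X) x)
      map_add' := fun _ _ => rfl
      map_smul' := fun _ _ => rfl }
  refine FiniteDimensional.of_injective ev ((injective_iff_map_eq_zero ev).2 fun η hη => ?_)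
  exact hN η fun x hx => congrFun hη ⟨x, hx⟩

end FiniteDimension

/-! ### The Hermitian form is positive definite and invariant -/

section HermitianForm

open MeasureTheory
open scoped ENNReal ComplexConjugate

section ChartImages

variable {X : Type*} [TopologicalSpace X] [ChartedSpace ℂ X]

/-- The pieces into which the definition of `hermitianForm` cuts the surface. -/
def chartPiece {n : ℕ} (p : Fin n → X) (k : Fin n) : Set X :=
  (chartAt ℂ (p k)).source \ ⋃ j : {j // j < k}, (chartAt ℂ (p j)).source

theorem chartPiece_subset {n : ℕ} (p : Fin n → X) (k : Fin n) :
    chartPiece p k ⊆ (chartAt ℂ (p k)).source := sdiff_subset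

theorem pairwise_disjoint_chartPiece {n : ℕ} (p : Fin n → X) :
    Pairwise (Function.onFun Disjoint (chartPiece p)) := by
  intro i j hij
  refine disjoint_left.2 fun x hi hj => ?_
  rcases hij.lt_or_gt with h | h
  · exact hj.2 (mem_iUnion.2 ⟨⟨i, h⟩, hi.1⟩)
  · exact hi.2 (mem_iUnion.2 ⟨⟨j, h⟩, hj.1⟩)

theorem exists_mem_chartPiece {n : ℕ} {p : Fin n → X}
    (hp : ∀ x, ∃ k, x ∈ (chartAt ℂ (p k)).source) (x : X) : ∃ k, x ∈ chartPiece p k := by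
  obtain ⟨k, hk, hmin⟩ := WellFounded.has_min (wellFounded_lt (α := Fin n))
    {k | x ∈ (chartAt ℂ (p k)).source} (hp x)
  refine ⟨k, hk, fun h => ?_⟩
  obtain ⟨⟨j, hj⟩, hx⟩ := mem_iUnion.1 h
  exact hmin j hx hj

/-- The centres of the charts used by the definition of `hermitianForm`. -/
def coverPoint (X : Type*) [TopologicalSpace X] [ChartedSpace ℂ X] [CompactSpace X] :
    Fin (exists_chart_cover X).choose → X :=
  (exists_chart_cover X).choose_spec.choose

theorem exists_mem_coverPoint_source (X : Type*) [TopologicalSpace X]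
    [ChartedSpace ℂ X] [CompactSpace X] (x : X) : ∃ k, x ∈ (chartAt ℂ (coverPoint X k)).source :=
  (exists_chart_cover X).choose_spec.choose_spec x

variable [MeasurableSpace X] [BorelSpace X]

theorem measurableSet_chart_image (p : X) {A : Set X} (hA : MeasurableSet A)
    (hs : A ⊆ (chartAt ℂ p).source) : MeasurableSet (chartAt ℂ p '' A) := by
  rw [(chartAt ℂ p).image_eq_target_inter_inv_preimage hs, ← Subtype.image_preimage_coe]
  refine (chartAt ℂ p).open_target.measurableSet.subtype_image ?_
  have : Continuous fun z : (chartAt ℂ p).target => (chartAt ℂ p).symm z :=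
    continuousOn_iff_continuous_domRestrict.1 (chartAt ℂ p).continuousOn_symm
  exact this.measurable hA

theorem measurableSet_chartPiece {n : ℕ} (p : Fin n → X) (k : Fin n) :
    MeasurableSet (chartPiece p k) :=
  (chartAt ℂ (p k)).open_source.measurableSet.diff
    (MeasurableSet.iUnion fun j : {j // j < k} => (chartAt ℂ (p j)).open_source.measurableSet)

end ChartImages

theorem ofReal_abs_det_restrictScalars_toSpanSingleton (c : ℂ) :
    ENNReal.ofReal |((ContinuousLinearMap.toSpanSingleton ℂ c).restrictScalars ℝ).det|
      = ‖c‖ₑ ^ 2 := by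
  have : ((ContinuousLinearMap.toSpanSingleton ℂ c).restrictScalars ℝ).det = ‖c‖ ^ 2 := by
    simp [ContinuousLinearMap.det, LinearMap.det_restrictScalars,
      Algebra.norm_complex_eq, Complex.normSq_eq_norm_sq]
  rw [this, abs_of_nonneg (by positivity), ENNReal.ofReal_pow (norm_nonneg _),
    ofReal_norm]

section Area

variable {X : Type*} [TopologicalSpace X] [ChartedSpace ℂ X] [IsManifold 𝓘(ℂ) ω X]

/-- The integral of the area form `(i / 2) η ∧ conj η` over a part `A` of the domain of the chart
at `p`, computed in that chart. -/
def chartArea (η : HolomorphicOneForm X) (p : X) (A : Set X) : ℝ≥0∞ :=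
  ∫⁻ z in chartAt ℂ p '' A, ‖chartCoeff η p z‖ₑ ^ 2

theorem chartArea_le_sum (η : HolomorphicOneForm X) {p : X} {A : Set X}
    {ι : Type*} (t : Finset ι) {B : ι → Set X} (hcov : ∀ x ∈ A, ∃ j ∈ t, x ∈ B j) :
    chartArea η p A ≤ ∑ j ∈ t, chartArea η p (A ∩ B j) := by
  have h1 : chartAt ℂ p '' A ⊆ ⋃ j : t, chartAt ℂ p '' (A ∩ B j) := by
    rintro _ ⟨x, hx, rfl⟩
    obtain ⟨j, hj, hxj⟩ := hcov x hx
    exact mem_iUnion.2 ⟨⟨j, hj⟩, x, ⟨hx, hxj⟩, rfl⟩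
  refine (lintegral_mono_set h1).trans ((lintegral_iUnion_le _ _).trans ?_)
  rw [tsum_fintype]
  exact (Finset.sum_coe_sort t fun j => chartArea η p (A ∩ B j)).le

variable [MeasurableSpace X] [BorelSpace X]

/-- Invariance of the area under an injective holomorphic map `ψ`: the change of variables formula,
the real Jacobian of a holomorphic function being the square of the norm of its derivative. -/
theorem chartArea_image {ψ : X → X} (hψ : ContMDiff 𝓘(ℂ) 𝓘(ℂ) ω ψ) (hinj : Function.Injective ψ)
    {η ζ : HolomorphicOneForm X}
    (hζ : ∀ x, ζ x = (η (ψ x)).comp (mfderiv 𝓘(ℂ) 𝓘(ℂ) ψ x)) {p q : X} {A : Set X}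
    (hA : MeasurableSet A) (hp : A ⊆ (chartAt ℂ p).source) (hq : ψ '' A ⊆ (chartAt ℂ q).source) :
    chartArea ζ p A = chartArea η q (ψ '' A) := by
  have hl : ∀ x ∈ A, (chartAt ℂ p).symm (chartAt ℂ p x) = x := fun x hx =>
    (chartAt ℂ p).left_inv (hp hx)
  have himg : chartAt ℂ q '' (ψ '' A) = chartMap ψ p q '' (chartAt ℂ p '' A) := by
    rw [image_image, image_image]
    refine image_congr fun x hx => ?_
    rw [chartMap, hl x hx]
  rw [chartArea, chartArea, himg, lintegral_image_eq_lintegral_abs_det_fderiv_mul volume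
    (measurableSet_chart_image p hA hp)
    (f' := fun z => (ContinuousLinearMap.toSpanSingleton ℂ
      (deriv (chartMap ψ p q) z)).restrictScalars ℝ)]
  · refine setLIntegral_congr_fun (measurableSet_chart_image p hA hp) ?_
    rintro _ ⟨x, hx, rfl⟩
    simp only
    rw [ofReal_abs_det_restrictScalars_toSpanSingleton, chartCoeff_comp hψ η ζ hζ
      ((chartAt ℂ p).map_source (hp hx)) (by rw [hl x hx]; exact hq (mem_image_of_mem _ hx)),
      enorm_mul, mul_pow]
  · rintro _ ⟨x, hx, rfl⟩
    have := (differentiableAt_chartMap hψ ((chartAt ℂ p).map_source (hp hx))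
      (q := q) (by rw [hl x hx]; exact hq (mem_image_of_mem _ hx))).hasDerivAt
    exact (this.hasFDerivAt.restrictScalars ℝ).hasFDerivWithinAt
  · rintro _ ⟨x, hx, rfl⟩ _ ⟨y, hy, rfl⟩ hxy
    rw [chartMap, chartMap, hl x hx, hl y hy] at hxy
    rw [hinj ((chartAt ℂ q).injOn (hq (mem_image_of_mem _ hx)) (hq (mem_image_of_mem _ hy)) hxy)]

theorem chartArea_eq_chartArea (η : HolomorphicOneForm X) {p q : X} {A : Set X}
    (hA : MeasurableSet A) (hp : A ⊆ (chartAt ℂ p).source) (hq : A ⊆ (chartAt ℂ q).source) :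
    chartArea η p A = chartArea η q A := by
  have := chartArea_image contMDiff_id Function.injective_id (η := η) (ζ := η)
    (fun x => by rw [mfderiv_id]; rfl) hA hp (q := q) (by rwa [image_id])
  rwa [image_id] at this

theorem chartArea_eq_sum (η : HolomorphicOneForm X) {p : X} {A : Set X}
    (hA : MeasurableSet A) (hp : A ⊆ (chartAt ℂ p).source) {ι : Type*} [Fintype ι] {B : ι → Set X}
    (hB : ∀ j, MeasurableSet (B j)) (hd : Pairwise (Function.onFun Disjoint B))
    (hcov : ∀ x, ∃ j, x ∈ B j) :
    chartArea η p A = ∑ j, chartArea η p (A ∩ B j) := by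
  have h1 : chartAt ℂ p '' A = ⋃ j, chartAt ℂ p '' (A ∩ B j) := by
    rw [← image_iUnion, ← inter_iUnion, iUnion_eq_univ_iff.2 hcov, inter_univ]
  rw [chartArea, h1, lintegral_iUnion (fun j => measurableSet_chart_image p (hA.inter (hB j))
    (inter_subset_left.trans hp)), tsum_fintype]
  · rfl
  · intro i j hij
    refine disjoint_left.2 ?_
    rintro _ ⟨x, hx, rfl⟩ ⟨y, hy, hxy⟩
    rw [(chartAt ℂ p).injOn (hp hy.1) (hp hx.1) hxy] at hy
    exact disjoint_left.1 (hd hij) hx.2 hy.2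

/-- Every measurable part of a chart domain has finite area, by the compactness of the surface:
the chart domain itself need not be relatively compact in its chart. -/
theorem chartArea_lt_top [CompactSpace X] (η : HolomorphicOneForm X) {p : X} {A : Set X}
    (hA : MeasurableSet A) (hp : A ⊆ (chartAt ℂ p).source) : chartArea η p A < ⊤ := by
  choose R hR hRt using exists_chart_disc (X := X)
  set U := fun x : X => (chartAt ℂ x).source ∩ chartAt ℂ x ⁻¹' Metric.ball (chartAt ℂ x x) (R x)
  have hU : ∀ x, IsOpen (U x) := fun x => (chartAt ℂ x).continuousOn.isOpen_inter_preimage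
    (chartAt ℂ x).open_source Metric.isOpen_ball
  obtain ⟨t, ht⟩ := isCompact_univ.elim_nhds_subcover U
    (fun x _ => (hU x).mem_nhds ⟨mem_chart_source ℂ x, Metric.mem_ball_self (hR x)⟩)
  refine (chartArea_le_sum η t (B := U) fun x _ => by simpa using ht.2 (mem_univ x)).trans_lt ?_
  refine ENNReal.sum_lt_top.2 fun j _ => ?_
  rw [chartArea_eq_chartArea η (hA.inter (hU j).measurableSet) (inter_subset_left.trans hp)
    (inter_subset_right.trans inter_subset_left)]
  obtain ⟨b, hb⟩ := (isCompact_closedBall (chartAt ℂ j j) (2 * R j)).exists_bound_of_continuousOn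
      ((continuousOn_chartCoeff η j).mono (hRt j))
  have hsub : chartAt ℂ j '' (A ∩ U j) ⊆ Metric.closedBall (chartAt ℂ j j) (2 * R j) := by
    rintro _ ⟨x, hx, rfl⟩
    exact Metric.closedBall_subset_closedBall (by linarith [hR j])
      (Metric.ball_subset_closedBall hx.2.2)
  calc chartArea η j (A ∩ U j)
      ≤ ∫⁻ z in Metric.closedBall (chartAt ℂ j j) (2 * R j), ‖chartCoeff η j z‖ₑ ^ 2 :=
        lintegral_mono_set hsub
    _ ≤ ∫⁻ z in Metric.closedBall (chartAt ℂ j j) (2 * R j), (ENNReal.ofReal b) ^ 2 := by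
        refine setLIntegral_mono' Metric.isClosed_closedBall.measurableSet fun z hz => ?_
        gcongr
        rw [← ofReal_norm]
        exact ENNReal.ofReal_le_ofReal (hb z hz)
    _ < ⊤ := by
        rw [setLIntegral_const]
        exact ENNReal.mul_lt_top (by simp) measure_closedBall_lt_top

theorem memLp_chartCoeff [CompactSpace X] (η : HolomorphicOneForm X) {p : X} {A : Set X}
    (hA : MeasurableSet A) (hp : A ⊆ (chartAt ℂ p).source) :
    MemLp (chartCoeff η p) 2 (volume.restrict (chartAt ℂ p '' A)) := by
  have hsub : chartAt ℂ p '' A ⊆ (chartAt ℂ p).target :=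
    image_subset_iff.2 fun x hx => (chartAt ℂ p).map_source (hp hx)
  have hm : AEStronglyMeasurable (chartCoeff η p) (volume.restrict (chartAt ℂ p '' A)) :=
    ((continuousOn_chartCoeff η p).mono hsub).aestronglyMeasurable
      (measurableSet_chart_image p hA hp)
  refine ⟨hm, ?_⟩
  rw [eLpNorm_lt_top_iff_lintegral_rpow_enorm_lt_top (by simp) (by simp)]
  simpa [chartArea] using chartArea_lt_top η hA hp

theorem integrableOn_chartCoeff_mul_conj [CompactSpace X] (η θ : HolomorphicOneForm X) {p : X}
    {A : Set X} (hA : MeasurableSet A) (hp : A ⊆ (chartAt ℂ p).source) :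
    IntegrableOn (fun z => chartCoeff η p z * conj (chartCoeff θ p z)) (chartAt ℂ p '' A) :=
  (memLp_chartCoeff η hA hp).integrable_mul (memLp_chartCoeff θ hA hp).star

end Area

variable {X : Type*} [TopologicalSpace X] [ChartedSpace ℂ X] [IsManifold 𝓘(ℂ) ω X] [CompactSpace X]

theorem hermitianForm_eq_sum (η θ : HolomorphicOneForm X) :
    hermitianForm η θ = ∑ k, ∫ z in chartAt ℂ (coverPoint X k) '' chartPiece (coverPoint X) k,
      chartCoeff η (coverPoint X k) z * conj (chartCoeff θ (coverPoint X k) z) := rfl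

theorem integrableOn_hermitianForm (η θ : HolomorphicOneForm X)
    (k : Fin (exists_chart_cover X).choose) :
    IntegrableOn (fun z => chartCoeff η (coverPoint X k) z * conj (chartCoeff θ (coverPoint X k) z))
      (chartAt ℂ (coverPoint X k) '' chartPiece (coverPoint X) k) := by
  let _ : MeasurableSpace X := borel X
  have _ : BorelSpace X := ⟨rfl⟩
  exact integrableOn_chartCoeff_mul_conj η θ (measurableSet_chartPiece _ k) (chartPiece_subset _ k)

theorem hermitianForm_conj (η θ : HolomorphicOneForm X) :
    conj (hermitianForm η θ) = hermitianForm θ η := by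
  simp only [hermitianForm_eq_sum, map_sum, ← integral_conj, map_mul, Complex.conj_conj, mul_comm]

theorem hermitianForm_add_left (η η' θ : HolomorphicOneForm X) :
    hermitianForm (η + η') θ = hermitianForm η θ + hermitianForm η' θ := by
  simp only [hermitianForm_eq_sum, chartCoeff_add, add_mul, ← Finset.sum_add_distrib]
  exact Finset.sum_congr rfl fun k _ =>
    integral_add (integrableOn_hermitianForm η θ k) (integrableOn_hermitianForm η' θ k)

theorem hermitianForm_smul_left (c : ℂ) (η θ : HolomorphicOneForm X) :
    hermitianForm (c • η) θ = c * hermitianForm η θ := by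
  simp only [hermitianForm_eq_sum, chartCoeff_smul, mul_assoc, integral_const_mul, Finset.mul_sum]

theorem hermitianForm_add_right (η θ θ' : HolomorphicOneForm X) :
    hermitianForm η (θ + θ') = hermitianForm η θ + hermitianForm η θ' := by
  rw [← hermitianForm_conj, hermitianForm_add_left, map_add, hermitianForm_conj,
    hermitianForm_conj]

theorem hermitianForm_smul_right (c : ℂ) (η θ : HolomorphicOneForm X) :
    hermitianForm η (c • θ) = conj c * hermitianForm η θ := by
  rw [← hermitianForm_conj, hermitianForm_smul_left, map_mul, hermitianForm_conj]

theorem hermitianForm_self [MeasurableSpace X] [BorelSpace X] (η : HolomorphicOneForm X) :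
    hermitianForm η η =
      ((∑ k, chartArea η (coverPoint X k) (chartPiece (coverPoint X) k)).toReal : ℂ) := by
  have hfin : ∀ k, chartArea η (coverPoint X k) (chartPiece (coverPoint X) k) < ⊤ := fun k =>
    chartArea_lt_top η (measurableSet_chartPiece _ k) (chartPiece_subset _ k)
  rw [ENNReal.toReal_sum fun k _ => (hfin k).ne, hermitianForm_eq_sum, Complex.ofReal_sum]
  refine Finset.sum_congr rfl fun k _ => ?_
  have h1 : ∀ z, chartCoeff η (coverPoint X k) z * conj (chartCoeff η (coverPoint X k) z)
      = ((‖chartCoeff η (coverPoint X k) z‖ ^ 2 : ℝ) : ℂ) := fun z => by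
    rw [Complex.mul_conj, Complex.normSq_eq_norm_sq]
  simp only [h1]
  rw [integral_complex_ofReal, chartArea, integral_eq_lintegral_of_nonneg_ae
    (Eventually.of_forall fun z => by positivity)]
  · congr 3
    funext z
    rw [ENNReal.ofReal_pow (norm_nonneg _), ofReal_norm]
  · exact ((memLp_chartCoeff η (measurableSet_chartPiece _ k)
      (chartPiece_subset _ k)).aestronglyMeasurable.norm.pow 2)

/-- The Hermitian form does not depend on the way in which the surface is cut, whence it is
invariant under automorphisms: refine the pieces by the inverse images of the pieces. -/
theorem hermitianForm_self_pullback {G : Type*} [CommGroup G] [MulAction G X]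
    [HolomorphicAction G X] (g : G) (η : HolomorphicOneForm X) :
    hermitianForm (formPullback g η) (formPullback g η) = hermitianForm η η := by
  let _ : MeasurableSpace X := borel X
  have _ : BorelSpace X := ⟨rfl⟩
  have hc : ∀ g : G, Continuous fun x : X => g • x := fun g =>
    (HolomorphicAction.contMDiff_smul g).continuous
  let A := chartPiece (coverPoint X)
  have hA : ∀ k, MeasurableSet (A k) := measurableSet_chartPiece _
  have hpre : ∀ k, MeasurableSet ((fun x : X => g • x) ⁻¹' A k) := fun k =>
    (hc g).measurable (hA k)
  have himg : ∀ B : Set X, (fun x : X => g • x) '' B = (fun x : X => g⁻¹ • x) ⁻¹' B := fun B => by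
    ext x
    constructor
    · rintro ⟨y, hy, rfl⟩
      simpa using hy
    · exact fun h => ⟨g⁻¹ • x, h, by simp⟩
  have himgm : ∀ k, MeasurableSet ((fun x : X => g • x) '' A k) := fun k => by
    rw [himg]; exact (hc g⁻¹).measurable (hA k)
  have hd := pairwise_disjoint_chartPiece (coverPoint X)
  have hcov := exists_mem_chartPiece (exists_mem_coverPoint_source X)
  rw [hermitianForm_self, hermitianForm_self]
  congr 2
  calc ∑ k, chartArea (formPullback g η) (coverPoint X k) (A k)
      = ∑ k, ∑ j, chartArea (formPullback g η) (coverPoint X k)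
          (A k ∩ (fun x : X => g • x) ⁻¹' A j) := by
        refine Finset.sum_congr rfl fun k _ => ?_
        exact chartArea_eq_sum _ (hA k) (chartPiece_subset _ k) hpre
          (fun i j hij => (hd hij).preimage _) (fun x => hcov (g • x))
    _ = ∑ k, ∑ j, chartArea η (coverPoint X j) (A j ∩ (fun x : X => g • x) '' A k) := by
        refine Finset.sum_congr rfl fun k _ => Finset.sum_congr rfl fun j _ => ?_
        rw [chartArea_image (HolomorphicAction.contMDiff_smul g) (MulAction.injective g)
          (η := η) (q := coverPoint X j) (fun _ => rfl) ((hA k).inter (hpre j))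
          (inter_subset_left.trans (chartPiece_subset _ k)), image_inter_preimage, inter_comm]
        rw [image_inter_preimage]
        exact inter_subset_right.trans (chartPiece_subset _ j)
    _ = ∑ j, ∑ k, chartArea η (coverPoint X j) (A j ∩ (fun x : X => g • x) '' A k) :=
        Finset.sum_comm
    _ = ∑ j, chartArea η (coverPoint X j) (A j) := by
        refine Finset.sum_congr rfl fun j _ => ?_
        refine (chartArea_eq_sum _ (hA j) (chartPiece_subset _ j) himgm
          (fun i j hij => ?_) (fun x => ?_)).symm
        · exact (disjoint_image_iff (MulAction.injective g)).2 (hd hij)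
        · obtain ⟨k, hk⟩ := hcov (g⁻¹ • x)
          exact ⟨k, g⁻¹ • x, hk, by simp⟩

theorem hermitianForm_pullback {G : Type*} [CommGroup G] [MulAction G X]
    [HolomorphicAction G X] (g : G) (η θ : HolomorphicOneForm X) :
    hermitianForm (formPullback g η) (formPullback g θ) = hermitianForm η θ := by
  -- polarization
  have h1 := hermitianForm_self_pullback g (η + θ)
  have h2 := hermitianForm_self_pullback g (η + Complex.I • θ)
  have h3 := hermitianForm_self_pullback g η
  have h4 := hermitianForm_self_pullback g θ
  simp only [map_add, map_smul, hermitianForm_add_left, hermitianForm_add_right,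
    hermitianForm_smul_left, hermitianForm_smul_right, h3, h4, Complex.conj_I] at h1 h2
  linear_combination (1 / 2) * h1 + (1 / 2) * Complex.I * h2 +
    (1 / 2) * (hermitianForm (formPullback g η) (formPullback g θ) - hermitianForm η θ
      - hermitianForm (formPullback g θ) (formPullback g η) + hermitianForm θ η) * Complex.I_sq

theorem hermitianForm_self_nonneg (η : HolomorphicOneForm X) : 0 ≤ (hermitianForm η η).re := by
  let _ : MeasurableSpace X := borel X
  have _ : BorelSpace X := ⟨rfl⟩
  rw [hermitianForm_self, Complex.ofReal_re]
  exact ENNReal.toReal_nonneg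

theorem eq_zero_of_hermitianForm_self {η : HolomorphicOneForm X} (h : hermitianForm η η = 0) :
    η = 0 := by
  let _ : MeasurableSpace X := borel X
  have _ : BorelSpace X := ⟨rfl⟩
  have hfin : ∀ k, chartArea η (coverPoint X k) (chartPiece (coverPoint X) k) < ⊤ := fun k =>
    chartArea_lt_top η (measurableSet_chartPiece _ k) (chartPiece_subset _ k)
  rw [hermitianForm_self, Complex.ofReal_eq_zero, ENNReal.toReal_eq_zero_iff,
    or_iff_left (ENNReal.sum_lt_top.2 fun k _ => hfin k).ne, Finset.sum_eq_zero_iff] at h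
  refine HolomorphicOneForm.eq_zero_of_chartCoeff fun x => ?_
  have hx : chartArea η x (chartAt ℂ x).source = 0 := by
    refine le_antisymm ((chartArea_le_sum η Finset.univ (B := chartPiece (coverPoint X))
      fun y _ => ?_).trans_eq (Finset.sum_eq_zero fun k _ => ?_)) zero_le
    · simpa using exists_mem_chartPiece (exists_mem_coverPoint_source X) y
    · rw [chartArea_eq_chartArea η ((chartAt ℂ x).open_source.measurableSet.inter
        (measurableSet_chartPiece _ k)) inter_subset_left
        (inter_subset_right.trans (chartPiece_subset _ k))]
      exact le_antisymm ((lintegral_mono_set (image_mono inter_subset_right)).trans_eq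
        (h k (Finset.mem_univ k))) zero_le
  rw [chartArea, (chartAt ℂ x).image_source_eq_target] at hx
  by_contra hne
  -- a coefficient that is not zero at a point is bounded away from zero nearby
  have hcont : ContinuousAt (chartCoeff η x) (chartAt ℂ x x) :=
    (differentiableAt_chartCoeff η (mem_chart_target ℂ x)).continuousAt
  obtain ⟨O, hO, hOo, hxO⟩ := mem_nhds_iff.1 (inter_mem
    ((chartAt ℂ x).open_target.mem_nhds (mem_chart_target ℂ x))
    (hcont.eventually_ne hne))
  have h2 : ∫⁻ z in O, ‖chartCoeff η x z‖ₑ ^ 2 = 0 :=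
    le_antisymm ((lintegral_mono_set fun z hz => (hO hz).1).trans_eq hx) zero_le
  have hpos : 0 < volume O := hOo.measure_pos volume ⟨_, hxO⟩
  have hm : AEMeasurable (fun z => ‖chartCoeff η x z‖ₑ ^ 2) (volume.restrict O) :=
    (((continuousOn_chartCoeff η x).mono fun z hz => (hO hz).1).aemeasurable
      hOo.measurableSet).enorm.pow_const 2
  rw [setLIntegral_eq_zero_iff' hOo.measurableSet hm, ae_iff] at h2
  refine hpos.ne' (measure_mono_null (fun z hz => ?_) h2)
  exact fun h => (hO hz).2 (by simpa using h hz)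

end HermitianForm

/-! ### Local primitives and integration along paths -/

section Periods

open MeasureTheory intervalIntegral

variable {X : Type*} [TopologicalSpace X] [ChartedSpace ℂ X] [IsManifold 𝓘(ℂ) ω X]

/-- The function `P` is a primitive of the form `η` on the set `S`: `dP = η`, expressed at each
point in the charts of the surface. -/
def IsPrimitiveOn (η : HolomorphicOneForm X) (P : X → ℂ) (S : Set X) : Prop :=
  ∀ x ∈ S, ∀ z ∈ (chartAt ℂ x).target, (chartAt ℂ x).symm z ∈ S →
    HasDerivAt (fun w => P ((chartAt ℂ x).symm w)) (chartCoeff η x z) z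

/-- Every point has a neighbourhood on which all holomorphic one-forms have a primitive. -/
theorem exists_isPrimitiveOn (p : X) : ∃ S : Set X, IsOpen S ∧ p ∈ S ∧
    ∃ P : HolomorphicOneForm X → X → ℂ, ∀ η, IsPrimitiveOn η (P η) S := by
  obtain ⟨R, hR, hRt⟩ := exists_chart_disc p
  have hsub : Metric.ball (chartAt ℂ p p) R ⊆ (chartAt ℂ p).target :=
    Metric.ball_subset_closedBall.trans
      ((Metric.closedBall_subset_closedBall (by linarith)).trans hRt)
  have hF : ∀ η : HolomorphicOneForm X, ∃ F : ℂ → ℂ, ∀ z ∈ Metric.ball (chartAt ℂ p p) R,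
      HasDerivAt F (chartCoeff η p z) z := fun η =>
    DifferentiableOn.isExactOn_ball fun z hz =>
      (differentiableAt_chartCoeff η (hsub hz)).differentiableWithinAt
  choose F hF using hF
  refine ⟨(chartAt ℂ p).source ∩ chartAt ℂ p ⁻¹' Metric.ball (chartAt ℂ p p) R,
    (chartAt ℂ p).continuousOn.isOpen_inter_preimage (chartAt ℂ p).open_source Metric.isOpen_ball,
    ⟨mem_chart_source ℂ p, Metric.mem_ball_self hR⟩, fun η x => F η (chartAt ℂ p x), ?_⟩
  intro η x _ z hz hzS
  have h1 := (differentiableAt_chartMap contMDiff_id (q := p) hz hzS.1).hasDerivAt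
  have h2 := (hF η _ hzS.2).comp z h1
  rw [chartCoeff_eq_transition η (q := p) hz hzS.1, mul_comm]
  exact h2

/-- Two primitives of a form differ by a locally constant function; the neighbourhood is
the same for all forms. -/
theorem eventually_sub_eq_of_isPrimitiveOn {S : Set X} (hS : IsOpen S) {x : X} (hx : x ∈ S) :
    ∀ᶠ y in 𝓝 x, ∀ (η : HolomorphicOneForm X) (P Q : X → ℂ), IsPrimitiveOn η P S →
      IsPrimitiveOn η Q S → P y - Q y = P x - Q x := by
  have hl := (chartAt ℂ x).left_inv (mem_chart_source ℂ x)
  have ho : IsOpen ((chartAt ℂ x).target ∩ (chartAt ℂ x).symm ⁻¹' S) :=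
    (chartAt ℂ x).continuousOn_symm.isOpen_inter_preimage (chartAt ℂ x).open_target hS
  obtain ⟨ε, hε, hb⟩ := Metric.isOpen_iff.1 ho (chartAt ℂ x x)
    ⟨mem_chart_target ℂ x, by rwa [mem_preimage, hl]⟩
  filter_upwards [(chartAt ℂ x).open_source.mem_nhds (mem_chart_source ℂ x),
    ((chartAt ℂ x).continuousAt (mem_chart_source ℂ x)).preimage_mem_nhds
      (Metric.ball_mem_nhds _ hε)] with y hys hyb η P Q hP hQ
  have hd : ∀ z ∈ Metric.ball (chartAt ℂ x x) ε,
      HasDerivAt (fun w => P ((chartAt ℂ x).symm w) - Q ((chartAt ℂ x).symm w)) 0 z := by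
    intro z hz
    have := (hP x hx z (hb hz).1 (hb hz).2).sub (hQ x hx z (hb hz).1 (hb hz).2)
    rwa [sub_self] at this
  have := (convex_ball (chartAt ℂ x x) ε).is_const_of_fderivWithin_eq_zero (𝕜 := ℂ)
    (fun z hz => (hd z hz).differentiableAt.differentiableWithinAt)
    (fun z hz => by
      rw [fderivWithin_of_isOpen Metric.isOpen_ball hz, (hd z hz).hasFDerivAt.fderiv]
      ext; simp) hyb (Metric.mem_ball_self hε)
  simpa only [hl, (chartAt ℂ x).left_inv hys] using this

/-- The integrand in the definition of `pathIntegral`. -/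
def pathIntegrand (η : HolomorphicOneForm X) (γ : C1Path X) (t : ℝ) : ℂ :=
  η (γ.1 t) (mfderiv 𝓘(ℝ) 𝓘(ℝ, ℂ) γ.1 t (1 : ℝ) : ℂ)

theorem C1Path.mdifferentiableAt {X : Type*} [TopologicalSpace X] [ChartedSpace ℂ X]
    (γ : C1Path X) {t : ℝ} (ht : t ∈ Ioo (0 : ℝ) 1) :
    MDifferentiableAt 𝓘(ℝ) 𝓘(ℝ, ℂ) γ.1 t :=
  (γ.2.mdifferentiableOn one_ne_zero t (Ioo_subset_Icc_self ht)).mdifferentiableAt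
    (Icc_mem_nhds ht.1 ht.2)

theorem C1Path.hasDerivAt {X : Type*} [TopologicalSpace X] [ChartedSpace ℂ X]
    (γ : C1Path X) {t : ℝ} (ht : t ∈ Ioo (0 : ℝ) 1) :
    HasDerivAt (chartAt ℂ (γ.1 t) ∘ γ.1) (mfderiv 𝓘(ℝ) 𝓘(ℝ, ℂ) γ.1 t (1 : ℝ) : ℂ) t := by
  let v : ℝ →L[ℝ] ℂ := mfderiv 𝓘(ℝ) 𝓘(ℝ, ℂ) γ.1 t
  have h : HasFDerivWithinAt (E := ℝ) (F := ℂ) (chartAt ℂ (γ.1 t) ∘ γ.1) v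
      (range (𝓘(ℝ) : ℝ → ℝ)) t := (γ.mdifferentiableAt ht).hasMFDerivAt.2
  rw [modelWithCornersSelf_coe, range_id, hasFDerivWithinAt_univ] at h
  exact h.hasDerivAt

theorem pathIntegrand_eq (η : HolomorphicOneForm X) (γ : C1Path X) {t : ℝ} {x : X} {c : ℂ}
    (ht : t ∈ Ioo (0 : ℝ) 1) (hx : γ.1 t ∈ (chartAt ℂ x).source)
    (hg : HasDerivAt (chartAt ℂ x ∘ γ.1) c t) :
    pathIntegrand η γ t = chartCoeff η x (chartAt ℂ x (γ.1 t)) * c := by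
  have hcont : ContinuousAt γ.1 t := (γ.mdifferentiableAt ht).continuousAt
  have hz : chartAt ℂ x (γ.1 t) ∈ (chartAt ℂ x).target := (chartAt ℂ x).map_source hx
  have hl := (chartAt ℂ x).left_inv hx
  have hs : (chartAt ℂ x).symm (chartAt ℂ x (γ.1 t)) ∈ (chartAt ℂ (γ.1 t)).source := by
    rw [hl]; exact mem_chart_source ℂ _
  have h1 := (differentiableAt_chartMap contMDiff_id hz hs).hasDerivAt
  have h2 : HasDerivAt (chartMap id x (γ.1 t) ∘ (chartAt ℂ x ∘ γ.1))
      (c * deriv (chartMap id x (γ.1 t)) (chartAt ℂ x (γ.1 t))) t :=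
    (h1.hasFDerivAt.restrictScalars ℝ).comp_hasDerivAt t hg
  have h3 : HasDerivAt (chartAt ℂ (γ.1 t) ∘ γ.1)
      (c * deriv (chartMap id x (γ.1 t)) (chartAt ℂ x (γ.1 t))) t := by
    refine h2.congr_of_eventuallyEq ?_
    filter_upwards [hcont.preimage_mem_nhds ((chartAt ℂ x).open_source.mem_nhds hx)] with s hs
    simp only [Function.comp, chartMap, (chartAt ℂ x).left_inv hs, id]
  have h4 := (γ.hasDerivAt ht).unique h3
  have h5 : pathIntegrand η γ t
      = (c * deriv (chartMap id x (γ.1 t)) (chartAt ℂ x (γ.1 t))) * (η (γ.1 t) (1 : ℂ) : ℂ) := by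
    rw [← h4]
    have hlin : ∀ w : ℂ, (η (γ.1 t) : ℂ → ℂ) w = w * (η (γ.1 t) : ℂ → ℂ) (1 : ℂ) := fun w => by
      have := map_smul (η (γ.1 t) : ℂ →L[ℂ] ℂ) w (1 : ℂ)
      rwa [smul_eq_mul, smul_eq_mul, mul_one] at this
    exact hlin _
  rw [h5, chartCoeff_eq_transition η hz hs, chartMap, hl, id, chartCoeff_self]
  ring

/-- The fundamental theorem of calculus along a path, near a parameter `t₀` (which may be an end
point); the neighbourhood of `t₀` is the same for all forms. -/
theorem eventually_integral_pathIntegrand (γ : C1Path X) {t₀ : ℝ} (ht₀ : t₀ ∈ Icc (0 : ℝ) 1)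
    {S : Set X} (hS : IsOpen S) (hγ : γ.1 t₀ ∈ S) :
    ∃ I ∈ 𝓝[Icc (0 : ℝ) 1] t₀, ∀ (η : HolomorphicOneForm X) (P : X → ℂ), IsPrimitiveOn η P S →
      IntegrableOn (pathIntegrand η γ) I ∧
      ∀ t ∈ I, ∫ s in t₀..t, pathIntegrand η γ s = P (γ.1 t) - P (γ.1 t₀) := by
  set x := γ.1 t₀ with hx
  have hc : ContDiffWithinAt ℝ 1 (chartAt ℂ x ∘ γ.1) (Icc 0 1) t₀ := by
    have h : ContDiffWithinAt ℝ 1 (chartAt ℂ x ∘ γ.1) (Icc 0 1 ∩ range (𝓘(ℝ) : ℝ → ℝ)) t₀ :=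
      (contMDiffWithinAt_iff.1 (γ.2 t₀ ht₀)).2
    rwa [modelWithCornersSelf_coe, range_id, inter_univ] at h
  obtain ⟨u, hu, -, hcu⟩ := hc.contDiffOn le_rfl (by simp)
  rw [insert_eq_of_mem ht₀] at hu
  have hcont : ContinuousWithinAt γ.1 (Icc 0 1) t₀ := (γ.2 t₀ ht₀).continuousWithinAt
  have hV : IsOpen (S ∩ (chartAt ℂ x).source) := hS.inter (chartAt ℂ x).open_source
  have hmem := inter_mem hu (hcont.preimage_mem_nhdsWithin
    (hV.mem_nhds ⟨hγ, mem_chart_source ℂ x⟩))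
  obtain ⟨δ, hδ, hsub⟩ := Metric.mem_nhdsWithin_iff.1 hmem
  -- the compact interval of parameters within `δ / 2` of `t₀`
  set a := max 0 (t₀ - δ / 2) with ha
  set b := min 1 (t₀ + δ / 2) with hb
  have hab : a < b := by
    rw [ha, hb, max_lt_iff, lt_min_iff, lt_min_iff]
    exact ⟨⟨one_pos, by linarith [ht₀.1]⟩, by linarith [ht₀.2], by linarith⟩
  have hI01 : Icc a b ⊆ Icc 0 1 := Icc_subset_Icc (le_max_left _ _) (min_le_left _ _)
  have hIsub : Icc a b ⊆ u ∩ γ.1 ⁻¹' (S ∩ (chartAt ℂ x).source) := fun t ht => by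
    refine hsub ⟨?_, hI01 ht⟩
    rw [Metric.mem_ball, Real.dist_eq, abs_lt]
    have h1 := (le_max_right _ _).trans ht.1
    have h2 := ht.2.trans (min_le_right _ _)
    constructor <;> linarith
  have ht₀I : t₀ ∈ Icc a b :=
    ⟨max_le ht₀.1 (by linarith), le_min ht₀.2 (by linarith)⟩
  have hInhds : Icc a b ∈ 𝓝[Icc (0 : ℝ) 1] t₀ := by
    refine Metric.mem_nhdsWithin_iff.2 ⟨δ / 2, by positivity, fun t ht => ?_⟩
    have h1 := ht.1
    rw [Metric.mem_ball, Real.dist_eq, abs_lt] at h1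
    exact ⟨max_le ht.2.1 (by linarith), le_min ht.2.2 (by linarith)⟩
  have hud : UniqueDiffOn ℝ (Icc a b) := uniqueDiffOn_Icc hab
  have hcI : ContDiffOn ℝ 1 (chartAt ℂ x ∘ γ.1) (Icc a b) := hcu.mono fun t ht => (hIsub ht).1
  have hdc : ContinuousOn (derivWithin (chartAt ℂ x ∘ γ.1) (Icc a b)) (Icc a b) :=
    hcI.continuousOn_derivWithin hud le_rfl
  have hderiv : ∀ t ∈ Ioo a b, HasDerivAt (chartAt ℂ x ∘ γ.1)
      (derivWithin (chartAt ℂ x ∘ γ.1) (Icc a b) t) t := fun t ht =>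
    ((hcI.differentiableOn one_ne_zero t (Ioo_subset_Icc_self ht)).hasDerivWithinAt).hasDerivAt
      (Icc_mem_nhds ht.1 ht.2)
  have hγI : ∀ t ∈ Icc a b, γ.1 t ∈ S ∧ γ.1 t ∈ (chartAt ℂ x).source := fun t ht => (hIsub ht).2
  refine ⟨Icc a b, hInhds, fun η P hP => ?_⟩
  set h := fun t => chartCoeff η x (chartAt ℂ x (γ.1 t)) *
    derivWithin (chartAt ℂ x ∘ γ.1) (Icc a b) t with hh
  have hhc : ContinuousOn h (Icc a b) :=
    ((continuousOn_chartCoeff η x).comp hcI.continuousOn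
      fun t ht => (chartAt ℂ x).map_source (hγI t ht).2).mul hdc
  have hEq : ∀ t ∈ Ioo a b, pathIntegrand η γ t = h t := fun t ht =>
    pathIntegrand_eq η γ
      ⟨(le_max_left _ _).trans_lt ht.1, ht.2.trans_le (min_le_left _ _)⟩
      (hγI t (Ioo_subset_Icc_self ht)).2 (hderiv t ht)
  have hPd : ∀ t ∈ Icc a b, HasDerivAt (fun w => P ((chartAt ℂ x).symm w))
      (chartCoeff η x (chartAt ℂ x (γ.1 t))) (chartAt ℂ x (γ.1 t)) := fun t ht =>
    hP x hγ _ ((chartAt ℂ x).map_source (hγI t ht).2)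
      (by rw [(chartAt ℂ x).left_inv (hγI t ht).2]; exact (hγI t ht).1)
  have hPe : ∀ t ∈ Icc a b, P ((chartAt ℂ x).symm (chartAt ℂ x (γ.1 t))) = P (γ.1 t) :=
    fun t ht => by rw [(chartAt ℂ x).left_inv (hγI t ht).2]
  have hcP : ContinuousOn (fun t => P ((chartAt ℂ x).symm (chartAt ℂ x (γ.1 t)))) (Icc a b) := by
    intro t ht
    exact (hPd t ht).continuousAt.comp_continuousWithinAt (f := chartAt ℂ x ∘ γ.1)
      (hcI.continuousOn t ht)
  have hPt : ∀ t ∈ Ioo a b,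
      HasDerivAt (fun t => P ((chartAt ℂ x).symm (chartAt ℂ x (γ.1 t)))) (h t) t := by
    intro t ht
    have := ((hPd t (Ioo_subset_Icc_self ht)).hasFDerivAt.restrictScalars ℝ).comp_hasDerivAt t
      (hderiv t ht)
    convert! this using 1
    simp [hh, mul_comm]
  constructor
  · rw [integrableOn_Icc_iff_integrableOn_Ioo]
    exact ((hhc.integrableOn_Icc).mono_set Ioo_subset_Icc_self).congr_fun
      (fun t ht => (hEq t ht).symm) measurableSet_Ioo
  · intro t ht
    have hsub' : uIcc t₀ t ⊆ Icc a b := uIcc_subset_Icc ht₀I ht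
    have h1 : ∫ s in t₀..t, pathIntegrand η γ s = ∫ s in t₀..t, h s := by
      refine integral_congr_ae ?_
      have hne : ∀ᵐ s : ℝ, s ≠ a ∧ s ≠ b :=
        ((measure_singleton a : volume {a} = 0).le.antisymm zero_le |> fun h => by
          filter_upwards [compl_mem_ae_iff.2 h,
            compl_mem_ae_iff.2 (measure_singleton b : volume {b} = 0)] with s h1 h2
          exact ⟨h1, h2⟩)
      filter_upwards [hne] with s hs hst
      have := hsub' (uIoc_subset_uIcc hst)
      exact hEq s ⟨lt_of_le_of_ne this.1 (Ne.symm hs.1), lt_of_le_of_ne this.2 hs.2⟩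
    rw [h1, integral_eq_sub_of_hasDeriv_right (f := fun t =>
      P ((chartAt ℂ x).symm (chartAt ℂ x (γ.1 t)))) (hcP.mono hsub') ?_
      ((hhc.mono hsub').intervalIntegrable), hPe t ht, hPe t₀ ht₀I]
    intro s hs
    have h2 : Ioo (min t₀ t) (max t₀ t) ⊆ Ioo a b := Ioo_subset_Ioo (le_min ht₀I.1 ht.1)
      (max_le ht₀I.2 ht.2)
    exact (hPt s (h2 hs)).hasDerivWithinAt

theorem integrableOn_pathIntegrand (η : HolomorphicOneForm X) (γ : C1Path X) :
    IntegrableOn (pathIntegrand η γ) (Icc 0 1) := by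
  refine LocallyIntegrableOn.integrableOn_isCompact (fun t ht => ?_) isCompact_Icc
  obtain ⟨S, hS, hx, P, hP⟩ := exists_isPrimitiveOn (γ.1 t)
  obtain ⟨I, hI, h⟩ := eventually_integral_pathIntegrand γ ht hS hx
  exact ⟨I, hI, (h η _ (hP η)).1⟩

/-- If `Q` is a primitive of all forms up to jumps in the group `Λ`, then
integration along a path computes the increment of `Q` modulo `Λ`. -/
theorem pathIntegral_sub_mem (γ : C1Path X) (Λ : AddSubgroup (HolomorphicOneForm X → ℂ))
    (Q : X → HolomorphicOneForm X → ℂ)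
    (h : ∀ t ∈ Icc (0 : ℝ) 1, ∃ S, IsOpen S ∧ γ.1 t ∈ S ∧ ∃ P : HolomorphicOneForm X → X → ℂ,
      (∀ η, IsPrimitiveOn η (P η) S) ∧
      ∀ y ∈ S, (fun η => (Q y η - P η y) - (Q (γ.1 t) η - P η (γ.1 t))) ∈ Λ) :
    (fun η => pathIntegral η γ - (Q (γ.1 1) η - Q (γ.1 0) η)) ∈ Λ := by
  have hint : ∀ η, ∀ a ∈ Icc (0 : ℝ) 1, ∀ b ∈ Icc (0 : ℝ) 1,
      IntervalIntegrable (pathIntegrand η γ) volume a b := fun η a ha b hb =>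
    ((integrableOn_pathIntegrand η γ).mono_set (uIcc_subset_Icc ha hb)).intervalIntegrable
  refine isPreconnected_Icc.induction₂ (s := Icc (0 : ℝ) 1)
    (fun a b => (fun η => (∫ s in a..b, pathIntegrand η γ s) - (Q (γ.1 b) η - Q (γ.1 a) η)) ∈ Λ)
    ?_ ?_ ?_ (left_mem_Icc.2 zero_le_one) (right_mem_Icc.2 zero_le_one)
  · intro t ht
    obtain ⟨S, hS, hx, P, hP, hQ⟩ := h t ht
    obtain ⟨I, hI, hIP⟩ := eventually_integral_pathIntegrand γ ht hS hx
    have hcont : ContinuousWithinAt γ.1 (Icc 0 1) t := (γ.2 t ht).continuousWithinAt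
    filter_upwards [hI, hcont.preimage_mem_nhdsWithin (hS.mem_nhds hx)] with s hs hsS
    convert! Λ.neg_mem (hQ _ hsS) using 1
    funext η
    rw [(hIP η _ (hP η)).2 s hs, Pi.neg_apply]
    ring
  · intro a b c ha hb hc hab hbc
    convert! Λ.add_mem hab hbc using 1
    funext η
    rw [Pi.add_apply, ← integral_add_adjacent_intervals (hint η a ha b hb) (hint η b hb c hc)]
    ring
  · intro a b ha hb hab
    convert! Λ.neg_mem hab using 1
    funext η
    rw [Pi.neg_apply, integral_symm]
    ring

/-- The integral of a form along a path in the domain of a primitive. -/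
theorem pathIntegral_eq_sub (γ : C1Path X) {S : Set X} (hS : IsOpen S)
    (hγ : ∀ t ∈ Icc (0 : ℝ) 1, γ.1 t ∈ S) {P : HolomorphicOneForm X → X → ℂ}
    (hP : ∀ η, IsPrimitiveOn η (P η) S) (η : HolomorphicOneForm X) :
    pathIntegral η γ = P η (γ.1 1) - P η (γ.1 0) := by
  have := pathIntegral_sub_mem γ ⊥ (fun y η => P η y) fun t ht => ⟨S, hS, hγ t ht, P, hP,
    fun y _ => by
      rw [AddSubgroup.mem_bot]
      funext η
      simp⟩
  rw [AddSubgroup.mem_bot] at this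
  exact sub_eq_zero.1 (congrFun this η)

end Periods

/-! ### The lattice of the Prym variety is countable and spans -/

section PeriodLattice

open MeasureTheory

variable {X : Type*} [TopologicalSpace X] [ChartedSpace ℂ X] [IsManifold 𝓘(ℂ) ω X]

theorem chainIntegral_single (η : HolomorphicOneForm X) (γ : C1Path X) (n : ℤ) :
    chainIntegral η (Finsupp.single γ n) = n * pathIntegral η γ := by
  simp [chainIntegral]

theorem intervalIntegrable_pathIntegrand (η : HolomorphicOneForm X) (γ : C1Path X) :
    IntervalIntegrable (pathIntegrand η γ) volume 0 1 :=
  ((integrableOn_pathIntegrand η γ).mono_set (by rw [uIcc_of_le zero_le_one])).intervalIntegrable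

/-- Integration of forms over a chain, as a linear functional. -/
def chainFunctional (c : C1Path X →₀ ℤ) : Module.Dual ℂ (HolomorphicOneForm X) where
  toFun η := chainIntegral η c
  map_add' η θ := by
    induction c using Finsupp.induction_linear with
    | zero => simp
    | add c d hc hd => rw [map_add, map_add, map_add, hc, hd]; ring
    | single γ n =>
      have : pathIntegral (η + θ) γ = pathIntegral η γ + pathIntegral θ γ :=
        intervalIntegral.integral_add (intervalIntegrable_pathIntegrand η γ)
          (intervalIntegrable_pathIntegrand θ γ)
      rw [chainIntegral_single, chainIntegral_single, chainIntegral_single, this, mul_add]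
  map_smul' a η := by
    induction c using Finsupp.induction_linear with
    | zero => simp
    | add c d hc hd => rw [map_add, map_add, hc, hd, RingHom.id_apply, smul_add]
    | single γ n =>
      have : pathIntegral (a • η) γ = a * pathIntegral η γ :=
        intervalIntegral.integral_const_mul a _
      rw [chainIntegral_single, chainIntegral_single, this, RingHom.id_apply, smul_eq_mul]
      ring

theorem chainBoundary_single {X : Type*} [TopologicalSpace X] [ChartedSpace ℂ X]
    (γ : C1Path X) (n : ℤ) : chainBoundary X (Finsupp.single γ n)
      = Finsupp.single (γ.1 1) n - Finsupp.single (γ.1 0) n := by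
  simp [chainBoundary]

/-- A countable subset of an additive group lies in a countable subgroup. -/
theorem exists_countable_addSubgroup {A : Type*} [AddCommGroup A] {s : Set A} (hs : s.Countable) :
    ∃ Λ : AddSubgroup A, s ⊆ Λ ∧ (Λ : Set A).Countable := by
  have : Countable s := hs.to_subtype
  refine ⟨(Finsupp.linearCombination ℤ ((↑) : s → A)).toAddMonoidHom.range, fun a ha => ?_,
    countable_range _⟩
  exact ⟨Finsupp.single ⟨a, ha⟩ 1, by simp⟩

/-- The group of periods is countable: the jumps of primitives on a finite cover by chart discs
are locally constant, hence take countably many values. -/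
theorem countable_periodLattice [CompactSpace X] :
    (periodLattice X : Set (Module.Dual ℂ (HolomorphicOneForm X))).Countable := by
  have : SecondCountableTopology X := ChartedSpace.secondCountable_of_sigmaCompact ℂ X
  choose S hS hxS P hP using exists_isPrimitiveOn (X := X)
  obtain ⟨t, ht⟩ := isCompact_univ.elim_nhds_subcover S fun x _ => (hS x).mem_nhds (hxS x)
  have hcov : ∀ x, ∃ j ∈ t, x ∈ S j := fun x => by simpa using ht.2 (mem_univ x)
  choose κ hκt hκ using hcov
  let jump : X → X → X → HolomorphicOneForm X → ℂ := fun i j x η => P i η x - P j η x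
  have hjump : ∀ i j, (jump i j '' (S i ∩ S j)).Countable := by
    intro i j
    have hloc : ∀ x ∈ S i ∩ S j, {y | jump i j y = jump i j x} ∈ 𝓝[S i ∩ S j] x := by
      intro x hx
      refine mem_nhdsWithin_of_mem_nhds ?_
      filter_upwards [eventually_sub_eq_of_isPrimitiveOn ((hS i).inter (hS j)) hx] with y hy
      funext η
      exact hy η _ _ (fun x hx z hz hzS => hP i η x hx.1 z hz hzS.1)
        (fun x hx z hz hzS => hP j η x hx.2 z hz hzS.2)
    obtain ⟨c, -, hc, hsub⟩ := TopologicalSpace.countable_cover_nhdsWithin hloc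
    refine (hc.image (jump i j)).mono ?_
    rintro _ ⟨y, hy, rfl⟩
    obtain ⟨x, hx, hxy⟩ := mem_iUnion₂.1 (hsub hy)
    exact ⟨x, hx, hxy.symm⟩
  obtain ⟨Λ, hΛs, hΛ⟩ := exists_countable_addSubgroup
    (t.countable_toSet.biUnion fun i _ => t.countable_toSet.biUnion fun j _ => hjump i j)
  have hpath : ∀ γ : C1Path X,
      (fun η => pathIntegral η γ - (P (κ (γ.1 1)) η (γ.1 1) - P (κ (γ.1 0)) η (γ.1 0))) ∈ Λ := by
    intro γ
    refine pathIntegral_sub_mem γ Λ (fun y η => P (κ y) η y) fun s _ =>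
      ⟨S (κ (γ.1 s)), hS _, hκ _, P (κ (γ.1 s)), hP _, fun y hy => ?_⟩
    have : jump (κ y) (κ (γ.1 s)) y ∈ Λ := hΛs
      (mem_iUnion₂.2 ⟨κ y, hκt y, mem_iUnion₂.2 ⟨κ (γ.1 s), hκt _, y, ⟨hκ y, hy⟩, rfl⟩⟩)
    convert! this using 1
    funext η
    simp [jump]
  -- the values of the primitives at the end points cancel in the integral over a cycle
  let val : (X →₀ ℤ) →+ (HolomorphicOneForm X → ℂ) :=
    Finsupp.liftAddHom fun x => (zmultiplesHom (HolomorphicOneForm X → ℂ)) fun η => P (κ x) η x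
  have hchain : ∀ c : C1Path X →₀ ℤ,
      (fun η => chainIntegral η c) - val (chainBoundary X c) ∈ Λ := by
    intro c
    induction c using Finsupp.induction_linear with
    | zero =>
      convert! Λ.zero_mem using 1
      funext η
      simp
    | add c d hc hd =>
      convert! Λ.add_mem hc hd using 1
      funext η
      simp only [map_add, Pi.sub_apply, Pi.add_apply]
      ring
    | single γ n =>
      convert! Λ.zsmul_mem (hpath γ) n using 1
      funext η
      simp only [chainIntegral_single, chainBoundary_single, map_sub, Pi.sub_apply, val,
        Finsupp.liftAddHom_apply_single, zmultiplesHom_apply, Pi.smul_apply]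
      simp only [zsmul_eq_mul]
      ring
  have himg : ((fun l : Module.Dual ℂ (HolomorphicOneForm X) => (l : HolomorphicOneForm X → ℂ)) ''
      (periodLattice X : Set (Module.Dual ℂ (HolomorphicOneForm X)))).Countable := by
    refine hΛ.mono ?_
    rintro _ ⟨l, ⟨c, hc, hl⟩, rfl⟩
    have := hchain c
    rw [hc, map_zero, sub_zero] at this
    convert! this using 1
    funext η
    exact hl η
  exact countable_of_injective_of_countable_image (DFunLike.coe_injective.injOn) himg

/-- A Riemann surface is a real manifold. -/
theorem isManifold_real (X : Type*) [TopologicalSpace X] [ChartedSpace ℂ X]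
    [IsManifold 𝓘(ℂ) ω X] : IsManifold 𝓘(ℝ, ℂ) 1 X := by
  refine isManifold_of_contDiffOn 𝓘(ℝ, ℂ) 1 X fun e e' he he' => ?_
  simp only [mfld_simps]
  have ho : IsOpen (e.target ∩ e.symm ⁻¹' e'.source) :=
    e.continuousOn_symm.isOpen_inter_preimage e.open_target e'.open_source
  have hd : DifferentiableOn ℂ (e' ∘ e.symm) (e.target ∩ e.symm ⁻¹' e'.source) := by
    intro z hz
    have h1 : MDifferentiableAt 𝓘(ℂ) 𝓘(ℂ) e.symm z := mdifferentiableAt_atlas_symm he hz.1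
    have h2 : MDifferentiableAt 𝓘(ℂ) 𝓘(ℂ) e' (e.symm z) := mdifferentiableAt_atlas he' hz.2
    exact (mdifferentiableAt_iff_differentiableAt.1 (h2.comp z h1)).differentiableWithinAt
  exact (hd.contDiffOn ho).restrict_scalars ℝ

/-- All points near `x` are end points of paths which start at `x` and do not leave a given
neighbourhood: take segments in the chart. -/
theorem eventually_exists_path {S : Set X} (hS : IsOpen S) {x : X} (hx : x ∈ S) :
    ∀ᶠ y in 𝓝 x, ∃ γ : C1Path X, γ.1 0 = x ∧ γ.1 1 = y ∧ ∀ t ∈ Icc (0 : ℝ) 1, γ.1 t ∈ S := by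
  have := isManifold_real X
  have hl := (chartAt ℂ x).left_inv (mem_chart_source ℂ x)
  have ho : IsOpen ((chartAt ℂ x).target ∩ (chartAt ℂ x).symm ⁻¹' S) :=
    (chartAt ℂ x).continuousOn_symm.isOpen_inter_preimage (chartAt ℂ x).open_target hS
  obtain ⟨ε, hε, hb⟩ := Metric.isOpen_iff.1 ho (chartAt ℂ x x)
    ⟨mem_chart_target ℂ x, by rwa [mem_preimage, hl]⟩
  filter_upwards [(chartAt ℂ x).open_source.mem_nhds (mem_chart_source ℂ x),
    ((chartAt ℂ x).continuousAt (mem_chart_source ℂ x)).preimage_mem_nhds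
      (Metric.ball_mem_nhds _ hε)] with y hys hyb
  have hseg : ∀ t ∈ Icc (0 : ℝ) 1, AffineMap.lineMap (chartAt ℂ x x) (chartAt ℂ x y) t ∈
      (chartAt ℂ x).target ∩ (chartAt ℂ x).symm ⁻¹' S := fun t ht =>
    hb ((convex_ball _ _).lineMap_mem (Metric.mem_ball_self hε) hyb ht)
  have hc : ContMDiffOn 𝓘(ℝ) 𝓘(ℝ, ℂ) 1
      (fun t : ℝ => (chartAt ℂ x).symm (AffineMap.lineMap (chartAt ℂ x x) (chartAt ℂ x y) t))
      (Icc 0 1) := by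
    refine (contMDiffOn_chart_symm (I := 𝓘(ℝ, ℂ)) (n := 1) (x := x)).comp
      (t := (chartAt ℂ x).target)
      (f := fun t : ℝ => (AffineMap.lineMap (chartAt ℂ x x) (chartAt ℂ x y) t : ℂ))
      ?_ fun t ht => (hseg t ht).1
    refine ContMDiff.contMDiffOn (contMDiff_iff_contDiff.2 ?_)
    simp only [AffineMap.lineMap_apply_module]
    fun_prop
  refine ⟨⟨_, hc⟩, ?_, ?_, fun t ht => (hseg t ht).2⟩
  · simp [hl]
  · simp [(chartAt ℂ x).left_inv hys]

theorem exists_chain_boundary [ConnectedSpace X] (x y : X) :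
    ∃ c : C1Path X →₀ ℤ, chainBoundary X c = Finsupp.single y 1 - Finsupp.single x 1 := by
  refine isPreconnected_univ.induction₂ (fun x y => ∃ c : C1Path X →₀ ℤ,
    chainBoundary X c = Finsupp.single y 1 - Finsupp.single x 1) ?_ ?_ ?_ (mem_univ x) (mem_univ y)
  · intro x _
    rw [nhdsWithin_univ]
    filter_upwards [eventually_exists_path isOpen_univ (mem_univ x)] with y ⟨γ, h0, h1, _⟩
    exact ⟨Finsupp.single γ 1, by rw [chainBoundary_single, h0, h1]⟩
  · rintro x y z _ _ _ ⟨c, hc⟩ ⟨d, hd⟩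
    exact ⟨c + d, by rw [map_add, hc, hd]; abel⟩
  · rintro x y _ _ ⟨c, hc⟩
    exact ⟨-c, by rw [map_neg, hc]; abel⟩

/-- A form with a single-valued real part of its primitives vanishes. -/
theorem eq_zero_of_re_primitive [CompactSpace X] [ConnectedSpace X] (η : HolomorphicOneForm X)
    (u : X → ℝ) (h : ∀ x, ∃ S, IsOpen S ∧ x ∈ S ∧ ∃ P : X → ℂ, IsPrimitiveOn η P S ∧
      ∀ᶠ y in 𝓝 x, u y - u x = (P y - P x).re) : η = 0 := by
  -- near `x`, the function `exp u` is the norm of the holomorphic function `exp P`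
  have hexp : ∀ x, ∃ F : ℂ → ℂ, (∀ᶠ z in 𝓝 (chartAt ℂ x x), HasDerivAt F (chartCoeff η x z) z) ∧
      (∀ᶠ z in 𝓝 (chartAt ℂ x x), u ((chartAt ℂ x).symm z) - u x
        = (F z - F (chartAt ℂ x x)).re) := by
    intro x
    obtain ⟨S, hS, hxS, P, hP, hu⟩ := h x
    have hl := (chartAt ℂ x).left_inv (mem_chart_source ℂ x)
    have hc : ContinuousAt (chartAt ℂ x).symm (chartAt ℂ x x) :=
      (chartAt ℂ x).continuousAt_symm (mem_chart_target ℂ x)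
    refine ⟨fun w => P ((chartAt ℂ x).symm w), ?_, ?_⟩
    · filter_upwards [(chartAt ℂ x).open_target.mem_nhds (mem_chart_target ℂ x),
        hc.preimage_mem_nhds (hS.mem_nhds (by rwa [hl]))] with z hz hzS
      exact hP x hxS z hz hzS
    · have := hc.eventually (p := fun y => u y - u x = (P y - P x).re) (by rwa [hl])
      simpa only [hl] using this
  have hcont : Continuous u := by
    refine continuous_iff_continuousAt.2 fun x => ?_
    obtain ⟨F, hF, huF⟩ := hexp x
    have h1 : ContinuousAt (chartAt ℂ x) x := (chartAt ℂ x).continuousAt (mem_chart_source ℂ x)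
    have h2 : ContinuousAt (fun y => u x + (F (chartAt ℂ x y) - F (chartAt ℂ x x)).re) x := by
      refine continuousAt_const.add (Complex.continuous_re.continuousAt.comp
        (ContinuousAt.sub ?_ continuousAt_const))
      exact ContinuousAt.comp (f := chartAt ℂ x) hF.self_of_nhds.continuousAt h1
    refine h2.congr ?_
    filter_upwards [h1.eventually huF,
      (chartAt ℂ x).open_source.mem_nhds (mem_chart_source ℂ x)] with y hy hys
    rw [(chartAt ℂ x).left_inv hys] at hy
    linarith
  have hconst : ∀ x, (∀ᶠ y in 𝓝 x, u y ≤ u x) → ∃ F : ℂ → ℂ,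
      (∀ᶠ z in 𝓝 (chartAt ℂ x x), HasDerivAt F (chartCoeff η x z) z) ∧
      (∀ᶠ z in 𝓝 (chartAt ℂ x x), u ((chartAt ℂ x).symm z) - u x
        = (F z - F (chartAt ℂ x x)).re) ∧
      ∀ᶠ z in 𝓝 (chartAt ℂ x x), Complex.exp (F z) = Complex.exp (F (chartAt ℂ x x)) := by
    intro x hx
    obtain ⟨F, hF, huF⟩ := hexp x
    refine ⟨F, hF, huF, Complex.eventually_eq_of_isLocalMax_norm
      (f := fun z => Complex.exp (F z)) ?_ ?_⟩
    · filter_upwards [hF] with z hz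
      exact hz.differentiableAt.cexp
    · have hc : Tendsto (chartAt ℂ x).symm (𝓝 (chartAt ℂ x x)) (𝓝 x) := by
        have := (chartAt ℂ x).continuousAt_symm (mem_chart_target ℂ x)
        rwa [ContinuousAt, (chartAt ℂ x).left_inv (mem_chart_source ℂ x)] at this
      filter_upwards [huF, hc.eventually hx] with z h1 h2
      simp only [Function.comp, Complex.norm_exp]
      rw [Complex.sub_re] at h1
      exact Real.exp_le_exp.2 (by linarith)
  obtain ⟨x₁, -, hmax⟩ := isCompact_univ.exists_isMaxOn univ_nonempty hcont.continuousOn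
  have hle : ∀ y, u y ≤ u x₁ := fun y => hmax (mem_univ y)
  have huniv : {x | u x = u x₁} = univ := by
    refine IsClopen.eq_univ ⟨isClosed_eq hcont continuous_const, ?_⟩ ⟨x₁, rfl⟩
    refine isOpen_iff_mem_nhds.2 fun x hx => ?_
    have hx : u x = u x₁ := hx
    obtain ⟨F, -, h2, h3⟩ := hconst x (Eventually.of_forall fun y => by rw [hx]; exact hle y)
    have h1 : ContinuousAt (chartAt ℂ x) x := (chartAt ℂ x).continuousAt (mem_chart_source ℂ x)
    filter_upwards [h1.eventually h2, h1.eventually h3,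
      (chartAt ℂ x).open_source.mem_nhds (mem_chart_source ℂ x)] with y h2 h3 hys
    rw [(chartAt ℂ x).left_inv hys, Complex.sub_re] at h2
    have := congrArg norm h3
    rw [Complex.norm_exp, Complex.norm_exp, Real.exp_eq_exp] at this
    change u y = u x₁
    linarith
  refine HolomorphicOneForm.eq_zero_of_chartCoeff fun x => ?_
  have hx : u x = u x₁ := (Set.ext_iff.1 huniv x).2 (mem_univ x)
  obtain ⟨F, h1, -, h3⟩ := hconst x (Eventually.of_forall fun y => by rw [hx]; exact hle y)
  have h4 : HasDerivAt (fun z => Complex.exp (F z)) 0 (chartAt ℂ x x) :=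
    (hasDerivAt_const _ _).congr_of_eventuallyEq h3
  have h5 := h1.self_of_nhds.cexp.unique h4
  exact (mul_eq_zero.1 h5).resolve_left (Complex.exp_ne_zero _)

/-- A form all of whose periods are purely imaginary vanishes. -/
theorem eq_zero_of_re_period [CompactSpace X] [ConnectedSpace X] (η : HolomorphicOneForm X)
    (h : ∀ c : C1Path X →₀ ℤ, chainBoundary X c = 0 → (chainIntegral η c).re = 0) : η = 0 := by
  obtain ⟨x₀⟩ : Nonempty X := inferInstance
  choose c hc using exists_chain_boundary x₀
  refine eq_zero_of_re_primitive η (fun x => (chainIntegral η (c x)).re) fun x => ?_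
  obtain ⟨S, hS, hxS, P, hP⟩ := exists_isPrimitiveOn x
  refine ⟨S, hS, hxS, P η, hP η, ?_⟩
  filter_upwards [eventually_exists_path hS hxS] with y ⟨γ, h0, h1, hγ⟩
  have := h (c x + Finsupp.single γ 1 - c y) (by
    rw [map_sub, map_add, hc, hc, chainBoundary_single, h0, h1]; abel)
  rw [map_sub, map_add, chainIntegral_single, pathIntegral_eq_sub γ hS hγ hP, h0, h1] at this
  simp only [Int.cast_one, one_mul, Complex.sub_re, Complex.add_re] at this ⊢
  linarith

section Action

theorem contMDiff_smul_real {X : Type*} [TopologicalSpace X] [ChartedSpace ℂ X] {G : Type*}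
    [CommGroup G] [MulAction G X] [HolomorphicAction G X] (g : G) :
    ContMDiff 𝓘(ℝ, ℂ) 𝓘(ℝ, ℂ) 1 (fun x : X => g • x) := by
  intro x
  have h := contMDiffAt_iff.1 (HolomorphicAction.contMDiff_smul (X := X) g x)
  refine contMDiffAt_iff.2 ⟨h.1, ?_⟩
  exact (h.2.restrict_scalars ℝ).of_le (by simp)

theorem mfderiv_smul_real {X : Type*} [TopologicalSpace X] [ChartedSpace ℂ X] {G : Type*}
    [CommGroup G] [MulAction G X] [HolomorphicAction G X] (g : G) (x : X) (v : ℂ) :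
    (mfderiv 𝓘(ℝ, ℂ) 𝓘(ℝ, ℂ) (fun x : X => g • x) x v : ℂ)
      = mfderiv 𝓘(ℂ) 𝓘(ℂ) (fun x : X => g • x) x v := by
  have h1 : MDifferentiableAt 𝓘(ℂ) 𝓘(ℂ) (fun x : X => g • x) x :=
    (HolomorphicAction.contMDiff_smul g).mdifferentiable (by simp) x
  have h2 : MDifferentiableAt 𝓘(ℝ, ℂ) 𝓘(ℝ, ℂ) (fun x : X => g • x) x :=
    (contMDiff_smul_real g).mdifferentiable one_ne_zero x
  let A : ℂ →L[ℂ] ℂ := mfderiv 𝓘(ℂ) 𝓘(ℂ) (fun x : X => g • x) x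
  let B : ℂ →L[ℝ] ℂ := mfderiv 𝓘(ℝ, ℂ) 𝓘(ℝ, ℂ) (fun x : X => g • x) x
  have hA : HasFDerivWithinAt (𝕜 := ℂ) (E := ℂ) (F := ℂ)
      (chartAt ℂ (g • x) ∘ (fun x : X => g • x) ∘ (chartAt ℂ x).symm) A
      (range (𝓘(ℂ) : ℂ → ℂ)) (chartAt ℂ x x) := h1.hasMFDerivAt.2
  have hB : HasFDerivWithinAt (𝕜 := ℝ) (E := ℂ) (F := ℂ)
      (chartAt ℂ (g • x) ∘ (fun x : X => g • x) ∘ (chartAt ℂ x).symm) B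
      (range (𝓘(ℝ, ℂ) : ℂ → ℂ)) (chartAt ℂ x x) := h2.hasMFDerivAt.2
  rw [modelWithCornersSelf_coe, range_id, hasFDerivWithinAt_univ] at hA hB
  exact DFunLike.congr_fun (hB.unique (hA.restrictScalars ℝ)) v

variable {G : Type*} [CommGroup G] [MulAction G X] [HolomorphicAction G X]

/-- The image of a path under an element of the group. -/
def C1Path.smul (g : G) (γ : C1Path X) : C1Path X :=
  ⟨fun t => g • γ.1 t, (contMDiff_smul_real g).comp_contMDiffOn γ.2⟩

theorem pathIntegral_smul (g : G) (γ : C1Path X) (η : HolomorphicOneForm X) :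
    pathIntegral η (γ.smul g) = pathIntegral (formPullback g η) γ := by
  refine intervalIntegral.integral_congr_ae ?_
  have hne : ∀ᵐ s : ℝ, s ≠ 1 := compl_mem_ae_iff.2 (measure_singleton 1)
  filter_upwards [hne] with t ht1 ht
  rw [uIoc_of_le zero_le_one] at ht
  have h1 := γ.mdifferentiableAt (t := t) ⟨ht.1, lt_of_le_of_ne ht.2 ht1⟩
  have h2 : MDifferentiableAt 𝓘(ℝ, ℂ) 𝓘(ℝ, ℂ) (fun x : X => g • x) (γ.1 t) :=
    (contMDiff_smul_real g).mdifferentiable one_ne_zero _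
  have h3 := DFunLike.congr_fun (mfderiv_comp t h2 h1) (1 : ℝ)
  have h4 := mfderiv_smul_real g (γ.1 t) (mfderiv 𝓘(ℝ) 𝓘(ℝ, ℂ) γ.1 t (1 : ℝ) : ℂ)
  exact congrArg (η (g • γ.1 t) : ℂ → ℂ) (h3.trans h4)

theorem exists_chain_smul (g : G) (c : C1Path X →₀ ℤ) (hc : chainBoundary X c = 0) :
    ∃ d : C1Path X →₀ ℤ, chainBoundary X d = 0 ∧
      ∀ η, chainIntegral η d = chainIntegral (formPullback g η) c := by
  refine ⟨Finsupp.mapDomain (C1Path.smul g) c, ?_, fun η => ?_⟩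
  · have : ∀ c : C1Path X →₀ ℤ, chainBoundary X (Finsupp.mapDomain (C1Path.smul g) c)
        = Finsupp.mapDomain (fun x : X => g • x) (chainBoundary X c) := by
      intro c
      induction c using Finsupp.induction_linear with
      | zero => simp
      | add c d hc hd => simp only [Finsupp.mapDomain_add, map_add, hc, hd]
      | single γ n =>
        rw [Finsupp.mapDomain_single, chainBoundary_single, chainBoundary_single]
        rw [sub_eq_add_neg, sub_eq_add_neg, Finsupp.mapDomain_add, ← Finsupp.single_neg,
          ← Finsupp.single_neg, Finsupp.mapDomain_single, Finsupp.mapDomain_single]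
        rfl
    rw [this, hc, Finsupp.mapDomain_zero]
  · clear hc
    induction c using Finsupp.induction_linear with
    | zero => simp
    | add c d hc hd => simp only [Finsupp.mapDomain_add, map_add, hc, hd]
    | single γ n =>
      rw [Finsupp.mapDomain_single, chainIntegral_single, chainIntegral_single, pathIntegral_smul]

theorem dualMap_mem_periodLattice (g : G) {l : Module.Dual ℂ (HolomorphicOneForm X)}
    (hl : l ∈ periodLattice X) : (formPullback g).dualMap l ∈ periodLattice X := by
  obtain ⟨c, hc, hlc⟩ := hl
  obtain ⟨d, hd, hdc⟩ := exists_chain_smul g c hc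
  exact ⟨d, hd, fun η => by rw [LinearMap.dualMap_apply, hlc, hdc]⟩

/-- The sum of the translates under `H` of a form in `H⁰(X, ω_X)₋` is zero. -/
theorem sum_formPullback_eq_zero (H : Subgroup G) [Fintype H] {η : HolomorphicOneForm X}
    (hη : η ∈ formsMinus X H) : ∑ h : H, formPullback (h : G) η = 0 := by
  have : formsMinus X H ≤ LinearMap.ker (∑ h : H, formPullback (X := X) (h : G)) := by
    refine iSup₂_le fun χ hχ η hη => ?_
    rw [LinearMap.mem_ker, LinearMap.sum_apply, Finset.sum_congr rfl fun h _ => hη h,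
      ← Finset.sum_smul]
    have h0 : ∑ h : H, (χ h : ℂ) = 0 := by
      refine sum_hom_units_eq_zero ((Units.coeHom ℂ).comp χ) fun h => hχ ?_
      ext h'
      exact DFunLike.congr_fun h h'
    rw [h0]
    exact zero_smul ℂ η
  simpa using this hη

theorem sum_formPullback_of_mem_formsPlus (H : Subgroup G) [Fintype H] (η : HolomorphicOneForm X)
    (hη : η ∈ formsPlus X H) : ∑ h : H, formPullback (h : G) η = (Fintype.card H : ℂ) • η := by
  rw [Finset.sum_congr rfl fun h _ => hη h]
  simp only [MonoidHom.one_apply, Units.val_one, Finset.sum_const, Finset.card_univ]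
  rw [← Nat.cast_smul_eq_nsmul ℂ, one_smul]

variable [CompactSpace X]

theorem countable_prymLattice (H : Subgroup G) :
    (prymLattice X H : Set (Module.Dual ℂ (formsMinus X H))).Countable := by
  refine (Countable.mono ?_ countable_periodLattice).image _
  exact inter_subset_left

/-- The lattice of the Prym variety spans: for a period `l`, the class `|H| l - ∑ h l` lies in
`H₁(X, ℤ)₋` and is `|H| l` on `H⁰(X, ω_X)₋`, so a form in `H⁰(X, ω_X)₋` whose pairing with
`H₁(X, ℤ)₋` is purely imaginary has purely imaginary periods. -/
theorem span_prymLattice [Finite G] [ConnectedSpace X] (H : Subgroup G) :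
    Submodule.span ℝ (prymLattice X H : Set (Module.Dual ℂ (formsMinus X H))) = ⊤ := by
  classical
  have := Fintype.ofFinite H
  by_contra hne
  obtain ⟨φ, hφ0, hφ⟩ := Submodule.exists_le_ker_of_lt_top _ (lt_top_iff_ne_top.2 hne)
  -- a real functional on the dual space is the real part of the evaluation at a form
  obtain ⟨η, hη⟩ : ∃ η : formsMinus X H, ∀ l : Module.Dual ℂ (formsMinus X H),
      (l η).re = φ l := by
    refine ⟨(Module.evalEquiv ℂ (formsMinus X H)).symm (Module.Dual.extendRCLike φ), fun l => ?_⟩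
    rw [Module.apply_evalEquiv_symm_apply]
    exact Module.Dual.re_extendRCLike_apply (𝕜 := ℂ) φ l
  have hη0 : (η : HolomorphicOneForm X) = 0 := by
    refine eq_zero_of_re_period _ fun c hc => ?_
    let l := chainFunctional c
    have hl : l ∈ periodLattice X := ⟨c, hc, fun _ => rfl⟩
    let l' := (Fintype.card H) • l - ∑ h : H, (formPullback (X := X) (h : G)).dualMap l
    have hl'a : ∀ θ, l' θ = (Fintype.card H : ℂ) * l θ - l (∑ h : H, formPullback (h : G) θ) := by
      intro θ
      simp [l', map_sum]
    have hl' : l' ∈ periodLattice X := sub_mem (nsmul_mem hl _)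
      (sum_mem fun h _ => dualMap_mem_periodLattice (h : G) hl)
    have hl'p : l' ∈ (formsPlus X H).dualAnnihilator := by
      refine (Submodule.mem_dualAnnihilator _).2 fun θ hθ => ?_
      rw [hl'a, sum_formPullback_of_mem_formsPlus H θ hθ, map_smul, smul_eq_mul, sub_self]
    have hm : (formsMinus X H).dualRestrict l' ∈ prymLattice X H := ⟨l', ⟨hl', hl'p⟩, rfl⟩
    have h0 : φ ((formsMinus X H).dualRestrict l') = 0 :=
      LinearMap.mem_ker.1 (hφ (Submodule.subset_span hm))
    rw [← hη, Submodule.dualRestrict_apply, hl'a, sum_formPullback_eq_zero H η.2, map_zero,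
      sub_zero] at h0
    have h1 : ((Fintype.card H : ℝ) : ℂ) * l η = (Fintype.card H : ℂ) * l η := by simp
    rw [← h1, Complex.re_ofReal_mul] at h0
    exact (mul_eq_zero.1 h0).resolve_left (by exact_mod_cast Fintype.card_ne_zero)
  refine hφ0 (LinearMap.ext fun l => ?_)
  have h1 : η = 0 := Subtype.ext hη0
  rw [← hη, h1, map_zero]
  rfl

end Action

end PeriodLattice

/-! ### Tangent vectors of the PEL locus and the upper bound for the dimension -/

section SiegelGeometry

variable {U : Type*} [AddCommGroup U] [Module ℝ U] {G : Type*}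

/-- The tangent space of the PEL locus at the complex structure `J`: the `J`-antilinear
endomorphisms in the Lie algebra of the symplectic group which commute with the action of `G`. -/
def pelTangent (B : U →ₗ[ℝ] U →ₗ[ℝ] ℝ) (ρ : G → Module.End ℝ U) (J : Module.End ℝ U) :
    Submodule ℝ (Module.End ℝ U) where
  carrier := {T | (∀ x, T (J x) = -J (T x)) ∧ (∀ x y, B (T x) y = -B x (T y)) ∧
    ∀ g x, T (ρ g x) = ρ g (T x)}
  add_mem' {S T} hS hT := by
    refine ⟨fun x => ?_, fun x y => ?_, fun g x => ?_⟩
    · simp only [LinearMap.add_apply, hS.1, hT.1, map_add]; abel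
    · simp only [LinearMap.add_apply, hS.2.1, hT.2.1, map_add]; abel
    · simp only [LinearMap.add_apply, hS.2.2, hT.2.2, map_add]
  zero_mem' := by simp
  smul_mem' c T hT := by
    refine ⟨fun x => ?_, fun x y => ?_, fun g x => ?_⟩
    · simp only [LinearMap.smul_apply, hT.1, map_smul, smul_neg]
    · simp only [LinearMap.smul_apply, hT.2.1, map_smul, smul_neg]
    · simp only [LinearMap.smul_apply, hT.2.2, map_smul]

variable {B : U →ₗ[ℝ] U →ₗ[ℝ] ℝ} {ρ : G → Module.End ℝ U} {J J₀ : Module.End ℝ U}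

theorem siegel_sq (hJ : J ∈ SiegelSpace fun x y => B x y) (x : U) : J (J x) = -x :=
  DFunLike.congr_fun hJ.1 x

theorem siegel_skew (hJ : J ∈ SiegelSpace fun x y => B x y) (x y : U) :
    B (J x) y = -B x (J y) := by
  have := hJ.2.1 x (J y)
  simp only [siegel_sq hJ, map_neg] at this
  linarith

theorem siegel_nondegenerate (hJ : J ∈ SiegelSpace fun x y => B x y) {y : U}
    (h : ∀ x, B x y = 0) : y = 0 := by
  by_contra hy
  have h1 := hJ.2.2 y hy
  simp only [h] at h1
  exact lt_irrefl _ h1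

theorem mem_pelLocus_iff : J ∈ pelLocus (fun x y => B x y) ρ ↔
    J ∈ SiegelSpace (fun x y => B x y) ∧ ∀ g x, J (ρ g x) = ρ g (J x) := by
  constructor
  · rintro ⟨hJ, h⟩
    refine ⟨hJ, fun g x => ?_⟩
    have h1 := (h Complex.I Complex.I_ne_zero).2.2 g
    simp only [hodgeHom, Complex.I_re, Complex.I_im, zero_smul, one_smul, zero_add] at h1
    exact DFunLike.congr_fun h1 x
  · rintro ⟨hJ, h⟩
    refine ⟨hJ, fun z hz => ⟨?_, ⟨Complex.normSq z, (Complex.normSq_pos.2 hz).ne', ?_⟩, ?_⟩⟩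
    · have hmul : ∀ w : ℂ, hodgeHom J z * hodgeHom J w = hodgeHom J (z * w) := by
        intro w
        ext x
        simp only [hodgeHom, Module.End.mul_apply, LinearMap.add_apply, LinearMap.smul_apply,
          Module.End.one_apply, map_add, map_smul, siegel_sq hJ, Complex.mul_re, Complex.mul_im]
        module
      have hone : hodgeHom J 1 = 1 := by simp [hodgeHom]
      have hcomm : ∀ w : ℂ, hodgeHom J w * hodgeHom J z = hodgeHom J z * hodgeHom J w := by
        intro w
        ext x
        simp only [hodgeHom, Module.End.mul_apply, LinearMap.add_apply, LinearMap.smul_apply,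
          Module.End.one_apply, map_add, map_smul]
        module
      refine ⟨⟨hodgeHom J z, hodgeHom J z⁻¹, ?_, ?_⟩, rfl⟩
      · rw [hmul, mul_inv_cancel₀ hz, hone]
      · rw [hcomm, hmul, mul_inv_cancel₀ hz, hone]
    · intro x y
      have h1 := siegel_skew hJ x y
      have h2 := hJ.2.1 x y
      simp only [hodgeHom, LinearMap.add_apply, LinearMap.smul_apply, Module.End.one_apply,
        map_add, map_smul, Complex.normSq_apply, smul_eq_mul] at h2 ⊢
      rw [h1, h2]
      ring
    · intro g
      ext x
      simp only [hodgeHom, Module.End.mul_apply, LinearMap.add_apply, LinearMap.smul_apply,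
        Module.End.one_apply, map_add, map_smul, h]

/-- The dimension of the tangent space is the same at all points of the PEL locus: for two points
`J` and `J₀`, the isomorphism `P = J + J₀` intertwines them, and `T ↦ P T P` maps the tangent space
at `J` to the one at `J₀`. -/
theorem finrank_pelTangent_le [FiniteDimensional ℝ U] (hJ : J ∈ pelLocus (fun x y => B x y) ρ)
    (hJ₀ : J₀ ∈ pelLocus (fun x y => B x y) ρ) :
    Module.finrank ℝ (pelTangent B ρ J) ≤ Module.finrank ℝ (pelTangent B ρ J₀) := by
  rw [mem_pelLocus_iff] at hJ hJ₀
  set P : Module.End ℝ U := J + J₀ with hP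
  have hPx : ∀ x, P x = J x + J₀ x := fun _ => rfl
  have hinj : Function.Injective P := by
    refine (injective_iff_map_eq_zero P).2 fun x hx => ?_
    by_contra hne
    have h1 := add_pos (hJ.1.2.2 x hne) (hJ₀.1.2.2 x hne)
    rw [← LinearMap.add_apply, ← map_add, ← hPx, hx, map_zero, LinearMap.zero_apply] at h1
    exact lt_irrefl _ h1
  have hsurj : Function.Surjective P := LinearMap.injective_iff_surjective.1 hinj
  have h1 : ∀ x, P (J₀ x) = J (P x) := fun x => by
    simp only [hPx, map_add, siegel_sq hJ.1, siegel_sq hJ₀.1]; abel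
  have h2 : ∀ x, J₀ (P x) = P (J x) := fun x => by
    simp only [hPx, map_add, siegel_sq hJ.1, siegel_sq hJ₀.1]; abel
  have h3 : ∀ x y, B (P x) y = -B x (P y) := fun x y => by
    simp only [hPx, map_add, LinearMap.add_apply, siegel_skew hJ.1, siegel_skew hJ₀.1]; ring
  have h4 : ∀ g x, P (ρ g x) = ρ g (P x) := fun g x => by
    simp only [hPx, map_add, hJ.2, hJ₀.2]
  let Ψ : Module.End ℝ U →ₗ[ℝ] Module.End ℝ U :=
    LinearMap.mulLeft ℝ P ∘ₗ LinearMap.mulRight ℝ P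
  have hΨ : ∀ T x, Ψ T x = P (T (P x)) := fun _ _ => rfl
  refine LinearMap.finrank_le_finrank_of_injective (f := Ψ.restrict (q := pelTangent B ρ J₀)
    (p := pelTangent B ρ J) fun T hT => ⟨fun x => ?_, fun x y => ?_, fun g x => ?_⟩) ?_
  · rw [hΨ, hΨ, h1, hT.1, map_neg, h2]
  · rw [hΨ, hΨ, h3, hT.2.1, h3, neg_neg]
  · rw [hΨ, hΨ, h4, hT.2.2, h4]
  · intro S T hST
    refine Subtype.ext (LinearMap.ext fun x => ?_)
    obtain ⟨y, rfl⟩ := hsurj x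
    exact hinj (DFunLike.congr_fun (congrArg Subtype.val hST) y)

theorem IsHolomorphicImmersion.conj {d : ℕ} {Ω Ω' : Set (Fin d → ℂ)}
    {f : (Fin d → ℂ) → Module.End ℝ U} (hf : IsHolomorphicImmersion Ω f) (h : Ω' ⊆ Ω)
    (g : U ≃ₗ[ℝ] U) : IsHolomorphicImmersion Ω' fun v => g.conj (f v) := by
  intro u hu
  obtain ⟨A, hA, hAI, hAinj⟩ := hf u (h hu)
  refine ⟨g.conj.toLinearMap ∘ₗ A, fun ℓ x => ?_, fun v => ?_, ?_⟩
  · exact hA (ℓ ∘ₗ g.toLinearMap) (g.symm x)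
  · ext x
    simp [hAI, LinearEquiv.conj_apply]
  · exact g.conj.injective.comp hAinj

theorem conj_mem_siegelSpace {g : U ≃ₗ[ℝ] U} (hg : ∀ x y, B (g x) (g y) = B x y)
    (hJ : J ∈ SiegelSpace fun x y => B x y) : g.conj J ∈ SiegelSpace fun x y => B x y := by
  refine ⟨?_, fun x y => ?_, fun x hx => ?_⟩
  · ext x
    simp [LinearEquiv.conj_apply, siegel_sq hJ]
  · have := hJ.2.1 (g.symm x) (g.symm y)
    simpa [LinearEquiv.conj_apply, hg, ← hg (g.symm x) (g.symm y)] using this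
  · have := hJ.2.2 (g.symm x) (by simpa using hx)
    simpa [LinearEquiv.conj_apply, ← hg _ (g.symm x)] using this

section UpperBound

variable [FiniteDimensional ℝ U]

/-- The derivative of a holomorphic immersion into the PEL locus takes values in `pelTangent`. That
it is antilinear is a consequence of its complex linearity and of the linear
equations which define the PEL locus. -/
theorem two_mul_le_finrank_pelTangent {d : ℕ} {Ω : Set (Fin d → ℂ)} (hΩ : IsOpen Ω)
    {f : (Fin d → ℂ) → Module.End ℝ U} (hf : IsHolomorphicImmersion Ω f)
    (hfΩ : ∀ v ∈ Ω, f v ∈ pelLocus (fun x y => B x y) ρ) {u : Fin d → ℂ} (hu : u ∈ Ω) :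
    2 * d ≤ Module.finrank ℝ (pelTangent B ρ (f u)) := by
  obtain ⟨A, hA, hAI, hAinj⟩ := hf u hu
  have hloc : ∀ v ∈ Ω, f v ∈ SiegelSpace (fun x y => B x y) ∧
      ∀ g x, f v (ρ g x) = ρ g (f v x) := fun v hv => mem_pelLocus_iff.1 (hfΩ v hv)
  have hJ := (hloc u hu).1
  have hzero : ∀ (ℓ ℓ' : Module.Dual ℝ U) (x y : U),
      (∀ v ∈ Ω, ℓ (f v x) + ℓ' (f v y) = 0) → ∀ w, ℓ (A w x) + ℓ' (A w y) = 0 := by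
    intro ℓ ℓ' x y h w
    have h1 := (hA ℓ x).add (hA ℓ' y)
    have h2 : HasFDerivAt (fun _ : Fin d → ℂ => (0 : ℝ)) (0 : (Fin d → ℂ) →L[ℝ] ℝ) u :=
      hasFDerivAt_const _ _
    have h3 := h1.unique (h2.congr_of_eventuallyEq (by
      filter_upwards [hΩ.mem_nhds hu] with v hv using h v hv))
    exact DFunLike.congr_fun h3 w
  have hskew : ∀ w x y, B (A w x) y = -B x (A w y) := by
    intro w x y
    have := hzero (B.flip y) (B x) x y (fun v hv => by
      rw [LinearMap.flip_apply, siegel_skew (hloc v hv).1]; ring) w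
    rw [LinearMap.flip_apply] at this
    linarith
  have hmem : ∀ w, A w ∈ pelTangent B ρ (f u) := by
    refine fun w => ⟨fun x => ?_, hskew w, fun g x => ?_⟩
    · refine eq_neg_of_add_eq_zero_left (siegel_nondegenerate hJ fun y => ?_)
      have h1 := hskew (Complex.I • w) y x
      rw [hAI, Module.End.mul_apply, Module.End.mul_apply, siegel_skew hJ, hskew] at h1
      rw [map_add]
      linarith
    · refine sub_eq_zero.1 ((Module.forall_dual_apply_eq_zero_iff ℝ _).1 fun ℓ => ?_)
      have := hzero ℓ (-(ℓ ∘ₗ ρ g)) (ρ g x) x (fun v hv => by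
        simp [(hloc v hv).2]) w
      simpa [sub_eq_add_neg] using this
  have := LinearMap.finrank_le_finrank_of_injective (f := A.codRestrict _ hmem)
    (fun v w h => hAinj (congrArg Subtype.val h))
  rwa [Module.finrank_pi_fintype, Finset.sum_congr rfl fun _ _ => Complex.finrank_real_complex,
    Finset.sum_const, Finset.card_univ, Fintype.card_fin, smul_eq_mul, mul_comm] at this

/-- The group of automorphisms of a countable subgroup which spans the space is countable, since an
automorphism is determined by the images of a basis. -/
theorem countable_lattice_automorphisms {L : AddSubgroup U} (hL : (L : Set U).Countable)
    (hspan : Submodule.span ℝ (L : Set U) = ⊤) :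
    Countable {g : U ≃ₗ[ℝ] U // ∀ x, g x ∈ L ↔ x ∈ L} := by
  obtain ⟨b, hbL, hb, hbi⟩ := exists_linearIndependent ℝ (L : Set U)
  have : Finite b := hbi.setFinite
  have : Countable L := hL.to_subtype
  refine Function.Injective.countable (β := b → L)
    (f := fun g x => ⟨g.1 x, (g.2 x).2 (hbL x.2)⟩) fun g h hgh => ?_
  refine Subtype.ext (LinearEquiv.toLinearMap_injective
    (LinearMap.ext_on (hb.trans hspan) fun x hx => ?_))
  exact congrArg Subtype.val (congrFun hgh ⟨x, hx⟩)

/-- No complex manifold immersed in the inverse image of the PEL subvariety has a dimension larger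
than that of the tangent space. The inverse image is a union of countably many
translates of the PEL locus, which are closed, so one of them contains an open
set of parameters by Baire's theorem. -/
theorem two_mul_le_of_immersion {L : AddSubgroup U} (hL : (L : Set U).Countable)
    (hspan : Submodule.span ℝ (L : Set U) = ⊤) (hJ₀ : J₀ ∈ pelLocus (fun x y => B x y) ρ)
    {d : ℕ} {Ω : Set (Fin d → ℂ)} (hΩ : IsOpen Ω) (hne : Ω.Nonempty)
    {f : (Fin d → ℂ) → Module.End ℝ U} (hf : IsHolomorphicImmersion Ω f)
    (hS : ∀ u ∈ Ω, ∃ h : f u ∈ SiegelSpace (fun x y => B x y),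
      Quotient.mk (siegelSetoid (fun x y => B x y) L) ⟨f u, h⟩
        ∈ pelSubvariety (fun x y => B x y) L ρ J₀) :
    2 * d ≤ Module.finrank ℝ (pelTangent B ρ J₀) := by
  have := countable_lattice_automorphisms hL hspan
  let Γ := {g : U ≃ₗ[ℝ] U // ∀ x, g x ∈ L ↔ x ∈ L}
  -- the parameters whose complex structures are carried into the PEL locus by `γ`
  let C : Γ → Set Ω := fun γ => {u | (∀ x y, B (γ.1 x) (γ.1 y) = B x y) ∧
    ∀ k x, γ.1.conj (f u) (ρ k x) = ρ k (γ.1.conj (f u) x)}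
  have hcont : ∀ (ℓ : Module.Dual ℝ U) (x : U), Continuous fun u : Ω => ℓ (f u x) := by
    refine fun ℓ x => continuous_iff_continuousAt.2 fun u => ?_
    obtain ⟨A, hA, -⟩ := hf u u.2
    exact (hA ℓ x).continuousAt.comp continuous_subtype_val.continuousAt
  have hclosed : ∀ γ, IsClosed (C γ) := by
    intro γ
    have : C γ = {u | ∀ x y, B (γ.1 x) (γ.1 y) = B x y} ∩
        ⋂ (k : G) (x : U) (ℓ : Module.Dual ℝ U), {u : Ω |
          (ℓ ∘ₗ γ.1.toLinearMap) (f u (γ.1.symm (ρ k x)))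
            = (ℓ ∘ₗ ρ k ∘ₗ γ.1.toLinearMap) (f u (γ.1.symm x))} := by
      ext u
      simp only [C, mem_ofPred_eq, mem_inter_iff, mem_iInter]
      refine and_congr_right fun _ => forall₂_congr fun k x => ?_
      constructor
      · intro h ℓ
        exact congrArg ℓ h
      · intro h
        refine sub_eq_zero.1 ((Module.forall_dual_apply_eq_zero_iff ℝ _).1 fun ℓ => ?_)
        rw [map_sub, sub_eq_zero]
        exact h ℓ
    rw [this]
    exact isClosed_const.inter (isClosed_iInter fun k => isClosed_iInter fun x =>
      isClosed_iInter fun ℓ => isClosed_eq (hcont _ _) (hcont _ _))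
  have hcov : ⋃ γ, C γ = univ := by
    refine eq_univ_of_forall fun u => ?_
    obtain ⟨hu, J, hJ, hq⟩ := hS u u.2
    obtain ⟨g, hg, hgL, hgJ⟩ := Quotient.exact hq
    refine mem_iUnion.2 ⟨⟨g, hgL⟩, hg, fun k x => ?_⟩
    have h1 : g.conj (f u) = J := by
      ext y
      have := hgJ (g.symm y)
      simpa [LinearEquiv.conj_apply] using this
    rw [h1]
    exact (mem_pelLocus_iff.1 hJ.1).2 k x
  have : LocallyCompactSpace Ω := hΩ.locallyCompactSpace
  have : Nonempty Ω := hne.to_subtype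
  obtain ⟨γ, u, hu⟩ := nonempty_interior_of_iUnion_of_closed hclosed hcov
  have hg := (interior_subset hu).1
  set W : Set (Fin d → ℂ) := Subtype.val '' interior (C γ) with hW
  have hWo : IsOpen W := hΩ.isOpenMap_subtype_val _ isOpen_interior
  have hWΩ : W ⊆ Ω := by
    rintro _ ⟨v, -, rfl⟩
    exact v.2
  have hWloc : ∀ v ∈ W, γ.1.conj (f v) ∈ pelLocus (fun x y => B x y) ρ := by
    rintro _ ⟨v, hv, rfl⟩
    obtain ⟨hs, -⟩ := hS v v.2
    exact mem_pelLocus_iff.2 ⟨conj_mem_siegelSpace hg hs, (interior_subset hv).2⟩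
  have huW : (u : Fin d → ℂ) ∈ W := ⟨u, hu, rfl⟩
  exact (two_mul_le_finrank_pelTangent hWo (hf.conj hWΩ γ.1) hWloc huW).trans
    (finrank_pelTangent_le (hWloc _ huW) hJ₀)

end UpperBound
end SiegelGeometry

/-! ### The Cayley transform parametrizes the PEL locus -/

section CayleyTransform

/-- A positive definite symmetric form on a finite-dimensional real space is the
standard one in suitable coordinates. -/
theorem exists_equiv_euclideanSpace {U : Type*} [AddCommGroup U] [Module ℝ U]
    [FiniteDimensional ℝ U] (b : U →ₗ[ℝ] U →ₗ[ℝ] ℝ) (hs : ∀ x y, b x y = b y x)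
    (hp : ∀ x, x ≠ 0 → 0 < b x x) :
    ∃ (n : ℕ) (e : U ≃ₗ[ℝ] EuclideanSpace ℝ (Fin n)), ∀ x, ‖e x‖ ^ 2 = b x x := by
  let core : InnerProductSpace.Core ℝ U :=
    { inner := fun x y => b x y
      conj_inner_symm := fun x y => hs y x
      re_inner_nonneg := fun x => by
        rcases eq_or_ne x 0 with rfl | hx
        · simp
        · exact (hp x hx).le
      add_left := fun x y z => by simp
      smul_left := fun x y r => by simp
      definite := fun x hx => by
        by_contra hne
        exact (hp x hne).ne' hx }
  let _ : NormedAddCommGroup U := core.toNormedAddCommGroup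
  let _ : InnerProductSpace ℝ U := InnerProductSpace.ofCore core.toCore
  refine ⟨Module.finrank ℝ U, (stdOrthonormalBasis ℝ U).repr.toLinearEquiv, fun x => ?_⟩
  have h1 : ‖(stdOrthonormalBasis ℝ U).repr x‖ = ‖x‖ := LinearIsometryEquiv.norm_map _ _
  have h2 : inner ℝ x x = ‖x‖ ^ 2 := real_inner_self_eq_norm_sq x
  change ‖(stdOrthonormalBasis ℝ U).repr x‖ ^ 2 = _
  rw [h1, ← h2]
  rfl

/-- The derivative of `v ↦ (1 + τ v) j (1 + τ v)⁻¹` in a Banach algebra. -/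
theorem hasFDerivAt_conj_one_add {V 𝔸 : Type*} [NormedAddCommGroup V] [NormedSpace ℝ V]
    [NormedRing 𝔸] [NormedAlgebra ℝ 𝔸] [CompleteSpace 𝔸] (τ : V →L[ℝ] 𝔸) (j : 𝔸) {v : V}
    (hv : IsUnit (1 + τ v)) :
    ∃ D : V →L[ℝ] 𝔸, HasFDerivAt (fun w => (1 + τ w) * j * Ring.inverse (1 + τ w)) D v ∧
      ∀ w, D w = (τ w * j - (1 + τ v) * j * Ring.inverse (1 + τ v) * τ w)
        * Ring.inverse (1 + τ v) := by
  obtain ⟨x, hx⟩ := hv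
  have h1 : HasFDerivAt (fun w => 1 + τ w) τ v := τ.hasFDerivAt.const_add 1
  have h2 : HasFDerivAt Ring.inverse (-ContinuousLinearMap.mulLeftRight ℝ 𝔸 ↑x⁻¹ ↑x⁻¹)
      (1 + τ v) := by
    rw [← hx]; exact hasFDerivAt_ringInverse x
  have h3 := (h1.mul_const' j).mul' (h2.comp v h1)
  refine ⟨_, h3, fun w => ?_⟩
  simp [← hx, sub_mul, mul_assoc, neg_add_eq_sub]

variable {U : Type*} [AddCommGroup U] [Module ℝ U] {G : Type*}
variable {B : U →ₗ[ℝ] U →ₗ[ℝ] ℝ} {ρ : G → Module.End ℝ U} {J₀ : Module.End ℝ U}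

/-- For `T` in the tangent space at `J₀` which is a strict contraction, `(1 + T) J₀ (1 + T)⁻¹` is a
point of the PEL locus. -/
theorem cayley_mem_pelLocus (hJ₀ : J₀ ∈ pelLocus (fun x y => B x y) ρ) {T R : Module.End ℝ U}
    (hT : T ∈ pelTangent B ρ J₀) (hlt : ∀ x, x ≠ 0 → B (J₀ (T x)) (T x) < B (J₀ x) x)
    (hR : (1 + T) * R = 1) (hR' : R * (1 + T) = 1) :
    (1 + T) * J₀ * R ∈ pelLocus (fun x y => B x y) ρ := by
  rw [mem_pelLocus_iff] at hJ₀
  have hsurj : ∀ x, ∃ a, x = a + T a ∧ R x = a := fun x => ⟨R x, by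
    have := DFunLike.congr_fun hR x
    simpa using this.symm, rfl⟩
  have hRa : ∀ a, R (a + T a) = a := fun a => DFunLike.congr_fun hR' a
  have hJ : ∀ a, ((1 + T) * J₀ * R) (a + T a) = J₀ a + T (J₀ a) := fun a => by
    rw [Module.End.mul_apply, hRa]; rfl
  have hB : ∀ a b, B (a + T a) (b + T b) = B a b + B (T a) (T b) := fun a b => by
    simp only [map_add, LinearMap.add_apply, hT.2.1 a b]; ring
  refine mem_pelLocus_iff.2 ⟨⟨?_, fun x y => ?_, fun x hx => ?_⟩, fun g x => ?_⟩
  · ext x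
    obtain ⟨a, rfl, -⟩ := hsurj x
    rw [Module.End.mul_apply, hJ, hJ, siegel_sq hJ₀.1]
    simp; abel
  · obtain ⟨a, rfl, -⟩ := hsurj x
    obtain ⟨b, rfl, -⟩ := hsurj y
    have h1 := hJ₀.1.2.1 a b
    have h2 := hJ₀.1.2.1 (T a) (T b)
    simp only at h1 h2 ⊢
    rw [hJ, hJ, hB, hB, hT.1, hT.1, map_neg, map_neg, LinearMap.neg_apply, neg_neg, h1, h2]
  · obtain ⟨a, rfl, -⟩ := hsurj x
    have ha : a ≠ 0 := by
      rintro rfl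
      simp at hx
    simp only
    rw [hJ, hB, hT.1, map_neg, LinearMap.neg_apply]
    linarith [hlt a ha]
  · obtain ⟨a, rfl, -⟩ := hsurj x
    have h1 : ρ g (a + T a) = ρ g a + T (ρ g a) := by rw [map_add, hT.2.2]
    rw [h1, hJ, hJ, hJ₀.2, hT.2.2, map_add]

variable [FiniteDimensional ℝ U]

/-- The Cayley transform `v ↦ (1 + T v) J₀ (1 + T v)⁻¹` of a complex linear parametrization `T` of
a subspace of the tangent space at `J₀` is a holomorphic immersion of a
neighbourhood of `0` into the component of `J₀` of the PEL locus. -/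
theorem exists_immersion_pelComponent (hB : ∀ x y, B x y = -B y x)
    (hJ₀ : J₀ ∈ pelLocus (fun x y => B x y) ρ) {m : ℕ}
    (T : (Fin m → ℂ) →ₗ[ℝ] Module.End ℝ U) (hT : ∀ v, T v ∈ pelTangent B ρ J₀)
    (hTI : ∀ v, T (Complex.I • v) = J₀ * T v) (hinj : Function.Injective T) :
    ∃ (Ω : Set (Fin m → ℂ)) (f : (Fin m → ℂ) → Module.End ℝ U), IsOpen Ω ∧ Ω.Nonempty ∧
      IsHolomorphicImmersion Ω f ∧
      ∀ u ∈ Ω, f u ∈ pelComponent (fun x y => B x y) ρ J₀ := by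
  have hJ := (mem_pelLocus_iff.1 hJ₀).1
  have hsq : J₀ * J₀ = -1 := hJ.1
  have hanti : ∀ v, T v * J₀ = -(J₀ * T v) := fun v => LinearMap.ext fun x => (hT v).1 x
  obtain ⟨n, e, he⟩ := exists_equiv_euclideanSpace (B ∘ₗ J₀)
    (fun x y => by
      rw [LinearMap.comp_apply, LinearMap.comp_apply, siegel_skew hJ, hB, neg_neg])
    (fun x hx => hJ.2.2 x hx)
  -- endomorphisms of `U` as elements of a Banach algebra
  let Φ : Module.End ℝ U ≃ₐ[ℝ]
      (EuclideanSpace ℝ (Fin n) →L[ℝ] EuclideanSpace ℝ (Fin n)) :=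
    (LinearEquiv.conjAlgEquiv ℝ e).trans (Module.End.toContinuousLinearMap _)
  have hΦ : ∀ S x, Φ S (e x) = e (S x) := fun S x => by
    change e (S (e.symm (e x))) = e (S x)
    rw [e.symm_apply_apply]
  let τ : (Fin m → ℂ) →L[ℝ] (EuclideanSpace ℝ (Fin n) →L[ℝ] EuclideanSpace ℝ (Fin n)) :=
    LinearMap.toContinuousLinearMap (Φ.toLinearMap ∘ₗ T)
  have hτ : ∀ v, τ v = Φ (T v) := fun _ => rfl
  have hunit : ∀ v, ‖τ v‖ < 1 → IsUnit (1 + τ v) := fun v hv => by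
    have := isUnit_one_sub_of_norm_lt_one (x := -τ v) (by rwa [norm_neg])
    rwa [sub_neg_eq_add] at this
  let R : (Fin m → ℂ) → Module.End ℝ U := fun v => Φ.symm (Ring.inverse (1 + τ v))
  have hΦ1 : ∀ v, Φ (1 + T v) = 1 + τ v := fun v => by rw [map_add, map_one, hτ]
  have hR : ∀ v, ‖τ v‖ < 1 → (1 + T v) * R v = 1 := fun v hv => by
    apply Φ.injective
    rw [map_mul, hΦ1, Φ.apply_symm_apply, Ring.mul_inverse_cancel _ (hunit v hv), map_one]
  have hR' : ∀ v, ‖τ v‖ < 1 → R v * (1 + T v) = 1 := fun v hv => by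
    apply Φ.injective
    rw [map_mul, hΦ1, Φ.apply_symm_apply, Ring.inverse_mul_cancel _ (hunit v hv), map_one]
  set Ω : Set (Fin m → ℂ) := {v | ‖τ v‖ < 1} with hΩ
  let f : (Fin m → ℂ) → Module.End ℝ U := fun v => (1 + T v) * J₀ * R v
  have hΩo : IsOpen Ω := isOpen_lt τ.continuous.norm continuous_const
  have h0 : (0 : Fin m → ℂ) ∈ Ω := by simp [hΩ]
  have hΩc : Convex ℝ Ω := by
    have : Ω = τ.toLinearMap ⁻¹' Metric.ball 0 1 := by
      ext v
      simp [hΩ]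
    rw [this]
    exact (convex_ball _ _).linear_preimage _
  have hderiv : ∀ u ∈ Ω, ∀ (ℓ : Module.Dual ℝ U) (x : U), HasFDerivAt (fun v => ℓ (f v x))
      (LinearMap.toContinuousLinearMap (ℓ ∘ₗ (LinearMap.applyₗ x) ∘ₗ
        (LinearMap.mulRight ℝ (R u) ∘ₗ (LinearMap.mulRight ℝ J₀ - LinearMap.mulLeft ℝ (f u))
          ∘ₗ T))) u := by
    intro u hu ℓ x
    obtain ⟨D, hD, hDw⟩ := hasFDerivAt_conj_one_add τ (Φ J₀) (hunit u hu)
    let c : (EuclideanSpace ℝ (Fin n) →L[ℝ] EuclideanSpace ℝ (Fin n)) →L[ℝ] ℝ :=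
      LinearMap.toContinuousLinearMap (ℓ ∘ₗ LinearMap.applyₗ x ∘ₗ Φ.symm.toLinearMap)
    have hc : ∀ S, c S = ℓ (Φ.symm S x) := fun _ => rfl
    have h1 := c.hasFDerivAt.comp u hD
    have hf : ∀ v, f v = Φ.symm ((1 + τ v) * Φ J₀ * Ring.inverse (1 + τ v)) := fun v => by
      simp [f, R, ← hΦ1]
    have h2 : (fun v => ℓ (f v x))
        = c ∘ fun w => (1 + τ w) * Φ J₀ * Ring.inverse (1 + τ w) := by
      funext v
      rw [Function.comp, hc, hf]
    rw [h2]
    refine h1.congr_fderiv ?_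
    ext w
    change ℓ (Φ.symm (D w) x) = ℓ (((T w * J₀ - f u * T w) * R u) x)
    rw [hDw]
    congr 2
    simp [f, R, hτ]
  have hloc : ∀ v ∈ Ω, f v ∈ pelLocus (fun x y => B x y) ρ := by
    intro v hv
    refine cayley_mem_pelLocus hJ₀ (hT v) (fun x hx => ?_) (hR v hv) (hR' v hv)
    have h1 := he x
    have h2 := he (T v x)
    rw [LinearMap.comp_apply] at h1 h2
    rw [← h1, ← h2, ← hΦ, ← hτ]
    have hpos : 0 < ‖e x‖ := norm_pos_iff.2 (by simpa using hx)
    have hlt : ‖τ v (e x)‖ < ‖e x‖ :=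
      ((τ v).le_opNorm _).trans_lt (mul_lt_of_lt_one_left hpos hv)
    exact pow_lt_pow_left₀ hlt (norm_nonneg _) two_ne_zero
  refine ⟨Ω, f, hΩo, ⟨0, h0⟩, fun u hu => ⟨_, hderiv u hu, fun v => ?_, ?_⟩,
    fun u hu => ⟨hloc u hu, ?_⟩⟩
  · -- complex linearity
    have hfsq : f u * f u = -1 := (mem_pelLocus_iff.1 (hloc u hu)).1.1
    change (T (Complex.I • v) * J₀ - f u * T (Complex.I • v)) * R u
      = f u * ((T v * J₀ - f u * T v) * R u)
    have h1 : J₀ * T v * J₀ = T v := by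
      rw [mul_assoc, hanti, mul_neg, ← mul_assoc, hsq]; simp
    have h2 : J₀ * T v = -(T v * J₀) := by rw [hanti, neg_neg]
    have h3 : f u * (f u * T v) = - T v := by rw [← mul_assoc, hfsq]; simp
    rw [hTI, h1, h2, ← mul_assoc (f u) (T v * J₀ - f u * T v), mul_sub, h3, mul_neg, sub_neg_eq_add,
      sub_neg_eq_add, add_comm]
  · -- injectivity
    refine (injective_iff_map_eq_zero _).2 fun w hw => ?_
    change (T w * J₀ - f u * T w) * R u = 0 at hw
    have h1 : T w * J₀ = f u * T w := by
      have := congrArg (· * (1 + T u)) hw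
      simp only [mul_assoc, hR' u hu, zero_mul, mul_one] at this
      exact sub_eq_zero.1 this
    set Q := R u * T w with hQ
    have h2 : T w = (1 + T u) * Q := by rw [hQ, ← mul_assoc, hR u hu, one_mul]
    have h3 : Q * J₀ = J₀ * Q := by
      have : R u * (T w * J₀) = R u * (f u * T w) := by rw [h1]
      calc Q * J₀ = R u * (T w * J₀) := by rw [hQ, mul_assoc]
        _ = R u * (f u * T w) := by rw [h1]
        _ = (R u * (1 + T u)) * J₀ * (R u * T w) := by simp only [f, mul_assoc]
        _ = J₀ * Q := by rw [hR' u hu, one_mul]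
    have h4 : (1 + T u) * Q * J₀ = -(J₀ * ((1 + T u) * Q)) := by rw [← h2, hanti]
    have h5 : T u * (J₀ * Q) = -(J₀ * (T u * Q)) := by
      rw [← mul_assoc, hanti, neg_mul, mul_assoc]
    have h6 : (2 : ℝ) • (J₀ * Q) = 0 := by
      simp only [add_mul, one_mul, mul_add, mul_assoc, h5, h3] at h4
      have h7 : J₀ * Q = -(J₀ * Q) := by
        have := congrArg (· + J₀ * (T u * Q)) h4
        simpa using this
      rw [two_smul]
      nth_rewrite 1 [h7]
      simp
    have h7 : J₀ * Q = 0 := by simpa using h6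
    have h8 : Q = 0 := by
      have : J₀ * (J₀ * Q) = 0 := by rw [h7, mul_zero]
      rw [← mul_assoc, hsq] at this
      simpa using this
    exact (injective_iff_map_eq_zero T).1 hinj w (by rw [h2, h8, mul_zero])
  · -- connectedness
    have hcont : ContinuousOn (fun v => endCoord (f v)) Ω :=
      continuousOn_pi.2 fun q v hv => (hderiv v hv q.1 q.2).continuousAt.continuousWithinAt
    have hpre : IsPreconnected ((fun v => endCoord (f v)) '' Ω) :=
      hΩc.isPreconnected.image _ hcont
    have hf0 : f 0 = J₀ := by simp [f, R]
    refine hpre.subset_connectedComponentIn ⟨0, h0, congrArg endCoord hf0⟩ ?_ ⟨u, hu, rfl⟩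
    rintro _ ⟨v, hv, rfl⟩
    exact ⟨f v, hloc v hv, rfl⟩

/-- The dimension of the PEL subvariety is the complex dimension of its tangent space at the base
point. -/
theorem hasComplexDim_pelSubvariety (hB : ∀ x y, B x y = -B y x) {L : AddSubgroup U}
    (hL : (L : Set U).Countable) (hspan : Submodule.span ℝ (L : Set U) = ⊤)
    (hJ₀ : J₀ ∈ pelLocus (fun x y => B x y) ρ) {m : ℕ}
    (T : (Fin m → ℂ) →ₗ[ℝ] Module.End ℝ U) (hT : LinearMap.range T = pelTangent B ρ J₀)
    (hTI : ∀ v, T (Complex.I • v) = J₀ * T v) (hinj : Function.Injective T) :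
    HasComplexDim (pelSubvariety (fun x y => B x y) L ρ J₀) m := by
  constructor
  · obtain ⟨Ω, f, hΩ, hne, hf, hmem⟩ := exists_immersion_pelComponent hB hJ₀ T
      (fun v => hT ▸ LinearMap.mem_range_self T v) hTI hinj
    exact ⟨Ω, f, hΩ, hne, hf, fun u hu => ⟨(hmem u hu).1.1, f u, hmem u hu, rfl⟩⟩
  · rintro d ⟨Ω, f, hΩ, hne, hf, hS⟩
    have h1 := two_mul_le_of_immersion hL hspan hJ₀ hΩ hne hf hS
    rw [← hT, LinearMap.finrank_range_of_inj hinj, Module.finrank_pi_fintype,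
      Finset.sum_congr rfl fun _ _ => Complex.finrank_real_complex, Finset.sum_const,
      Finset.card_univ, Fintype.card_fin, smul_eq_mul] at h1
    omega

end CayleyTransform

/-! ### The symmetric square of a representation of a finite commutative group -/

section SymmetricSquare

variable {V : Type*} [AddCommGroup V] [Module ℂ V]

/-- The symmetric bilinear form on `V^*` with values `l ↦ l(v) w + l(w) v` in `V`, as a multilinear
function of the pair `(v, w)`. -/
def polarMultilinear (V : Type*) [AddCommGroup V] [Module ℂ V] :
    MultilinearMap ℂ (fun _ : Fin 2 => V) (Module.Dual ℂ V →ₗ[ℂ] V) :=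
  MultilinearMap.mk' (fun v => (Module.Dual.eval ℂ V (v 0)).smulRight (v 1) +
      (Module.Dual.eval ℂ V (v 1)).smulRight (v 0))
    (by
      intro v i x y
      ext l
      fin_cases i <;> simp [add_smul] <;> abel)
    (by
      intro v i c x
      ext l
      fin_cases i <;> simp [mul_smul, smul_comm c])

@[simp]
theorem polarMultilinear_apply (v : Fin 2 → V) (l : Module.Dual ℂ V) :
    polarMultilinear V v l = l (v 0) • v 1 + l (v 1) • v 0 := rfl

theorem polarMultilinear_perm (e : Equiv.Perm (Fin 2)) (v : Fin 2 → V) :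
    polarMultilinear V (fun i => v (e i)) = polarMultilinear V v := by
  ext l
  rcases eq_or_ne (e 0) 0 with h | h
  · have h1 : e 1 = 1 := by
      have : e 1 ≠ e 0 := e.injective.ne (by decide)
      omega
    simp [h, h1]
  · have h0 : e 0 = 1 := by omega
    have h1 : e 1 = 0 := by
      have : e 1 ≠ e 0 := e.injective.ne (by decide)
      omega
    simp [h0, h1, add_comm]

variable (V) in
/-- The linear map from the symmetric square of `V` to the linear maps `V^* → V` that sends `v w` to
`l ↦ l(v) w + l(w) v`. -/
def symSquarePolar : Sym[ℂ]^2 V →ₗ[ℂ] (Module.Dual ℂ V →ₗ[ℂ] V) where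
  toFun := AddCon.lift _ (PiTensorProduct.lift (polarMultilinear V)).toAddMonoidHom <| by
    refine AddCon.addConGen_le.2 ?_
    rintro _ _ ⟨e, v⟩
    refine (AddCon.ker_rel _).2 ?_
    change PiTensorProduct.lift (polarMultilinear V) (PiTensorProduct.tprod ℂ fun i => v i)
      = PiTensorProduct.lift (polarMultilinear V) (PiTensorProduct.tprod ℂ fun i => v (e i))
    rw [PiTensorProduct.lift.tprod, PiTensorProduct.lift.tprod]
    exact (polarMultilinear_perm e v).symm
  map_add' s t := map_add _ s t
  map_smul' c t := by
    induction t using AddCon.induction_on with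
    | H t =>
      change PiTensorProduct.lift (polarMultilinear V) (c • t)
        = c • PiTensorProduct.lift (polarMultilinear V) t
      rw [map_smul]

theorem symSquarePolar_tprod (v : Fin 2 → V) :
    symSquarePolar V (SymmetricPower.tprod ℂ v) = polarMultilinear V v :=
  PiTensorProduct.lift.tprod (φ := polarMultilinear V) v

theorem symSquareMap_tprod (f : V →ₗ[ℂ] V) (v : Fin 2 → V) :
    symSquareMap f (SymmetricPower.tprod ℂ v) = SymmetricPower.tprod ℂ fun i => f (v i) := by
  change SymmetricPower.mk ℂ (Fin 2) V
    (PiTensorProduct.map (fun _ => f) (PiTensorProduct.tprod ℂ v)) = _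
  rw [PiTensorProduct.map_tprod]
  rfl

/-- Linear maps on a symmetric square are determined by their values on products. -/
theorem symSquare_hom_ext {W : Type*} [AddCommGroup W] [Module ℂ W] {f g : Sym[ℂ]^2 V →ₗ[ℂ] W}
    (h : ∀ v : Fin 2 → V, f (SymmetricPower.tprod ℂ v) = g (SymmetricPower.tprod ℂ v)) : f = g :=
  LinearMap.ext_on (SymmetricPower.span_tprod_eq_top ℂ (Fin 2) V) (by rintro _ ⟨v, rfl⟩; exact h v)

theorem symSquarePolar_symm (t : Sym[ℂ]^2 V) (l m : Module.Dual ℂ V) :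
    m (symSquarePolar V t l) = l (symSquarePolar V t m) := by
  have : m ∘ₗ (LinearMap.applyₗ l) ∘ₗ symSquarePolar V
      = l ∘ₗ (LinearMap.applyₗ m) ∘ₗ symSquarePolar V := by
    refine symSquare_hom_ext fun v => ?_
    simp only [LinearMap.comp_apply, LinearMap.applyₗ_apply_apply, symSquarePolar_tprod,
      polarMultilinear_apply, map_add, map_smul, smul_eq_mul]
    ring
  exact LinearMap.congr_fun this t

theorem symSquarePolar_map (f : V →ₗ[ℂ] V) (t : Sym[ℂ]^2 V) :
    symSquarePolar V (symSquareMap f t) = f ∘ₗ symSquarePolar V t ∘ₗ f.dualMap := by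
  let F : Sym[ℂ]^2 V →ₗ[ℂ] Sym[ℂ]^2 V :=
    { toFun := symSquareMap f
      map_add' := map_add _
      map_smul' := symSquareMap_smul f }
  ext l
  have : (LinearMap.applyₗ l) ∘ₗ symSquarePolar V ∘ₗ F
      = f ∘ₗ (LinearMap.applyₗ (f.dualMap l)) ∘ₗ symSquarePolar V := by
    refine symSquare_hom_ext fun v => ?_
    have h1 : F (SymmetricPower.tprod ℂ v) = SymmetricPower.tprod ℂ fun i => f (v i) :=
      symSquareMap_tprod f v
    simp only [LinearMap.comp_apply, LinearMap.applyₗ_apply_apply, h1, symSquarePolar_tprod,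
      polarMultilinear_apply, map_add, map_smul, LinearMap.dualMap_apply]
  exact LinearMap.congr_fun this t

variable (V) in
/-- The product `V × V → S² V`. -/
def symSquareMul : V →ₗ[ℂ] V →ₗ[ℂ] Sym[ℂ]^2 V :=
  have h0 : ∀ x y z : V, Function.update ![x, y] 0 z = ![z, y] := fun x y z => by
    ext i
    fin_cases i <;> simp
  have h1 : ∀ x y z : V, Function.update ![x, y] 1 z = ![x, z] := fun x y z => by
    ext i
    fin_cases i <;> simp
  LinearMap.mk₂ ℂ (fun v w => SymmetricPower.tprod ℂ ![v, w])
    (fun x y z => by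
      simpa only [h0] using (SymmetricPower.tprod ℂ).map_update_add ![0, z] (0 : Fin 2) x y)
    (fun c x z => by
      simpa only [h0] using (SymmetricPower.tprod ℂ).map_update_smul ![0, z] (0 : Fin 2) c x)
    (fun z x y => by
      simpa only [h1] using (SymmetricPower.tprod ℂ).map_update_add ![z, 0] (1 : Fin 2) x y)
    (fun c z x => by
      simpa only [h1] using (SymmetricPower.tprod ℂ).map_update_smul ![z, 0] (1 : Fin 2) c x)

theorem symSquareMul_apply (v w : V) :
    symSquareMul V v w = SymmetricPower.tprod ℂ ![v, w] := rfl

theorem symSquareMul_comm (v w : V) : symSquareMul V v w = symSquareMul V w v := by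
  rw [symSquareMul_apply, ← SymmetricPower.tprod_equiv (Equiv.swap (0 : Fin 2) 1) ![v, w]]
  refine congrArg (SymmetricPower.tprod ℂ) (funext fun i => ?_)
  fin_cases i <;> simp

theorem tprod_eq_symSquareMul (v : Fin 2 → V) :
    SymmetricPower.tprod ℂ v = symSquareMul V (v 0) (v 1) := by
  refine congrArg (SymmetricPower.tprod ℂ) (funext fun i => ?_)
  fin_cases i <;> rfl

/-- The sum `½ ∑ eᵢ · S(eᵢ^*)` over a basis of `V` and its dual basis; on symmetric maps this is
the inverse of `symSquarePolar`. -/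
def symSquareOfDual [FiniteDimensional ℂ V] :
    (Module.Dual ℂ V →ₗ[ℂ] V) →ₗ[ℂ] Sym[ℂ]^2 V :=
  (1 / 2 : ℂ) • ∑ i, symSquareMul V (Module.finBasis ℂ V i) ∘ₗ
    LinearMap.applyₗ ((Module.finBasis ℂ V).coord i)

theorem symSquareOfDual_apply [FiniteDimensional ℂ V] (S : Module.Dual ℂ V →ₗ[ℂ] V) :
    symSquareOfDual S = (1 / 2 : ℂ) • ∑ i, symSquareMul V (Module.finBasis ℂ V i)
      (S ((Module.finBasis ℂ V).coord i)) := by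
  simp [symSquareOfDual]

theorem symSquareOfDual_polar [FiniteDimensional ℂ V] (t : Sym[ℂ]^2 V) :
    symSquareOfDual (symSquarePolar V t) = t := by
  have : symSquareOfDual ∘ₗ symSquarePolar V = LinearMap.id := by
    refine symSquare_hom_ext fun v => ?_
    have key : ∀ x y : V, ∑ i, (Module.finBasis ℂ V).coord i x •
        symSquareMul V (Module.finBasis ℂ V i) y = symSquareMul V x y := by
      intro x y
      conv_rhs => rw [← (Module.finBasis ℂ V).sum_repr x]
      rw [map_sum, LinearMap.sum_apply]
      simp only [map_smul, LinearMap.smul_apply]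
      rfl
    rw [LinearMap.comp_apply, symSquarePolar_tprod, symSquareOfDual_apply]
    simp only [polarMultilinear_apply, map_add, map_smul, Finset.sum_add_distrib, key]
    rw [symSquareMul_comm (v 1), ← two_smul ℂ, smul_smul, LinearMap.id_apply,
      tprod_eq_symSquareMul]
    norm_num
  exact LinearMap.congr_fun this t

theorem symSquarePolar_ofDual [FiniteDimensional ℂ V] {S : Module.Dual ℂ V →ₗ[ℂ] V}
    (hS : ∀ l m : Module.Dual ℂ V, m (S l) = l (S m)) :
    symSquarePolar V (symSquareOfDual S) = S := by
  ext l
  set b := Module.finBasis ℂ V with hb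
  have h2 : ∑ i, l (b i) • S (b.coord i) = S l := by
    conv_rhs => rw [← b.sum_dual_apply_smul_coord l]
    rw [map_sum]
    simp only [map_smul]
  have h3 : ∑ i, l (S (b.coord i)) • b i = S l := by
    rw [← b.sum_repr (S l)]
    refine Finset.sum_congr rfl fun i _ => ?_
    rw [← hS l (b.coord i)]
    rfl
  rw [symSquareOfDual_apply, map_smul, map_sum, LinearMap.smul_apply, LinearMap.sum_apply]
  simp only [symSquareMul_apply, symSquarePolar_tprod, polarMultilinear_apply,
    Matrix.cons_val_zero, Matrix.cons_val_one, Finset.sum_add_distrib, ← hb, h2, h3]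
  rw [← two_smul ℂ, smul_smul]
  norm_num

/-- The symmetric linear maps `S : V^* → V` with `g S g^* = S` for the operators `g = σ g`. -/
def invariantSymmMaps {G : Type*} (σ : G → V →ₗ[ℂ] V) :
    Submodule ℂ (Module.Dual ℂ V →ₗ[ℂ] V) where
  carrier := {S | (∀ l m : Module.Dual ℂ V, m (S l) = l (S m)) ∧
    ∀ g, σ g ∘ₗ S ∘ₗ (σ g).dualMap = S}
  add_mem' {S T} hS hT := by
    refine ⟨fun l m => ?_, fun g => ?_⟩
    · rw [LinearMap.add_apply, LinearMap.add_apply, map_add, map_add, hS.1, hT.1]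
    · rw [LinearMap.add_comp, LinearMap.comp_add, hS.2, hT.2]
  zero_mem' := ⟨by simp, by simp⟩
  smul_mem' c S hS := by
    refine ⟨fun l m => ?_, fun g => ?_⟩
    · rw [LinearMap.smul_apply, LinearMap.smul_apply, map_smul, map_smul, hS.1]
    · rw [LinearMap.smul_comp, LinearMap.comp_smul, hS.2]

theorem finrank_invariantSymmMaps [FiniteDimensional ℂ V] {G : Type*} (σ : G → V →ₗ[ℂ] V) :
    Module.finrank ℂ (invariantSymmMaps σ) = Module.finrank ℂ (symSquareInvariants σ) := by
  have hinj : Function.Injective (symSquarePolar V) :=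
    Function.LeftInverse.injective symSquareOfDual_polar
  have h : (symSquareInvariants σ).map (symSquarePolar V) = invariantSymmMaps σ := by
    ext S
    constructor
    · rintro ⟨t, ht, rfl⟩
      refine ⟨symSquarePolar_symm t, fun g => ?_⟩
      rw [← symSquarePolar_map, ht g]
    · rintro ⟨h1, h2⟩
      refine ⟨symSquareOfDual S, fun g => hinj ?_, symSquarePolar_ofDual h1⟩
      rw [symSquarePolar_map, symSquarePolar_ofDual h1, h2]
  rw [← h]
  exact (Submodule.equivMapOfInjective _ hinj _).finrank_eq.symm

end SymmetricSquare

section Eigenbasis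

variable {V : Type*} [AddCommGroup V] [Module ℂ V] {G : Type*} [CommGroup G]

/-- The `χ`-eigenspace of a representation of a commutative group. -/
def charEigenspace (σ : G →* Module.End ℂ V) (χ : G →* ℂˣ) : Submodule ℂ V where
  carrier := {v | ∀ g, σ g v = (χ g : ℂ) • v}
  add_mem' {v w} hv hw g := by rw [map_add, hv g, hw g, smul_add]
  zero_mem' g := by rw [map_zero, smul_zero]
  smul_mem' c v hv g := by rw [map_smul, hv g, smul_comm]

/-- A representation of a finite commutative group is the direct sum of its eigenspaces. -/
theorem isInternal_charEigenspace [FiniteDimensional ℂ V] [Finite G] [DecidableEq (G →* ℂˣ)]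
    (σ : G →* Module.End ℂ V) : DirectSum.IsInternal (charEigenspace σ) := by
  have hcomm : ∀ g h, Commute (σ g) (σ h) := fun g h => (Commute.all g h).map σ
  -- the operators are diagonalizable, as roots of the separable polynomial `X ^ n - 1`
  have hmax : ∀ g (μ : ℂ), (σ g).maxGenEigenspace μ = (σ g).eigenspace μ := fun g μ => by
    have hn : ((Nat.card G : ℕ) : ℂ) ≠ 0 := Nat.cast_ne_zero.2 Nat.card_pos.ne'
    have hp : Polynomial.aeval (σ g) (Polynomial.X ^ Nat.card G - 1 : Polynomial ℂ) = 0 := by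
      rw [map_sub, map_pow, Polynomial.aeval_X, map_one, ← map_pow, pow_card_eq_one', map_one,
        sub_self]
    exact (Module.End.isSemisimple_of_squarefree_aeval_eq_zero
      (Polynomial.X_pow_sub_one_separable_iff.2 hn).squarefree
        hp).isFinitelySemisimple.maxGenEigenspace_eq_eigenspace μ
  have hle : ∀ χ : G →* ℂˣ, charEigenspace σ χ
      = ⨅ g, (σ g).maxGenEigenspace ((χ g : ℂˣ) : ℂ) := by
    intro χ
    ext v
    simp only [Submodule.mem_iInf, hmax, Module.End.mem_eigenspace_iff]
    rfl
  refine DirectSum.isInternal_submodule_of_iSupIndep_of_iSup_eq_top ?_ ?_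
  · have h1 := Module.End.independent_iInf_maxGenEigenspace_of_forall_mapsTo (fun g => σ g)
      fun g h φ => Module.End.mapsTo_maxGenEigenspace_of_comm (hcomm h g) φ
    have h2 : Function.Injective fun (χ : G →* ℂˣ) (g : G) => ((χ g : ℂˣ) : ℂ) := by
      intro χ χ' h
      ext g
      exact congrFun h g
    have h3 := h1.comp h2
    rwa [show charEigenspace σ = _ from funext hle]
  · have htop :=
      Module.End.iSup_iInf_maxGenEigenspace_eq_top_of_iSup_maxGenEigenspace_eq_top_of_commute
        (fun g => σ g) (fun g h _ => hcomm g h) fun g => Module.End.iSup_maxGenEigenspace_eq_top _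
    rw [eq_top_iff, ← htop]
    refine iSup_le fun μ v hv => ?_
    simp only [Submodule.mem_iInf, hmax, Module.End.mem_eigenspace_iff] at hv
    rcases eq_or_ne v 0 with rfl | hne
    · exact zero_mem _
    -- the eigenvalues of a nonzero joint eigenvector form a character
    · let χ : G →* ℂ :=
        { toFun := μ
          map_one' := by
            have := hv 1
            rw [map_one, Module.End.one_apply] at this
            exact smul_left_injective ℂ hne (by simpa using this.symm)
          map_mul' := fun g h => by
            have := hv (g * h)
            rw [map_mul, Module.End.mul_apply, hv h, map_smul, hv g, smul_smul] at this
            exact smul_left_injective ℂ hne (by simpa [mul_comm] using this.symm) }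
      exact Submodule.mem_iSup_of_mem χ.toHomUnits fun g => hv g

open Classical in
/-- Coefficients `aᵢⱼ` of symmetric invariant maps: they are symmetric, and `aᵢⱼ = 0` unless
the characters of the eigenvectors `bᵢ` and `bⱼ` are inverse to each other. -/
theorem finrank_invariantSymmMaps_eq_card {ι : Type*} [Fintype ι] [LinearOrder ι]
    (σ : G →* Module.End ℂ V) (b : Module.Basis ι ℂ V) (κ : ι → G →* ℂˣ)
    (hb : ∀ i, b i ∈ charEigenspace σ (κ i)) :
    Module.finrank ℂ (invariantSymmMaps σ)
      = Fintype.card {p : ι × ι // p.1 ≤ p.2 ∧ κ p.1 * κ p.2 = 1} := by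
  let F : invariantSymmMaps σ →ₗ[ℂ] ({p : ι × ι // p.1 ≤ p.2 ∧ κ p.1 * κ p.2 = 1} → ℂ) :=
    { toFun := fun S p => b.coord p.1.1 (S.1 (b.coord p.1.2))
      map_add' := fun S T => by
        ext p
        simp
      map_smul' := fun c S => by
        ext p
        simp }
  have hdual : ∀ g j, (σ g).dualMap (b.coord j) = ((κ j g : ℂˣ) : ℂ) • b.coord j := by
    intro g j
    refine b.ext fun k => ?_
    rw [LinearMap.dualMap_apply, hb k g, map_smul, LinearMap.smul_apply, b.coord_apply,
      b.repr_self]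
    rcases eq_or_ne k j with rfl | h
    · rfl
    · simp [Finsupp.single_eq_of_ne h.symm]
  have hcoord : ∀ g i v, b.coord i (σ g v) = ((κ i g : ℂˣ) : ℂ) * b.coord i v := fun g i v =>
    LinearMap.congr_fun (hdual g i) v
  have hinj : Function.Injective F := by
    refine (injective_iff_map_eq_zero F).2 fun S hS => ?_
    have h1 : ∀ i j, i ≤ j → b.coord i (S.1 (b.coord j)) = 0 := by
      intro i j hij
      by_cases hκ : κ i * κ j = 1
      · exact congrFun hS ⟨(i, j), hij, hκ⟩
      · obtain ⟨g, hg⟩ : ∃ g, (κ i * κ j) g ≠ 1 := by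
          by_contra! h
          exact hκ (MonoidHom.ext h)
        have h2 := congrArg (b.coord i) (LinearMap.congr_fun (S.2.2 g) (b.coord j))
        rw [LinearMap.comp_apply, LinearMap.comp_apply, hdual, map_smul, map_smul, map_smul,
          hcoord, smul_eq_mul, ← mul_assoc] at h2
        by_contra hne
        refine hg (Units.ext ?_)
        have h3 := mul_right_cancel₀ hne (h2.trans (one_mul _).symm)
        rw [MonoidHom.mul_apply, Units.val_mul, mul_comm, h3, Units.val_one]
    have h2 : ∀ i j, b.coord i (S.1 (b.coord j)) = 0 := by
      intro i j
      rcases le_total i j with h | h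
      · exact h1 i j h
      · rw [S.2.1, h1 j i h]
    ext1
    refine (Module.Basis.ext b.dualBasis fun j => b.ext_elem fun i => ?_)
    have := h2 i j
    simpa using this
  have hsurj : Function.Surjective F := by
    intro a
    let A : ι → ι → ℂ := fun i j =>
      if h : min i j ≤ max i j ∧ κ (min i j) * κ (max i j) = 1 then a ⟨(min i j, max i j), h⟩ else 0
    have hsymm : ∀ i j, A i j = A j i := fun i j => by
      simp only [A, min_comm i j, max_comm i j]
    have hinv : ∀ g i j, A i j * (((κ i g : ℂˣ) : ℂ) * ((κ j g : ℂˣ) : ℂ)) = A i j := by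
      intro g i j
      by_cases h : κ i * κ j = 1
      · rw [← Units.val_mul, ← MonoidHom.mul_apply, h]
        simp
      · have : ¬ (min i j ≤ max i j ∧ κ (min i j) * κ (max i j) = 1) := by
          rintro ⟨-, h'⟩
          rcases le_total i j with hij | hij
          · exact h (by simpa [hij] using h')
          · exact h (by simpa [hij, mul_comm (κ j)] using h')
        simp only [A, dif_neg this, zero_mul]
    let S : Module.Dual ℂ V →ₗ[ℂ] V :=
      ∑ i, ∑ j, A i j • (Module.Dual.eval ℂ V (b j)).smulRight (b i)
    have hS : ∀ l, S l = ∑ i, ∑ j, (A i j * l (b j)) • b i := fun l => by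
      simp [S, LinearMap.sum_apply, mul_smul]
    have hmem : S ∈ invariantSymmMaps σ := by
      refine ⟨fun l m => ?_, fun g => LinearMap.ext fun l => ?_⟩
      · rw [hS, hS]
        simp only [map_sum, map_smul, smul_eq_mul]
        rw [Finset.sum_comm]
        refine Finset.sum_congr rfl fun i _ => Finset.sum_congr rfl fun j _ => ?_
        rw [hsymm]
        ring
      · rw [LinearMap.comp_apply, LinearMap.comp_apply, hS, hS]
        simp only [map_sum, map_smul, LinearMap.dualMap_apply]
        refine Finset.sum_congr rfl fun i _ => Finset.sum_congr rfl fun j _ => ?_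
        rw [hb i g, hb j g, map_smul, smul_smul]
        congr 1
        conv_rhs => rw [← hinv g i j]
        rw [smul_eq_mul]
        ring
    refine ⟨⟨S, hmem⟩, funext fun p => ?_⟩
    change b.coord p.1.1 (S (b.coord p.1.2)) = a p
    have h1 : ∀ i j, b.coord i (S (b.coord j)) = A i j := by
      intro i j
      rw [hS]
      simp [Finsupp.single_apply]
    rw [h1]
    obtain ⟨⟨i, j⟩, hij, hκ⟩ := p
    have hm : min i j = i := min_eq_left hij
    have hM : max i j = j := max_eq_right hij
    simp only [A, hm, hM]
    rw [dif_pos ⟨hij, hκ⟩]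
  rw [(LinearEquiv.ofBijective F ⟨hinj, hsurj⟩).finrank_eq, Module.finrank_pi]

open Classical in
/-- Twice the number of unordered pairs of indices with inverse characters. -/
theorem two_mul_card_le_pairs {ι M : Type*} [Fintype ι] [LinearOrder ι] [CommGroup M]
    (κ : ι → M) :
    2 * Fintype.card {p : ι × ι // p.1 ≤ p.2 ∧ κ p.1 * κ p.2 = 1}
      = Fintype.card {p : ι × ι // κ p.1 * κ p.2 = 1} + Fintype.card {i : ι // κ i ^ 2 = 1} := by
  simp only [Fintype.card_subtype]
  have h1 : (Finset.univ.filter fun p : ι × ι => p.1 ≤ p.2 ∧ κ p.1 * κ p.2 = 1).card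
      = (Finset.univ.filter fun p : ι × ι => p.2 ≤ p.1 ∧ κ p.1 * κ p.2 = 1).card := by
    refine Finset.card_equiv (Equiv.prodComm ι ι) fun p => ?_
    simp [mul_comm]
  have h2 : (Finset.univ.filter fun i : ι => κ i ^ 2 = 1).card
      = ((Finset.univ.filter fun p : ι × ι => p.1 ≤ p.2 ∧ κ p.1 * κ p.2 = 1) ∩
        (Finset.univ.filter fun p : ι × ι => p.2 ≤ p.1 ∧ κ p.1 * κ p.2 = 1)).card := by
    refine Finset.card_bij (fun i _ => (i, i)) ?_ ?_ ?_
    · intro i hi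
      simpa [pow_two] using hi
    · intro i _ j _ h
      exact congrArg Prod.fst h
    · rintro ⟨i, j⟩ h
      simp only [Finset.mem_inter, Finset.mem_filter, Finset.mem_univ, true_and] at h
      obtain rfl : i = j := le_antisymm h.1.1 h.2.1
      exact ⟨i, by simpa [pow_two] using h.1.2, rfl⟩
  have h3 : (Finset.univ.filter fun p : ι × ι => κ p.1 * κ p.2 = 1)
      = (Finset.univ.filter fun p : ι × ι => p.1 ≤ p.2 ∧ κ p.1 * κ p.2 = 1) ∪
        (Finset.univ.filter fun p : ι × ι => p.2 ≤ p.1 ∧ κ p.1 * κ p.2 = 1) := by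
    ext p
    have := le_total p.1 p.2
    simp only [Finset.mem_union, Finset.mem_filter, Finset.mem_univ, true_and]
    tauto
  rw [h2, h3, Finset.card_union_add_card_inter, ← h1, two_mul]

open Classical in
/-- The number of unordered pairs of indices with inverse characters, in terms of the
multiplicities of the characters. -/
theorem two_mul_card_le_pairs_eq_finsum {ι M : Type*} [Fintype ι] [LinearOrder ι] [CommGroup M]
    [Finite M] (κ : ι → M) (d : M → ℕ) (hd : ∀ χ, d χ = Fintype.card {i // κ i = χ}) :
    2 * (Fintype.card {p : ι × ι // p.1 ≤ p.2 ∧ κ p.1 * κ p.2 = 1} : ℚ)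
      = (∑ᶠ (χ : M) (_ : χ ^ 2 ≠ 1), (d χ : ℚ) * d χ⁻¹) +
        ∑ᶠ (χ : M) (_ : χ ^ 2 = 1), (d χ : ℚ) * (d χ + 1) := by
  have := Fintype.ofFinite M
  have hd' : ∀ χ, d χ = ∑ i, if κ i = χ then 1 else 0 := fun χ => by
    rw [hd, Fintype.card_subtype, Finset.card_filter]
  have hsum : ∀ f : M → ℕ, ∑ χ, d χ * f χ = ∑ i, f (κ i) := by
    intro f
    simp only [hd', Finset.sum_mul, ite_mul, one_mul, zero_mul]
    rw [Finset.sum_comm]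
    simp
  have h3 : Fintype.card {p : ι × ι // κ p.1 * κ p.2 = 1} = ∑ χ, d χ * d χ⁻¹ := by
    rw [hsum, Fintype.card_subtype, Finset.card_filter, Fintype.sum_prod_type]
    refine Finset.sum_congr rfl fun i _ => ?_
    rw [hd']
    refine Finset.sum_congr rfl fun j _ => ?_
    simp only [mul_eq_one_iff_inv_eq, eq_comm]
  have h4 : Fintype.card {i : ι // κ i ^ 2 = 1} = ∑ χ, d χ * if χ ^ 2 = 1 then 1 else 0 := by
    rw [hsum, Fintype.card_subtype, Finset.card_filter]
  have h2 := two_mul_card_le_pairs κ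
  rw [h3, h4] at h2
  have h5 : ∀ (P : M → Prop) (f : M → ℚ),
      ∑ᶠ (χ : M) (_ : P χ), f χ = ∑ χ, if P χ then f χ else 0 := by
    intro P f
    rw [finsum_eq_sum_of_fintype]
    exact Finset.sum_congr rfl fun χ _ => finsum_eq_if
  rw [h5, h5, ← Finset.sum_add_distrib]
  have h6 := congrArg (fun n : ℕ => (n : ℚ)) h2
  push_cast at h6
  rw [h6, ← Finset.sum_add_distrib]
  refine Finset.sum_congr rfl fun χ _ => ?_
  by_cases h : χ ^ 2 = 1
  · have : χ⁻¹ = χ := inv_eq_of_mul_eq_one_left ((pow_two χ).symm.trans h)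
    simp only [h, this, ne_eq, not_true_eq_false, if_true, if_false]
    ring
  · simp [h]

/-- The dimension of `(S² V)^G` in terms of the dimensions of the eigenspaces of `G` in `V`. -/
theorem two_mul_finrank_invariantSymmMaps [FiniteDimensional ℂ V] [Finite G]
    (σ : G →* Module.End ℂ V) (d : (G →* ℂˣ) → ℕ)
    (hd : ∀ χ, d χ = Module.finrank ℂ (charEigenspace σ χ)) :
    2 * (Module.finrank ℂ (invariantSymmMaps σ) : ℚ)
      = (∑ᶠ (χ : G →* ℂˣ) (_ : χ ^ 2 ≠ 1), (d χ : ℚ) * d χ⁻¹) +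
        ∑ᶠ (χ : G →* ℂˣ) (_ : χ ^ 2 = 1), (d χ : ℚ) * (d χ + 1) := by
  classical
  have := Fintype.ofFinite (G →* ℂˣ)
  let b := (isInternal_charEigenspace σ).collectedBasis
    fun χ => Module.finBasisOfFinrankEq ℂ (charEigenspace σ χ) (hd χ).symm
  let _ : LinearOrder ((χ : G →* ℂˣ) × Fin (d χ)) :=
    LinearOrder.lift' (Fintype.equivFin _) (Fintype.equivFin _).injective
  rw [finrank_invariantSymmMaps_eq_card σ b Sigma.fst
    fun i => DirectSum.IsInternal.collectedBasis_mem _ _ i]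
  refine two_mul_card_le_pairs_eq_finsum _ d fun χ => ?_
  rw [Fintype.card_congr (Equiv.sigmaSubtype χ), Fintype.card_fin]

end Eigenbasis

/-! ### Tangent vectors of the PEL locus as invariant symmetric maps -/

section PelTangent

variable {V : Type*} [AddCommGroup V] [Module ℂ V] {G : Type*} [CommGroup G]
  {D : V →ₗ[ℝ] Module.Dual ℂ V} {B : Module.Dual ℂ V →ₗ[ℝ] Module.Dual ℂ V →ₗ[ℝ] ℝ}
  {σ : G →* Module.End ℂ V}

variable (V) in
/-- Multiplication by `i` on the dual space. -/
def dualStructure : Module.End ℝ (Module.Dual ℂ V) :=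
  (LinearMap.lsmul ℂ (Module.Dual ℂ V) Complex.I).restrictScalars ℝ

theorem dualStructure_apply (l : Module.Dual ℂ V) : dualStructure V l = Complex.I • l := rfl

/-- A linear map `S : V^* → V`, followed by a conjugate-linear map `D : V → V^*`. -/
def tangentOfDual (D : V →ₗ[ℝ] Module.Dual ℂ V) :
    (Module.Dual ℂ V →ₗ[ℂ] V) →ₗ[ℝ] Module.End ℝ (Module.Dual ℂ V) where
  toFun S := D ∘ₗ S.restrictScalars ℝ
  map_add' S S' := LinearMap.ext fun l => map_add D (S l) (S' l)
  map_smul' r S := LinearMap.ext fun l => map_smul D r (S l)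

theorem tangentOfDual_apply (S : Module.Dual ℂ V →ₗ[ℂ] V) (l : Module.Dual ℂ V) :
    tangentOfDual D S l = D (S l) := rfl

theorem tangentOfDual_mem_pelTangent (hsmul : ∀ (c : ℂ) u, D (c • u) = (starRingEnd ℂ) c • D u)
    (hB : ∀ l m, B l m = -B m l) (hBD : ∀ l u, B l (D u) = (l u).im)
    (hσ : ∀ g u, (σ g).dualMap (D u) = D (σ g⁻¹ u)) {S : Module.Dual ℂ V →ₗ[ℂ] V}
    (hS : S ∈ invariantSymmMaps σ) :
    tangentOfDual D S ∈
      pelTangent B (fun g => (σ g).dualMap.restrictScalars ℝ) (dualStructure V) := by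
  refine ⟨fun l => ?_, fun l m => ?_, fun g l => ?_⟩
  · rw [tangentOfDual_apply, tangentOfDual_apply, dualStructure_apply, dualStructure_apply,
      map_smul, hsmul, Complex.conj_I, neg_smul]
  · rw [tangentOfDual_apply, tangentOfDual_apply, hB, hBD, hBD, hS.1]
  · rw [tangentOfDual_apply, tangentOfDual_apply, LinearMap.restrictScalars_apply,
      LinearMap.restrictScalars_apply, hσ]
    congr 1
    have h1 : σ g (S ((σ g).dualMap l)) = S l := LinearMap.congr_fun (hS.2 g) l
    rw [← h1, ← Module.End.mul_apply, ← map_mul, inv_mul_cancel, map_one, Module.End.one_apply]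

/-- Every tangent vector of the PEL locus comes from an invariant symmetric map `S`: antilinearity
makes `S` complex linear, the symplectic condition makes it symmetric. -/
theorem exists_tangentOfDual (hD : Function.Bijective D)
    (hsmul : ∀ (c : ℂ) u, D (c • u) = (starRingEnd ℂ) c • D u)
    (hB : ∀ l m, B l m = -B m l) (hBD : ∀ l u, B l (D u) = (l u).im)
    (hσ : ∀ g u, (σ g).dualMap (D u) = D (σ g⁻¹ u)) {T : Module.End ℝ (Module.Dual ℂ V)}
    (hT : T ∈ pelTangent B (fun g => (σ g).dualMap.restrictScalars ℝ) (dualStructure V)) :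
    ∃ S ∈ invariantSymmMaps σ, tangentOfDual D S = T := by
  obtain ⟨h1, h2, h3⟩ := hT
  let r := (LinearEquiv.ofBijective D hD).symm
  have hr : ∀ l, D (r l) = l := (LinearEquiv.ofBijective D hD).apply_symm_apply
  have hI : ∀ l, T (Complex.I • l) = -(Complex.I • T l) := h1
  let S : Module.Dual ℂ V →ₗ[ℂ] V :=
    { toFun := fun l => r (T l)
      map_add' := fun l m => by rw [map_add, map_add]
      map_smul' := fun c l => by
        apply hD.1
        rw [hr, RingHom.id_apply, hsmul, hr]
        have hc : c • l = c.re • l + c.im • Complex.I • l := by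
          conv_lhs => rw [← Complex.re_add_im c, add_smul, mul_smul]
          rfl
        have hc' : (starRingEnd ℂ) c • T l = c.re • T l - c.im • Complex.I • T l := by
          conv_lhs => rw [← Complex.re_add_im c, map_add, map_mul, Complex.conj_ofReal,
            Complex.conj_ofReal, Complex.conj_I, mul_neg, add_smul, neg_smul, mul_smul,
            ← sub_eq_add_neg]
          rfl
        rw [hc, map_add, map_smul, map_smul, hI, hc', smul_neg, sub_eq_add_neg] }
  have hST : tangentOfDual D S = T := LinearMap.ext fun l => hr (T l)
  have him : ∀ l m : Module.Dual ℂ V, (m (S l)).im = (l (S m)).im := by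
    intro l m
    have := h2 l m
    rw [← hST, tangentOfDual_apply, tangentOfDual_apply, hB, hBD, hBD] at this
    linarith
  refine ⟨S, ⟨fun l m => Complex.ext ?_ (him l m), fun g => LinearMap.ext fun l => ?_⟩, hST⟩
  · -- the real parts are compared by replacing `l` with `i l`
    have := him (Complex.I • l) m
    rw [map_smul, map_smul] at this
    simpa using this
  · have h4 : D (S ((σ g).dualMap l)) = D (σ g⁻¹ (S l)) := by
      rw [← hσ, ← tangentOfDual_apply, ← tangentOfDual_apply, hST]
      exact h3 g l
    change σ g (S ((σ g).dualMap l)) = S l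
    rw [hD.1 h4, ← Module.End.mul_apply, ← map_mul, mul_inv_cancel, map_one, Module.End.one_apply]

/-- The tangent space of the PEL locus at the complex structure `i` of `V^*` is isomorphic to the
space of invariant symmetric maps `V^* → V`. The isomorphism is conjugate-linear, so that a linear
parametrization of the tangent space is given by the conjugates of coordinates of these maps. -/
theorem exists_pelTangent_parametrization [FiniteDimensional ℂ V] (hD : Function.Bijective D)
    (hsmul : ∀ (c : ℂ) u, D (c • u) = (starRingEnd ℂ) c • D u)
    (hB : ∀ l m, B l m = -B m l) (hBD : ∀ l u, B l (D u) = (l u).im)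
    (hσ : ∀ g u, (σ g).dualMap (D u) = D (σ g⁻¹ u)) :
    ∃ T : (Fin (Module.finrank ℂ (invariantSymmMaps σ)) → ℂ) →ₗ[ℝ]
        Module.End ℝ (Module.Dual ℂ V),
      LinearMap.range T
        = pelTangent B (fun g => (σ g).dualMap.restrictScalars ℝ) (dualStructure V) ∧
      (∀ v, T (Complex.I • v) = dualStructure V * T v) ∧ Function.Injective T := by
  let c := Module.finBasis ℂ (invariantSymmMaps σ)
  let e := (LinearEquiv.piCongrRight fun _ => Complex.conjAe.toLinearEquiv) ≪≫ₗ
    c.equivFun.symm.restrictScalars ℝ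
  have he : ∀ v, e (Complex.I • v) = (-Complex.I) • e v := by
    intro v
    change c.equivFun.symm _ = _ • c.equivFun.symm _
    rw [← map_smul]
    congr 1
    ext i
    simp
  let T := tangentOfDual D ∘ₗ (invariantSymmMaps σ).subtype.restrictScalars ℝ ∘ₗ e.toLinearMap
  have hT : ∀ v, T v = tangentOfDual D (e v).1 := fun v => rfl
  refine ⟨T, ?_, fun v => ?_, fun v w h => ?_⟩
  · ext S
    constructor
    · rintro ⟨v, rfl⟩
      exact tangentOfDual_mem_pelTangent hsmul hB hBD hσ (e v).2
    · intro hS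
      obtain ⟨S', hS', rfl⟩ := exists_tangentOfDual hD hsmul hB hBD hσ hS
      exact ⟨e.symm ⟨S', hS'⟩, by rw [hT, e.apply_symm_apply]⟩
  · refine LinearMap.ext fun l => ?_
    have h := hsmul (-Complex.I) ((e v).1 l)
    rw [map_neg, Complex.conj_I, neg_neg] at h
    rw [hT, hT, he]
    exact h
  · refine e.injective (Subtype.ext (LinearMap.ext fun l => hD.1 ?_))
    exact LinearMap.congr_fun h l

end PelTangent

/-! ### The polarization of the Prym variety -/

section PrymPolarization

variable {X : Type*} [TopologicalSpace X] [ChartedSpace ℂ X]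
  [IsManifold 𝓘(ℂ) ω X] {G : Type*} [CommGroup G] [MulAction G X] [HolomorphicAction G X]

theorem formPullback_one (η : HolomorphicOneForm X) : formPullback (1 : G) η = η := by
  refine ContMDiffSection.ext fun x => ?_
  have hc : mfderiv 𝓘(ℂ) 𝓘(ℂ) (fun y : X => (1 : G) • y) x = ContinuousLinearMap.id ℂ ℂ := by
    have : (fun y : X => (1 : G) • y) = id := funext fun y => one_smul G y
    rw [this]
    exact mfderiv_id
  change (η ((1 : G) • x)).comp (mfderiv 𝓘(ℂ) 𝓘(ℂ) (fun y : X => (1 : G) • y) x) = η x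
  rw [hc]
  have key : ∀ y y' : X, y = y' → ∀ w : ℂ, (η y : ℂ → ℂ) w = (η y' : ℂ → ℂ) w := by
    rintro y _ rfl w
    rfl
  exact ContinuousLinearMap.ext fun w => key _ _ (one_smul G x) w

/-- The representation of `G` on `H⁰(X, ω_X)₋` by pullback. -/
def minusRep (H : Subgroup G) : G →* Module.End ℂ (formsMinus X H) where
  toFun := minusPullback H
  map_one' := LinearMap.ext fun η => Subtype.ext (formPullback_one (η : HolomorphicOneForm X))
  map_mul' g h := by
    refine LinearMap.ext fun η => Subtype.ext ?_
    change formPullback (g * h) (η : HolomorphicOneForm X)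
      = formPullback g (formPullback h (η : HolomorphicOneForm X))
    rw [formPullback_mul, mul_comm]

variable [CompactSpace X]

/-- The conjugate-linear map `u ↦ ⟨·, u⟩` from `H⁰(X, ω_X)₋` to its dual, as a real linear map. -/
def hermitianDual (H : Subgroup G) : formsMinus X H →ₗ[ℝ] Module.Dual ℂ (formsMinus X H) where
  toFun u :=
    { toFun := fun η => hermitianForm (η : HolomorphicOneForm X) u
      map_add' := fun η θ => hermitianForm_add_left _ _ _
      map_smul' := fun c η => hermitianForm_smul_left _ _ _ }
  map_add' u v := LinearMap.ext fun η => hermitianForm_add_right _ _ _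
  map_smul' r u := LinearMap.ext fun η => by
    have := hermitianForm_smul_right (r : ℂ) (η : HolomorphicOneForm X) u
    rw [Complex.conj_ofReal] at this
    exact this

theorem hermitianDual_apply (H : Subgroup G) (u η : formsMinus X H) :
    hermitianDual H u η = hermitianForm (η : HolomorphicOneForm X) u := rfl

theorem hermitianDual_smul (H : Subgroup G) (c : ℂ) (u : formsMinus X H) :
    hermitianDual H (c • u) = (starRingEnd ℂ) c • hermitianDual H u :=
  LinearMap.ext fun η => hermitianForm_smul_right c (η : HolomorphicOneForm X) u

theorem bijective_hermitianDual (H : Subgroup G) :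
    Function.Bijective (hermitianDual (X := X) H) := by
  have hinj : Function.Injective (hermitianDual (X := X) H) := by
    refine (injective_iff_map_eq_zero _).2 fun u hu => Subtype.ext ?_
    exact eq_zero_of_hermitianForm_self (LinearMap.congr_fun hu u)
  have : FiniteDimensional ℝ (formsMinus X H) := FiniteDimensional.complexToReal _
  have : FiniteDimensional ℝ (Module.Dual ℂ (formsMinus X H)) :=
    FiniteDimensional.complexToReal _
  refine ⟨hinj, (LinearMap.injective_iff_surjective_of_finrank_eq_finrank ?_).1 hinj⟩
  rw [finrank_real_of_complex, finrank_real_of_complex, Subspace.dual_finrank_eq]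

theorem hermitianDual_rieszRep {H : Subgroup G} (l : Module.Dual ℂ (formsMinus X H)) :
    hermitianDual H (rieszRep l) = l := by
  obtain ⟨u, hu⟩ := (bijective_hermitianDual H).2 l
  exact LinearMap.ext (Classical.epsilon_spec
    (p := fun u : formsMinus X H => ∀ η : formsMinus X H,
      hermitianForm (η : HolomorphicOneForm X) u = l η) ⟨u, fun η => LinearMap.congr_fun hu η⟩)

theorem rieszRep_hermitianDual {H : Subgroup G} (u : formsMinus X H) :
    rieszRep (hermitianDual H u) = u :=
  (bijective_hermitianDual H).1 (hermitianDual_rieszRep _)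

theorem prymPolarization_apply (H : Subgroup G) (l m : Module.Dual ℂ (formsMinus X H)) :
    prymPolarization H l m = (l (rieszRep m)).im := by
  conv_rhs => rw [← hermitianDual_rieszRep l]
  rfl

theorem prymPolarization_hermitianDual (H : Subgroup G) (l : Module.Dual ℂ (formsMinus X H))
    (u : formsMinus X H) : prymPolarization H l (hermitianDual H u) = (l u).im := by
  rw [prymPolarization_apply, rieszRep_hermitianDual]

theorem prymPolarization_swap (H : Subgroup G) (l m : Module.Dual ℂ (formsMinus X H)) :
    prymPolarization H l m = -prymPolarization H m l := by
  rw [prymPolarization, prymPolarization, ← hermitianForm_conj, Complex.conj_im]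

/-- The polarization of the Prym variety as a bilinear form. -/
def prymForm (H : Subgroup G) :
    Module.Dual ℂ (formsMinus X H) →ₗ[ℝ] Module.Dual ℂ (formsMinus X H) →ₗ[ℝ] ℝ :=
  LinearMap.mk₂ ℝ (prymPolarization H)
    (fun l l' m => by simp [prymPolarization_apply])
    (fun r l m => by simp [prymPolarization_apply])
    (fun l m m' => by
      rw [prymPolarization_swap, prymPolarization_swap H l m, prymPolarization_swap H l m']
      simp [prymPolarization_apply]
      ring)
    (fun r l m => by
      rw [prymPolarization_swap, prymPolarization_swap H l m]
      simp [prymPolarization_apply])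

theorem prymForm_apply (H : Subgroup G) (l m : Module.Dual ℂ (formsMinus X H)) :
    prymForm H l m = prymPolarization H l m := rfl

theorem rieszRep_I_smul {H : Subgroup G} (l : Module.Dual ℂ (formsMinus X H)) :
    rieszRep (Complex.I • l) = -(Complex.I • rieszRep l) := by
  apply (bijective_hermitianDual H).1
  rw [hermitianDual_rieszRep, map_neg, hermitianDual_smul, hermitianDual_rieszRep, Complex.conj_I,
    neg_smul, neg_neg]

theorem dualStructure_mem_siegelSpace (H : Subgroup G) :
    dualStructure (formsMinus X H) ∈ SiegelSpace (fun l m => prymForm H l m) := by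
  refine ⟨?_, fun l m => ?_, fun l hl => ?_⟩
  · refine LinearMap.ext fun l => ?_
    change Complex.I • Complex.I • l = -l
    rw [smul_smul, Complex.I_mul_I, neg_one_smul]
  · simp only [prymForm_apply, dualStructure_apply, prymPolarization_apply, rieszRep_I_smul]
    simp
  · have h1 : rieszRep l ≠ 0 := fun h => hl (by rw [← hermitianDual_rieszRep l, h, map_zero])
    have h2 : l (rieszRep l) = hermitianForm (rieszRep l : HolomorphicOneForm X) (rieszRep l) := by
      conv_lhs => rw [← hermitianDual_rieszRep l]
      rw [rieszRep_hermitianDual]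
      rfl
    have h3 : prymForm H (dualStructure (formsMinus X H) l) l = (l (rieszRep l)).re := by
      simp [prymForm_apply, dualStructure_apply, prymPolarization_apply]
    have h4 : (hermitianForm (rieszRep l : HolomorphicOneForm X) (rieszRep l)).im = 0 := by
      have := congrArg Complex.im
        (hermitianForm_conj (rieszRep l : HolomorphicOneForm X) (rieszRep l))
      rw [Complex.conj_im] at this
      linarith
    simp only [h3, h2]
    refine (hermitianForm_self_nonneg _).lt_of_ne fun h => h1 (Subtype.ext ?_)
    exact eq_zero_of_hermitianForm_self (Complex.ext h.symm h4)

theorem dualStructure_mem_pelLocus (H : Subgroup G) :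
    dualStructure (formsMinus X H) ∈ pelLocus (fun l m => prymForm H l m) (dualAction H) :=
  mem_pelLocus_iff.2 ⟨dualStructure_mem_siegelSpace H,
    fun g l => ((minusPullback H g).dualMap.map_smul Complex.I l).symm⟩

/-- The Hermitian form is invariant, so that pulling back functionals along `g` corresponds to
pulling back forms along `g⁻¹`. -/
theorem dualAction_hermitianDual (H : Subgroup G) (g : G) (u : formsMinus X H) :
    dualAction H g (hermitianDual H u) = hermitianDual H (minusRep H g⁻¹ u) := by
  refine LinearMap.ext fun η => ?_
  have h1 : minusRep H g (minusRep H g⁻¹ u) = u := by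
    rw [← Module.End.mul_apply, ← map_mul, mul_inv_cancel, map_one, Module.End.one_apply]
  have h2 := hermitianForm_pullback g (η : HolomorphicOneForm X) (minusRep H g⁻¹ u)
  rw [hermitianDual_apply, ← h2]
  change hermitianForm (formPullback g (η : HolomorphicOneForm X)) (u : HolomorphicOneForm X) = _
  conv_lhs => rw [← h1]
  rfl

end PrymPolarization
end

theorem mainTheorem2 {X : Type*} [TopologicalSpace X] [T2Space X] [CompactSpace X]
    [ConnectedSpace X] [ChartedSpace ℂ X] [IsManifold 𝓘(ℂ) ω X]
    {G : Type*} [CommGroup G] [Finite G] [MulAction G X] [HolomorphicAction G X]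
    (H : Subgroup G) (d : (G →* ℂˣ) → ℕ)
    (hd : ∀ χ, d χ = Module.finrank ℂ (minusEigenspace X H χ)) :
    ∃ m : ℕ, HasComplexDim (prymPELSubvariety (X := X) H) m ∧
      (m : ℚ) = (1 / 2) * (∑ᶠ (χ : G →* ℂˣ) (_ : χ ^ 2 ≠ 1), (d χ : ℚ) * d χ⁻¹) +
        (1 / 2) * (∑ᶠ (χ : G →* ℂˣ) (_ : χ ^ 2 = 1), (d χ : ℚ) * (d χ + 1)) ∧
      m = Module.finrank ℂ (symSquareInvariants (minusPullback (X := X) H)) := by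
  have : FiniteDimensional ℝ (Module.Dual ℂ (formsMinus X H)) :=
    FiniteDimensional.complexToReal _
  refine ⟨Module.finrank ℂ (invariantSymmMaps (minusPullback (X := X) H)), ?_, ?_,
    finrank_invariantSymmMaps _⟩
  · obtain ⟨T, hT, hTI, hinj⟩ := exists_pelTangent_parametrization
      (bijective_hermitianDual (X := X) H) (hermitianDual_smul H) (B := prymForm H)
      (prymPolarization_swap H) (prymPolarization_hermitianDual H) (σ := minusRep H)
      (dualAction_hermitianDual H)
    exact hasComplexDim_pelSubvariety (B := prymForm H) (prymPolarization_swap H)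
      (countable_prymLattice H) (span_prymLattice H) (dualStructure_mem_pelLocus H) T hT hTI hinj
  · have h : 2 * (Module.finrank ℂ (invariantSymmMaps (minusPullback (X := X) H)) : ℚ) = _ :=
      two_mul_finrank_invariantSymmMaps (minusRep H) d hd
    linarith
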